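/- Let $n\ge 1$, $M=\operatorname{Spin}(2n)$, and let $\hat M$ be the set of equivalence classes of finite-dimensional irreducible (continuous complex) representations of $M$. With respect to the standard maximal torus of $M$, with standard coordinates $e_2,\dots,e_{n+1}$ and positive roots $e_i\pm e_j$ ($2\le i<j\le n+1$), write the highest weight of $\sigma\in\hat M$ as $k_2(\sigma)e_2+\dots+k_{n+1}(\sigma)e_{n+1}$, where the $k_j(\sigma)$ are all integers or all half-integers. Put $\rho_j=n+1-j$. Let $\check\sigma$ be the contragredient of $\sigma$, and let $w_0\sigma$ be the twist $m\mapsto\sigma(m_0^{-1}mm_0)$ of $\sigma$, where $m_0\in\operatorname{Spin}(2n+1)$ represents the nontrivial element $w_0$ of the restricted Weyl group of $\operatorname{Spin}(2n+1,1)$; equivalently, $\sigma$ is twisted by conjugation with a unit vector of $\mathbb R^{2n}$ in the Clifford algebra. Let $\mathfrak h_{\mathbb C}^*$ have the basis $e_1,\dots,e_{n+1}$ and the bilinear form $\langle\cdot,\cdot\rangle$ induced by the Killing form of $\mathfrak{so}(2n+2,\mathbb C)$ (for which the $e_i$ are orthogonal and of equal length). For a root $\alpha$ let $H_\alpha$ be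 its coroot, so that $x(H_\alpha)=2\langle x,\alpha\rangle/\langle\alpha,\alpha\rangle$, and let $s_\alpha(x)=x-x(H_\alpha)\alpha$. Put $\Pi(x)=\prod_{2\le i<j\le n+1}x(H_{e_i+e_j})\,x(H_{e_i-e_j})$, $\rho_M=\sum_{j=2}^{n+1}\rho_je_j$ and, for $\lambda\in\mathbb R$, $\lambda_\sigma=i\lambda e_1+\sum_{j=2}^{n+1}(k_j(\sigma)+\rho_j)e_j$. Hoffmann's function is $$\Omega(\sigma,\lambda)=-2\dim(\sigma)\gamma-\frac12\sum_{\alpha\in\{e_1\pm e_j\,:\,2\le j\le n+1\}}\frac{\Pi(s_\alpha\lambda_\sigma)}{\Pi(\rho_M)}\bigl(\psi(1+\lambda_\sigma(H_\alpha))+\psi(1-\lambda_\sigma(H_\alpha))\bigr),$$ where $\psi$ is the digamma function and $\gamma$ is the Euler–Mascheroni constant; at $\lambda=0$, where poles of the individual terms cancel, the value is the limit for $\lambda\to0$. **Proposition.** (1) Let $\sigma\in\hat M$ be such that all $k_j=k_j(\sigma)$ are integers, and let $m_0:=|k_{n+1}|$. Then there exist an even polynomial $Q(\sigma,\lambda)$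 in $\lambda$ with real coefficients, of degree $\le 2n-4$ (so $Q=0$ if $n=1$), and, for every $j=2,\dots,n+1$ and every integer $l$ with $m_0\le l<|k_j|+\rho_j$, an integer $c_{j,l}(\sigma)$, such that for all $\lambda\in\mathbb R$ $$\begin{aligned}\Omega(\sigma,\lambda)=&-\dim(\sigma)\Bigl(2\gamma+\psi(1+i\lambda)+\psi(1-i\lambda)+\sum_{1\le l<m_0}\frac{2l}{\lambda^2+l^2}\Bigr)-\sum_{j=2}^{n+1}\ \sum_{m_0\le l<|k_j|+\rho_j}c_{j,l}(\sigma)\frac{2l}{\lambda^2+l^2}\\&-\sum_{j=2}^{n+1}\dim(\sigma)\frac{|k_j|+\rho_j}{(|k_j|+\rho_j)^2+\lambda^2}-Q(\sigma,\lambda),\end{aligned}$$ where fractions with numerator $0$ are read as $0$. The polynomial $Q(\sigma,\cdot)$ is uniquely determined by $\sigma$, and $Q(\sigma,\lambda)=Q(w_0\sigma,\lambda)$. (2) For every $\sigma\in\hat M$ (with integral or half-integral highest weight) and every $\lambda\in\mathbb R$ one has $\Omega(\sigma,\lambda)=\Omega(w_0\sigma,\lambda)=\Omega(\check\sigma,\lambda)$.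 -/

import Mathlib

open scoped Topology

noncomputable section

namespace HoffmannOmega

/-! ### The group `M = Spin(2n)` -/

/-- The standard positive definite quadratic form `∑ x_{j,a}²` on `ℝ^{2n}`; the coordinates are
grouped into the `n` planes `{j} × {0, 1}`. -/
def sqForm (n : ℕ) : QuadraticForm ℝ (Fin n × Fin 2 → ℝ) :=
  QuadraticMap.weightedSumSquares ℝ (fun _ : Fin n × Fin 2 => (1 : ℝ))

/-- The compact group `Spin(2n)`, inside the Clifford algebra of `ℝ^{2n}`. -/
abbrev Spin (n : ℕ) : Submonoid (CliffordAlgebra (sqForm n)) := spinGroup (sqForm n)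

/-- `Spin(2n)` carries the subspace topology of the Clifford algebra, a finite-dimensional real
vector space with its canonical topology. -/
instance spinTopology (n : ℕ) : TopologicalSpace (Spin n) :=
  TopologicalSpace.induced Subtype.val (moduleTopology ℝ (CliffordAlgebra (sqForm n)))

/-- The vector `x ∈ ℝ^{2n}` as an element of the Clifford algebra. -/
abbrev vec {n : ℕ} (x : Fin n × Fin 2 → ℝ) : CliffordAlgebra (sqForm n) :=
  CliffordAlgebra.ι (sqForm n) x

/-- The standard orthonormal basis vectors of `ℝ^{2n}`, in the Clifford algebra. -/
def e {n : ℕ} (j : Fin n) (a : Fin 2) : CliffordAlgebra (sqForm n) :=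
  vec (Pi.single (j, a) 1)

theorem sqForm_apply {n : ℕ} (x : Fin n × Fin 2 → ℝ) : sqForm n x = ∑ p, x p * x p := by
  simp [sqForm, QuadraticMap.weightedSumSquares_apply]

theorem sqForm_single {n : ℕ} (p : Fin n × Fin 2) : sqForm n (Pi.single p 1) = 1 := by
  rw [sqForm_apply]
  simp [Pi.single_apply]

theorem vec_mul_self {n : ℕ} {x : Fin n × Fin 2 → ℝ} (hx : sqForm n x = 1) :
    vec x * vec x = 1 := by
  rw [CliffordAlgebra.ι_sq_scalar, hx, map_one]

/-- A unit vector as a unit of the Clifford algebra. -/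
def vecUnit {n : ℕ} {x : Fin n × Fin 2 → ℝ} (hx : sqForm n x = 1) :
    (CliffordAlgebra (sqForm n))ˣ :=
  ⟨vec x, vec x, vec_mul_self hx, vec_mul_self hx⟩

theorem vecUnit_mem {n : ℕ} {x : Fin n × Fin 2 → ℝ} (hx : sqForm n x = 1) :
    vecUnit hx ∈ lipschitzGroup (sqForm n) :=
  Subgroup.subset_closure ⟨x, rfl⟩

theorem star_vec {n : ℕ} (x : Fin n × Fin 2 → ℝ) : star (vec x) = -vec x := by
  rw [CliffordAlgebra.star_def]
  simp

/-- The product of two unit vectors lies in the spin group. -/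
theorem vec_mul_vec_mem {n : ℕ} {x y : Fin n × Fin 2 → ℝ} (hx : sqForm n x = 1)
    (hy : sqForm n y = 1) : vec x * vec y ∈ Spin n := by
  have h1 := vec_mul_self hx
  have h2 := vec_mul_self hy
  refine ⟨⟨⟨vecUnit hx * vecUnit hy, mul_mem (vecUnit_mem hx) (vecUnit_mem hy), rfl⟩, ?_⟩,
    CliffordAlgebra.ι_mul_ι_mem_evenOdd_zero _ _ _⟩
  rw [SetLike.mem_coe, Unitary.mem_iff, star_mul, star_vec, star_vec]
  constructor
  · calc -vec y * -vec x * (vec x * vec y) = vec y * (vec x * vec x) * vec y := by noncomm_ring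
      _ = 1 := by rw [h1, mul_one, h2]
  · calc vec x * vec y * (-vec y * -vec x) = vec x * (vec y * vec y) * vec x := by noncomm_ring
      _ = 1 := by rw [h2, mul_one, h1]

/-- Conjugation by a unit vector preserves the spin group. -/
theorem conj_mem {n : ℕ} {x : Fin n × Fin 2 → ℝ} (hx : sqForm n x = 1)
    {m : CliffordAlgebra (sqForm n)} (hm : m ∈ Spin n) : vec x * m * vec x ∈ Spin n := by
  have h1 := vec_mul_self hx
  obtain ⟨⟨⟨u, hu, rfl⟩, hm2⟩, hm3⟩ := hm
  refine ⟨⟨⟨vecUnit hx * u * vecUnit hx,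
    mul_mem (mul_mem (vecUnit_mem hx) hu) (vecUnit_mem hx), rfl⟩, ?_⟩, ?_⟩
  · simp only [Units.coeHom_apply] at hm2 ⊢
    rw [SetLike.mem_coe, Unitary.mem_iff] at hm2 ⊢
    obtain ⟨ha, hb⟩ := hm2
    rw [star_mul, star_mul, star_vec]
    constructor
    · calc -vec x * (star (u : CliffordAlgebra (sqForm n)) * -vec x) * (vec x * u * vec x)
          = vec x * (star (u : CliffordAlgebra (sqForm n)) * (vec x * vec x) * u) * vec x := by
            noncomm_ring
        _ = 1 := by rw [h1, mul_one, ha, mul_one, h1]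
    · calc vec x * u * vec x * (-vec x * (star (u : CliffordAlgebra (sqForm n)) * -vec x))
          = vec x * (u * (vec x * vec x) * star (u : CliffordAlgebra (sqForm n))) * vec x := by
            noncomm_ring
        _ = 1 := by rw [h1, mul_one, hb, mul_one, h1]
  · have hv := CliffordAlgebra.ι_mem_evenOdd_one (sqForm n) x
    have h3 := CliffordAlgebra.evenOdd_mul_le (sqForm n) (1 + 0) 1 (Submodule.mul_mem_mul
      (CliffordAlgebra.evenOdd_mul_le (sqForm n) 1 0 (Submodule.mul_mem_mul hv hm3)) hv)
    have h4 : (1 + 0 + 1 : ZMod 2) = 0 := by decide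
    rw [h4] at h3
    exact h3

/-- The element `cos (θ/2) + sin (θ/2) e_{j,1} e_{j,0}` of the maximal torus of `Spin(2n)`; it covers
the rotation by the angle `θ` in the `j`-th coordinate plane. -/
def torusElt {n : ℕ} (j : Fin n) (θ : ℝ) : Spin n :=
  ⟨algebraMap ℝ _ (Real.cos (θ / 2)) + Real.sin (θ / 2) • (e j 1 * e j 0), by
    have h : algebraMap ℝ _ (Real.cos (θ / 2)) + Real.sin (θ / 2) • (e j 1 * e j 0) =
        vec (Pi.single (j, 1) 1) * vec (Real.cos (θ / 2) • Pi.single (j, 1) 1 +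
          Real.sin (θ / 2) • Pi.single (j, 0) 1) := by
      rw [vec, vec, LinearMap.map_add, LinearMap.map_smul, LinearMap.map_smul, mul_add, mul_smul_comm, mul_smul_comm,
        vec_mul_self (sqForm_single _), Algebra.algebraMap_eq_smul_one]
      rfl
    rw [h]
    refine vec_mul_vec_mem (sqForm_single _) ?_
    rw [sqForm_apply, Fintype.sum_prod_type, Finset.sum_eq_single j]
    · simp [Fin.sum_univ_two, Pi.single_apply]
      nlinarith [Real.sin_sq_add_cos_sq (θ / 2)]
    · intro b _ hb
      simp [hb]
    · simp⟩

/-- The last index, which belongs to the coordinate `k_{n+1}`. -/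
def lastIdx (n : ℕ) [NeZero n] : Fin n := ⟨n - 1, Nat.sub_lt (NeZero.pos n) one_pos⟩

/-- The automorphism `m ↦ m₀⁻¹ m m₀` of `M = Spin(2n)`, where `m₀ = e₀ v ∈ K = Spin(2n+1)`
represents the nontrivial element `w₀` of the restricted Weyl group; `e₀` spans the direction of
`ℝ^{2n+1}` orthogonal to `ℝ^{2n}` and `v` is a basis vector of `ℝ^{2n}`.  As `e₀` commutes with all
even elements of the Clifford algebra of `ℝ^{2n}` and `v⁻¹ = v`, this is `m ↦ v m v`. -/
def w0Aut (n : ℕ) [NeZero n] : Spin n →* Spin n where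
  toFun m := ⟨e (lastIdx n) 0 * m * e (lastIdx n) 0, conj_mem (sqForm_single _) m.2⟩
  map_one' := Subtype.ext (by simpa [e] using vec_mul_self (sqForm_single (lastIdx n, (0 : Fin 2))))
  map_mul' a b := Subtype.ext (by
    have h : e (lastIdx n) 0 * e (lastIdx n) 0 = 1 := vec_mul_self (sqForm_single _)
    change e (lastIdx n) 0 * ((a : CliffordAlgebra (sqForm n)) * b) * e (lastIdx n) 0 =
      e (lastIdx n) 0 * a * e (lastIdx n) 0 * (e (lastIdx n) 0 * b * e (lastIdx n) 0)
    calc e (lastIdx n) 0 * ((a : CliffordAlgebra (sqForm n)) * b) * e (lastIdx n) 0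
        = e (lastIdx n) 0 * a * 1 * b * e (lastIdx n) 0 := by noncomm_ring
      _ = _ := by rw [← h]; noncomm_ring)

/-! ### Representations of `M` and their highest weights -/

section Rep

variable {n : ℕ} {V : Type*} [AddCommGroup V] [Module ℂ V]

/-- Continuity of a (finite-dimensional) representation: all matrix coefficients are continuous. -/
def IsContinuousRep (σ : Representation ℂ (Spin n) V) : Prop :=
  ∀ (v : V) (f : Module.Dual ℂ V), Continuous fun m : Spin n => f (σ m v)

/-- The representation `w₀σ`, that is, `m ↦ σ (m₀⁻¹ m m₀)`. -/
def w0Rep [NeZero n] (σ : Representation ℂ (Spin n) V) : Representation ℂ (Spin n) V :=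
  σ.comp (w0Aut n)

/-- `μ = ∑ μ_j e_j` is a weight of `σ`: there is a nonzero simultaneous eigenvector on which the
rotation by `θ` in the `j`-th plane acts by `exp (i μ_j θ)`. -/
def IsWeight (σ : Representation ℂ (Spin n) V) (μ : Fin n → ℝ) : Prop :=
  ∃ v : V, v ≠ 0 ∧ ∀ (j : Fin n) (θ : ℝ),
    σ (torusElt j θ) v = Complex.exp (Complex.I * μ j * θ) • v

end Rep

/-- The positive roots `e_i + e_j`, `e_i - e_j`, `i < j`, of the root system `D_r`, in the
coordinates `e_0, …, e_{r-1}`. -/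
def posRoots (r : ℕ) : Finset (Fin r → ℤ) :=
  ((Finset.univ.filter fun p : Fin r × Fin r => p.1 < p.2).image
      fun p => Pi.single p.1 1 + Pi.single p.2 1) ∪
    ((Finset.univ.filter fun p : Fin r × Fin r => p.1 < p.2).image
      fun p => Pi.single p.1 1 - Pi.single p.2 1)

section Rep

variable {n : ℕ} {V : Type*} [AddCommGroup V] [Module ℂ V]

/-- `Λ` is the highest weight of `σ`: it is a weight, and every weight is obtained from `Λ` by
subtracting a sum of positive roots of `M`. -/
def IsHighestWeight (σ : Representation ℂ (Spin n) V) (Λ : Fin n → ℝ) : Prop :=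
  IsWeight σ Λ ∧ ∀ μ, IsWeight σ μ →
    ∃ c : (Fin n → ℤ) → ℕ, ∀ i, Λ i - μ i = ∑ α ∈ posRoots n, (c α : ℝ) * (α i : ℝ)

open Classical in
/-- The highest weight of `σ` (every irreducible `σ` has exactly one). -/
def highestWeight (σ : Representation ℂ (Spin n) V) : Fin n → ℝ :=
  if h : ∃ Λ, IsHighestWeight σ Λ then h.choose else 0

end Rep

/-! ### The function `Ω`

Elements of `𝔥_ℂ^*`, of dimension `n + 1`, are written in the basis `e_1, …, e_{n+1}`, which is
indexed here by `Fin (n + 1)`: `e_1`, the restricted root, has index `0`.  The index `j : Fin n` of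
a weight of `M` stands for `e_{j+2}`. -/

/-- The `i`-th coordinate of the half sum of the positive roots of `D_r`. -/
def rho (r : ℕ) (i : Fin r) : ℕ := r - 1 - i

/-- The bilinear form on `𝔥_ℂ^*` induced by the Killing form of `𝔤_ℂ = 𝔰𝔬(2n+2, ℂ)`: since the
Killing form of `∑ x_i H_i` with itself is `4 n ∑ x_i ^ 2`, the `e_i` are orthogonal with square
`1 / (4 n)`. -/
def killing {n : ℕ} (x y : Fin (n + 1) → ℂ) : ℂ := (1 / (4 * n)) * ∑ i, x i * y i

/-- A root as an element of `𝔥_ℂ^*`. -/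
def toDual {n : ℕ} (α : Fin (n + 1) → ℤ) : Fin (n + 1) → ℂ := fun i => (α i : ℂ)

/-- The value `x (H_α) = 2 ⟨x, α⟩ / ⟨α, α⟩` of `x ∈ 𝔥_ℂ^*` at the coroot `H_α`. -/
def atCoroot {n : ℕ} (x : Fin (n + 1) → ℂ) (α : Fin (n + 1) → ℤ) : ℂ :=
  2 * killing x (toDual α) / killing (toDual α) (toDual α)

/-- The reflection `s_α x = x - 2 ⟨x, α⟩ / ⟨α, α⟩ α`. -/
def reflect {n : ℕ} (α : Fin (n + 1) → ℤ) (x : Fin (n + 1) → ℂ) : Fin (n + 1) → ℂ :=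
  x - (2 * killing x (toDual α) / killing (toDual α) (toDual α)) • toDual α

/-- `Δ⁺(𝔪_ℂ, 𝔟_ℂ)`: the positive roots that vanish on `𝔞`. -/
def posRootsM (n : ℕ) : Finset (Fin (n + 1) → ℤ) := (posRoots (n + 1)).filter fun α => α 0 = 0

/-- `Δ⁺(𝔤_ℂ, 𝔞_ℂ)`: the positive roots that do not vanish on `𝔞`. -/
def posRootsA (n : ℕ) : Finset (Fin (n + 1) → ℤ) := (posRoots (n + 1)).filter fun α => α 0 ≠ 0

/-- `Π = ∏ H_α`, over the positive roots of `𝔪`, as a polynomial function on `𝔥_ℂ^*`. -/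
def bigPi {n : ℕ} (x : Fin (n + 1) → ℂ) : ℂ := ∏ α ∈ posRootsM n, atCoroot x α

/-- `ρ_M`, extended by zero to `𝔥_ℂ`. -/
def rhoM (n : ℕ) : Fin (n + 1) → ℂ := Fin.cons 0 fun j => (rho n j : ℂ)

/-- `λ_σ = i λ e_1 + ∑_{j ≥ 2} (k_j + ρ_j) e_j`. -/
def lamSigma {n : ℕ} (k : Fin n → ℝ) (lam : ℝ) : Fin (n + 1) → ℂ :=
  Fin.cons (Complex.I * lam) fun j => (k j : ℂ) + (rho n j : ℂ)

/-- The explicit expression for `Ω(σ, λ)` in terms of `d = dim σ` and the highest weight `k`. -/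
def omegaExpr {n : ℕ} (d : ℕ) (k : Fin n → ℝ) (lam : ℝ) : ℂ :=
  -2 * d * (Real.eulerMascheroniConstant : ℂ) -
    (1 / 2) * ∑ α ∈ posRootsA n,
      bigPi (reflect α (lamSigma k lam)) / bigPi (rhoM n) *
        (Complex.digamma (1 + atCoroot (lamSigma k lam) α) +
          Complex.digamma (1 - atCoroot (lamSigma k lam) α))

/-- The function `Ω(σ, λ)`, `λ ∈ ℝ`.  At `λ = 0` single digamma terms may have poles, which cancel
in the sum; the value there is the limit for `λ → 0`. -/
def Omega {n : ℕ} {V : Type*} [AddCommGroup V] [Module ℂ V]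
    (σ : Representation ℂ (Spin n) V) (lam : ℝ) : ℂ :=
  Function.update (omegaExpr (Module.finrank ℂ V) (highestWeight σ)) 0
    (Filter.limUnder (𝓝[≠] (0 : ℝ)) (omegaExpr (Module.finrank ℂ V) (highestWeight σ))) lam

/-- `Q` and the integers `c j l` provide the decomposition of `Ω(σ, ·)`, where `k` is the integral
highest weight of `σ`.  Only the `c j l` with `m₀ ≤ l < |k_j| + ρ_j` occur. -/
structure IsDecomposition {n : ℕ} [NeZero n] {V : Type*} [AddCommGroup V] [Module ℂ V]
    (σ : Representation ℂ (Spin n) V) (k : Fin n → ℤ) (Q : Polynomial ℝ)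
    (c : Fin n → ℕ → ℤ) : Prop where
  even : ∀ lam : ℝ, Q.eval (-lam) = Q.eval lam
  degree_le : Q = 0 ∨ Q.natDegree + 4 ≤ 2 * n
  formula : ∀ lam : ℝ, Omega σ lam =
    -(Module.finrank ℂ V : ℂ) * (2 * (Real.eulerMascheroniConstant : ℂ) +
        Complex.digamma (1 + Complex.I * lam) + Complex.digamma (1 - Complex.I * lam) +
        ∑ l ∈ Finset.Ico 1 (k (lastIdx n)).natAbs, 2 * (l : ℂ) / ((lam : ℂ) ^ 2 + (l : ℂ) ^ 2)) -
      ∑ j, ∑ l ∈ Finset.Ico (k (lastIdx n)).natAbs ((k j).natAbs + rho n j),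
        (c j l : ℂ) * (2 * (l : ℂ) / ((lam : ℂ) ^ 2 + (l : ℂ) ^ 2)) -
      ∑ j, (Module.finrank ℂ V : ℂ) * (((k j).natAbs + rho n j : ℕ) : ℂ) /
        ((((k j).natAbs + rho n j : ℕ) : ℂ) ^ 2 + (lam : ℂ) ^ 2) -
      ((Q.eval lam : ℝ) : ℂ)

end HoffmannOmega

end

/-!
For `λ ≠ 0` the function `Ω(σ, λ)` is a sum over the coordinates `j` of digamma values with the
coefficient `Π(s_α λ_σ) / Π(ρ_M)`, where `α = e_1 ± e_j`.  Let `b_j = |k_j| + ρ_j`.  Up to a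
constant, `Π(s_α λ_σ)` is `∏_{i ≠ j} (-λ² - b_i²)`, and Weyl's dimension formula, read as
`Π(ρ_M + k) = dim σ · Π(ρ_M)`, identifies the coefficient with the value at `X = -λ²` of `dim σ`
times the Lagrange basis polynomial of the nodes `b_i²` (`rootProd_div_eq`).  The recurrence of the
digamma function turns the four digamma values of `j` into `ψ(1 + iλ) + ψ(1 - iλ)` and the fractions
`2 l / (λ² + l²)`, `l < b_j`, and half of the fraction `l = b_j` (`psiSum_natCast`).  The Lagrange
polynomials add up to `dim σ`, so all that is common to the indices `j` gets the coefficient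
`dim σ`. In the remaining terms, division of the Lagrange polynomial by `X - l²` leaves its value at
`l²` as coefficient of the fraction, and the quotients, of degree at most `n - 2` in `λ²`, make up
`Q` (`omegaExpr_eq_decompExpr`).  At `l = b_j` the value is `dim σ`; at the other `l` it is a
quotient of two root products, which is an integer because the root product of `ρ` divides that of
any integral weight (`rootProd_rho_dvd`).  All fractions vanish at infinity, so `Q` is unique.

The invariance under `w₀` and contragredients is a matter of weights: `w₀` changes the sign of the
last coordinate, where `ρ` is zero, and `Ω` depends only on the squares of the coordinates
`k_j + ρ_j`; the weights of the contragredient are those of `σ` or of `w₀σ`, depending on the parity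
of `n` (`highestWeight_dual`).

Weyl's dimension formula requires the structure of the representation `σ` of the group.
One-parameter groups in a Banach algebra have generators (`exists_generator`), and the generators
`X_{pq}` of the rotations in coordinate planes satisfy the relations of `𝔰𝔬(2n)` (`rotGen_lie`);
these follow from identities between unit quaternions, which hold in `Spin(2n)`.  Coordinate
rotations generate `Spin(2n)` (`mem_rotSubgroup`), so subspaces stable under the generators are
subrepresentations, and the Casimir operator is a scalar by Schur's lemma.  Its formal trace then
shows that the product of the Weyl denominator and the character is an eigenfunction of the Laplace
operator on the group algebra of the weight lattice (`WeightBasis.laplace_mul_char`).  The product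
is alternating under the Weyl group and has the leading term `e^{ρ + k}`, so it is the alternating
sum of the exponentials of the orbit of `ρ + k` (`WeightBasis.weylDenom_mul_char`).  The dimension
formula (`finrank_mul_rootProd`) follows by evaluation at `s ρ` for `s → 0`.
-/

noncomputable section

namespace HoffmannOmega

/-! ### One-parameter groups in Banach algebras -/

section OneParameter

variable {𝔸 : Type*} [NormedRing 𝔸] [NormedAlgebra ℝ 𝔸] [CompleteSpace 𝔸]

theorem hasDerivAt_exp_smul (A : 𝔸) (t : ℝ) :
    HasDerivAt (fun s : ℝ => NormedSpace.exp (s • A)) (NormedSpace.exp (t • A) * A) t :=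
  hasDerivAt_exp_smul_const A t

theorem hasDerivAt_exp_smul' (A : 𝔸) (t : ℝ) :
    HasDerivAt (fun s : ℝ => NormedSpace.exp (s • A)) (A * NormedSpace.exp (t • A)) t :=
  hasDerivAt_exp_smul_const' A t

theorem hasDerivAt_exp_neg_smul (A : 𝔸) (t : ℝ) :
    HasDerivAt (fun s : ℝ => NormedSpace.exp (-s • A)) (-(A * NormedSpace.exp (-t • A))) t := by
  have h := (hasDerivAt_exp_smul' A (-t)).scomp t (hasDerivAt_neg t)
  simpa [Function.comp_def] using h

theorem exp_smul_mul_exp_neg_smul (A : 𝔸) (t : ℝ) :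
    NormedSpace.exp (t • A) * NormedSpace.exp (-t • A) = 1 := by
  let _ : NormedAlgebra ℚ 𝔸 := NormedAlgebra.restrictScalars ℚ ℝ 𝔸
  rw [← NormedSpace.exp_add_of_commute]
  · simp
  · exact ((Commute.refl A).smul_left t).smul_right (-t)

theorem exp_neg_smul_mul_exp_smul (A : 𝔸) (t : ℝ) :
    NormedSpace.exp (-t • A) * NormedSpace.exp (t • A) = 1 := by
  simpa using exp_smul_mul_exp_neg_smul A (-t)

theorem eq_of_hasDerivAt_zero {E : Type*} [NormedAddCommGroup E] [NormedSpace ℝ E] {f : ℝ → E}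
    (h : ∀ t, HasDerivAt f 0 t) (s t : ℝ) : f s = f t :=
  is_const_of_deriv_eq_zero (fun t => (h t).differentiableAt) (fun t => (h t).deriv) s t

/-- A continuous one-parameter group in a Banach algebra is `t ↦ exp (t A)`.  The function
`t ↦ U t * ∫₀^ε U = ∫_t^{t+ε} U` is differentiable, and `∫₀^ε U` is invertible for small `ε`. -/
theorem exists_generator (U : ℝ → 𝔸) (hc : Continuous U) (h0 : U 0 = 1)
    (hadd : ∀ s t, U (s + t) = U s * U t) : ∃ A : 𝔸, ∀ t, U t = NormedSpace.exp (t • A) := by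
  have hint : ∀ a b : ℝ, IntervalIntegrable U MeasureTheory.volume a b :=
    fun a b => hc.intervalIntegrable a b
  have hD : ∀ b : ℝ, HasDerivAt (fun u => ∫ x in (0 : ℝ)..u, U x) (U b) b := fun b =>
    intervalIntegral.integral_hasDerivAt_right (hint _ _) (hc.stronglyMeasurableAtFilter _ _)
      hc.continuousAt
  obtain ⟨ε, J, hJ⟩ : ∃ (ε : ℝ) (J : 𝔸ˣ), (J : 𝔸) = ∫ x in (0 : ℝ)..ε, U x := by
    have h := (hD 0).tendsto_slope
    have hopen : {x : 𝔸 | IsUnit x} ∈ 𝓝 (U 0) := by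
      rw [h0]; exact Units.isOpen.mem_nhds isUnit_one
    have h2 := (h.eventually hopen).and self_mem_nhdsWithin
    obtain ⟨ε, ⟨u, hu⟩, hε⟩ := h2.exists
    have hε' : ε ≠ 0 := hε
    rw [slope_def_module] at hu
    simp only [intervalIntegral.integral_same, sub_zero] at hu
    refine ⟨ε, Units.mk0 ε hε' • u, ?_⟩
    rw [Units.val_smul, hu, Units.smul_def, Units.val_mk0, smul_smul, mul_inv_cancel₀ hε', one_smul]
  have hU : ∀ t, U t = ((∫ x in (0 : ℝ)..(t + ε), U x) - ∫ x in (0 : ℝ)..t, U x) * ↑J⁻¹ := by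
    intro t
    rw [intervalIntegral.integral_interval_sub_left (hint _ _) (hint _ _),
      Units.eq_mul_inv_iff_mul_eq, hJ]
    calc U t * ∫ x in (0 : ℝ)..ε, U x = ∫ x in (0 : ℝ)..ε, U t * U x :=
          ((ContinuousLinearMap.mul ℝ 𝔸 (U t)).intervalIntegral_comp_comm (hint 0 ε)).symm
      _ = ∫ x in (0 : ℝ)..ε, U (t + x) := by simp only [hadd]
      _ = _ := by rw [intervalIntegral.integral_comp_add_left, add_zero]
  set A : 𝔸 := (U ε - 1) * ↑J⁻¹ with hA
  have hUd : ∀ t, HasDerivAt U (U t * A) t := by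
    intro t
    have h1 := (((hD (t + ε)).comp_add_const t ε).sub (hD t)).mul_const (↑J⁻¹ : 𝔸)
    have h2 : U t * A = (U (t + ε) - U t) * ↑J⁻¹ := by
      rw [hA, hadd]; noncomm_ring
    rw [h2]
    exact h1.congr_of_eventuallyEq (Filter.Eventually.of_forall hU)
  -- `U` solves `U' = U A`, so `U t * exp (-t A)` is constant.
  refine ⟨A, fun t => ?_⟩
  have hz : ∀ t, HasDerivAt (fun s => U s * NormedSpace.exp (-s • A)) 0 t := by
    intro t
    have h := (hUd t).mul (hasDerivAt_exp_neg_smul A t)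
    have h3 : U t * A * NormedSpace.exp (-t • A) + U t * -(A * NormedSpace.exp (-t • A)) = 0 := by
      noncomm_ring
    rwa [h3] at h
  have h4 := eq_of_hasDerivAt_zero hz t 0
  simp only [h0, neg_zero, zero_smul, NormedSpace.exp_zero, mul_one] at h4
  calc U t = U t * (NormedSpace.exp (-t • A) * NormedSpace.exp (t • A)) := by
        rw [exp_neg_smul_mul_exp_smul, mul_one]
    _ = _ := by rw [← mul_assoc, h4, one_mul]

/-- If `Ad (exp φA) B + Ad (exp (-φA)) B = 2 cos (2φ) B` for small `φ`, then `ad(A)² B = -4 B`, so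
`B` and `[A, B] / 2` rotate into each other under `Ad (exp sA)`. -/
theorem half_commutator_eq (A B : 𝔸) (δ : ℝ) (hδ : 0 < δ)
    (h : ∀ φ : ℝ, |φ| < δ →
      NormedSpace.exp (φ • A) * B * NormedSpace.exp (-φ • A) +
        NormedSpace.exp (-φ • A) * B * NormedSpace.exp (φ • A) =
      (2 * Real.cos (2 * φ)) • B) :
    A * B - B * A =
      (2 : ℝ) • (NormedSpace.exp ((Real.pi / 4) • A) * B * NormedSpace.exp (-(Real.pi / 4) • A)) := by
  set E : ℝ → 𝔸 := fun s => NormedSpace.exp (s • A) with hE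
  have hAd : ∀ (C : 𝔸) (s : ℝ), HasDerivAt (fun s => E s * C * E (-s))
      (E s * (A * C - C * A) * E (-s)) s := by
    intro C s
    have := ((hasDerivAt_exp_smul A s).mul_const C).mul (hasDerivAt_exp_neg_smul A s)
    refine this.congr_deriv ?_
    simp only [hE]; noncomm_ring
  have hAd' : ∀ (C : 𝔸) (s : ℝ), HasDerivAt (fun s => E (-s) * C * E s)
      (-(E (-s) * (A * C - C * A) * E s)) s := by
    intro C s
    have := (hAd C (-s)).scomp s (hasDerivAt_neg s)
    simpa [Function.comp_def] using this
  have hEv : ∀ φ : ℝ, |φ| < δ → ∀ᶠ x in 𝓝 φ, |x| < δ := fun φ hφ =>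
    (continuous_abs.tendsto φ).eventually (gt_mem_nhds hφ)
  -- The first two derivatives of the hypothesis; the second one is needed only at `φ = 0`.
  have h1 : ∀ φ : ℝ, |φ| < δ → E φ * (A * B - B * A) * E (-φ) +
      -(E (-φ) * (A * B - B * A) * E φ) = (-4 * Real.sin (2 * φ)) • B := by
    intro φ hφ
    have hd1 := (hAd B φ).add (hAd' B φ)
    have hd2 :
        HasDerivAt (fun φ => (2 * Real.cos (2 * φ)) • B) ((-4 * Real.sin (2 * φ)) • B) φ := by
      have : HasDerivAt (fun φ => 2 * Real.cos (2 * φ)) (2 * (-Real.sin (2 * φ) * (2 * 1))) φ :=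
        ((hasDerivAt_id φ).const_mul 2).cos.const_mul 2
      have := this.smul_const B
      refine this.congr_deriv ?_
      congr 1; ring
    refine hd1.unique (hd2.congr_of_eventuallyEq ?_)
    filter_upwards [hEv φ hφ] with x hx using h x hx
  have h2 : A * (A * B - B * A) - (A * B - B * A) * A = (-4 : ℝ) • B := by
    have h0 : |(0 : ℝ)| < δ := by simpa using hδ
    have hd1 := (hAd (A * B - B * A) 0).add (hAd' (A * B - B * A) 0).neg
    have hd2 : HasDerivAt (fun φ => (-4 * Real.sin (2 * φ)) • B) ((-8 : ℝ) • B) 0 := by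
      have : HasDerivAt (fun φ => -4 * Real.sin (2 * φ)) (-4 * (Real.cos (2 * 0) * (2 * 1))) 0 :=
        ((hasDerivAt_id (0 : ℝ)).const_mul 2).sin.const_mul (-4)
      have := this.smul_const B
      refine this.congr_deriv ?_
      congr 1; simp; norm_num
    have h3 := hd1.unique (hd2.congr_of_eventuallyEq (by
      filter_upwards [hEv 0 h0] with x hx using h1 x hx))
    simp only [hE, neg_zero, zero_smul, NormedSpace.exp_zero, one_mul, mul_one, neg_neg] at h3
    have h4 : (2 : ℝ) • (A * (A * B - B * A) - (A * B - B * A) * A) = (2 : ℝ) • ((-4 : ℝ) • B) := by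
      rw [two_smul, h3, smul_smul]; norm_num
    exact smul_right_injective 𝔸 (two_ne_zero' ℝ) h4
  -- The `B`-component of the rotating vector `Ad (exp sA) B` is constant in the rotating frame.
  have hY : ∀ s, HasDerivAt (fun s => Real.cos (2 * s) • (E (-s) * B * E s) +
      ((1 / 2) * Real.sin (2 * s)) • (E (-s) * (A * B - B * A) * E s)) 0 s := by
    intro s
    have hc : HasDerivAt (fun φ => Real.cos (2 * φ)) (-Real.sin (2 * s) * (2 * 1)) s :=
      ((hasDerivAt_id s).const_mul 2).cos
    have hs : HasDerivAt (fun φ => 1 / 2 * Real.sin (2 * φ)) (1 / 2 * (Real.cos (2 * s) *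
        (2 * 1))) s :=
      ((hasDerivAt_id s).const_mul 2).sin.const_mul (1 / 2)
    have := (hc.smul (hAd' B s)).add (hs.smul (hAd' (A * B - B * A) s))
    refine this.congr_deriv ?_
    rw [h2]
    simp only [mul_smul_comm, smul_mul_assoc]
    module
  have hYc := eq_of_hasDerivAt_zero hY (Real.pi / 4) 0
  have e1 : 2 * (Real.pi / 4) = Real.pi / 2 := by ring
  simp only [e1, Real.cos_pi_div_two, Real.sin_pi_div_two, zero_smul, zero_add, mul_zero,
      Real.cos_zero,
    Real.sin_zero, add_zero, one_smul, neg_zero, hE, NormedSpace.exp_zero, one_mul, mul_one] at hYc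
  have e2 := exp_smul_mul_exp_neg_smul A (Real.pi / 4)
  calc A * B - B * A = (E (Real.pi / 4) * E (-(Real.pi / 4))) * (A * B - B * A) *
        (E (Real.pi / 4) * E (-(Real.pi / 4))) := by simp only [hE, e2, one_mul, mul_one]
    _ = E (Real.pi / 4) * (E (-(Real.pi / 4)) * (A * B - B * A) * E (Real.pi / 4)) *
        E (-(Real.pi / 4)) := by noncomm_ring
    _ = _ := by
      have : E (-(Real.pi / 4)) * (A * B - B * A) * E (Real.pi / 4) = (2 : ℝ) • B := by
        have h5 : (1 / 2 : ℝ) • (E (-(Real.pi / 4)) * (A * B - B * A) * E (Real.pi / 4)) = B := hYc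
        rw [← smul_right_injective 𝔸 (one_div_ne_zero (two_ne_zero' ℝ)) |>.eq_iff, h5, smul_smul]
        norm_num
      rw [this]; simp only [mul_smul_comm, smul_mul_assoc]; rfl

end OneParameter

section OneParameterRelations

variable {𝔸 : Type*} [NormedRing 𝔸] [NormedAlgebra ℝ 𝔸] [CompleteSpace 𝔸]

theorem generator_eq_of_conj {A B P Q : 𝔸}
    (h : ∀ t : ℝ, P * NormedSpace.exp (t • A) * Q = NormedSpace.exp (t • B)) : P * A * Q = B := by
  have h1 := (((hasDerivAt_exp_smul A 0).const_mul P).mul_const Q)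
  have h2 := hasDerivAt_exp_smul B 0
  have h3 := h1.unique (h2.congr_of_eventuallyEq (Filter.Eventually.of_forall h))
  simpa using h3

theorem generator_unique {A B : 𝔸}
    (h : ∀ t : ℝ, NormedSpace.exp (t • A) = NormedSpace.exp (t • B)) : A = B := by
  have := generator_eq_of_conj (P := 1) (Q := 1) (A := A) (B := B) (by simpa using h)
  simpa using this

theorem generator_commute {A B : 𝔸} (h : ∀ s t : ℝ,
    NormedSpace.exp (s • A) * NormedSpace.exp (t • B) =
      NormedSpace.exp (t • B) * NormedSpace.exp (s • A)) : A * B = B * A := by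
  have h1 : ∀ s : ℝ, NormedSpace.exp (s • A) * B = B * NormedSpace.exp (s • A) := by
    intro s
    have h2 := (hasDerivAt_exp_smul B 0).const_mul (NormedSpace.exp (s • A))
    have h3 := (hasDerivAt_exp_smul B 0).mul_const (NormedSpace.exp (s • A))
    have := h2.unique (h3.congr_of_eventuallyEq (Filter.Eventually.of_forall fun t => h s t))
    simpa using this
  have h2 := (hasDerivAt_exp_smul A 0).mul_const B
  have h3 := (hasDerivAt_exp_smul A 0).const_mul B
  have := h2.unique (h3.congr_of_eventuallyEq (Filter.Eventually.of_forall h1))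
  simpa using this

theorem cos_arcsin_mul_arctan {C S c s : ℝ} (hC : 0 < C) (hc : 0 < c) (h1 : S ^ 2 + C ^ 2 = 1)
    (h2 : s ^ 2 + c ^ 2 = 1) :
    Real.cos (Real.arcsin (C * s)) * Real.cos (Real.arctan (S / C / c)) = C * c ∧
    Real.cos (Real.arcsin (C * s)) * Real.sin (Real.arctan (S / C / c)) = S ∧
    -1 ≤ C * s ∧ C * s ≤ 1 := by
  have hx : 1 + (S / C / c) ^ 2 = (1 - (C * s) ^ 2) / (C * c) ^ 2 := by
    field_simp
    linear_combination h1 + C ^ 2 * h2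
  have hsq : Real.sqrt (1 + (S / C / c) ^ 2) = Real.sqrt (1 - (C * s) ^ 2) / (C * c) := by
    rw [hx, Real.sqrt_div' _ (sq_nonneg _), Real.sqrt_sq (mul_pos hC hc).le]
  have hpos : 0 < Real.sqrt (1 - (C * s) ^ 2) := by
    have h0 : 0 < Real.sqrt (1 + (S / C / c) ^ 2) := Real.sqrt_pos.2 (by positivity)
    rw [hsq] at h0
    exact (div_pos_iff_of_pos_right (mul_pos hC hc)).1 h0
  have hle' := (sq_le_one_iff_abs_le_one _).1 (sub_nonneg.1 (Real.sqrt_pos.1 hpos).le)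
  rw [abs_le] at hle'
  rw [Real.cos_arctan, Real.cos_arcsin, Real.sin_arctan, hsq]
  generalize Real.sqrt (1 - (C * s) ^ 2) = w at *
  refine ⟨?_, ?_, hle'.1, hle'.2⟩ <;> field_simp

/-- The generators of two perpendicular one-parameter groups of unit quaternions satisfy
`[i, j] = 2 k`.  The hypothesis `h1` is the factorization
`exp (tj) exp (-2φi) exp (tj) = exp (bi) exp (θj) exp (bi)`; differentiating it at `t = 0`, where
`b = -φ`, `b' = 0`, `θ' = 2 cos (2φ)`, gives the hypothesis of `half_commutator_eq`. -/
theorem commutator_eq_of_quaternion {A B C : 𝔸}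
    (h1 : ∀ φ t b θ : ℝ, Real.sin θ = Real.cos (2 * φ) * Real.sin (2 * t) →
      Real.cos θ * Real.cos (2 * b) = Real.cos (2 * φ) * Real.cos (2 * t) →
      Real.cos θ * Real.sin (2 * b) = -Real.sin (2 * φ) →
      NormedSpace.exp (t • B) * NormedSpace.exp ((-2 * φ) • A) * NormedSpace.exp (t • B) =
        NormedSpace.exp (b • A) * NormedSpace.exp (θ • B) * NormedSpace.exp (b • A))
    (h2 : ∀ t : ℝ, NormedSpace.exp ((Real.pi / 4) • A) * NormedSpace.exp (t • B) *
      NormedSpace.exp (-(Real.pi / 4) • A) = NormedSpace.exp (t • C)) :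
    A * B - B * A = (2 : ℝ) • C := by
  rw [half_commutator_eq A B (Real.pi / 4) (by positivity), generator_eq_of_conj h2]
  intro φ hφ
  rw [abs_lt] at hφ
  have hcφ : 0 < Real.cos (2 * φ) := Real.cos_pos_of_mem_Ioo ⟨by linarith, by linarith⟩
  set θ : ℝ → ℝ := fun t => Real.arcsin (Real.cos (2 * φ) * Real.sin (2 * t)) with hθ
  set b : ℝ → ℝ := fun t => -(1 / 2) * Real.arctan (Real.tan (2 * φ) / Real.cos (2 * t)) with hb
  have key : ∀ᶠ t in 𝓝 (0 : ℝ),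
      NormedSpace.exp (t • B) * NormedSpace.exp ((-2 * φ) • A) * NormedSpace.exp (t • B) =
        NormedSpace.exp (b t • A) * NormedSpace.exp (θ t • B) * NormedSpace.exp (b t • A) := by
    have : ∀ᶠ t in 𝓝 (0 : ℝ), |t| < Real.pi / 4 := by
      refine (continuous_abs.tendsto (0 : ℝ)).eventually (gt_mem_nhds ?_)
      simp [Real.pi_pos]
    filter_upwards [this] with t ht
    rw [abs_lt] at ht
    have hct : 0 < Real.cos (2 * t) := Real.cos_pos_of_mem_Ioo ⟨by linarith, by linarith⟩
    obtain ⟨g1, g2, g3, g4⟩ := cos_arcsin_mul_arctan hcφ hct (Real.sin_sq_add_cos_sq (2 * φ))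
      (Real.sin_sq_add_cos_sq (2 * t))
    rw [← Real.tan_eq_sin_div_cos] at g1 g2
    have h2b : 2 * b t = -Real.arctan (Real.tan (2 * φ) / Real.cos (2 * t)) := by
      simp only [hb]; ring
    apply h1
    · exact Real.sin_arcsin g3 g4
    · rw [h2b, Real.cos_neg]; exact g1
    · rw [h2b, Real.sin_neg, mul_neg, neg_inj]; exact g2
  have hb0 : b 0 = -φ := by
    simp only [hb, mul_zero, Real.cos_zero, div_one]
    rw [Real.arctan_tan (by linarith) (by linarith)]; ring
  have hθ0 : θ 0 = 0 := by simp [hθ]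
  have hdb : HasDerivAt b 0 0 := by
    have e1 : HasDerivAt (fun t : ℝ => Real.cos (2 * t)) (-Real.sin (2 * 0) * (2 * 1)) 0 :=
      ((hasDerivAt_id (0 : ℝ)).const_mul 2).cos
    have e2 := (((hasDerivAt_const (0 : ℝ) (Real.tan (2 * φ))).div e1 (by simp)).arctan).const_mul
      (-(1 / 2) : ℝ)
    refine e2.congr_deriv ?_
    simp
  have hdθ : HasDerivAt θ (2 * Real.cos (2 * φ)) 0 := by
    have e1 : HasDerivAt (fun t : ℝ => Real.cos (2 * φ) * Real.sin (2 * t))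
        (Real.cos (2 * φ) * (Real.cos (2 * 0) * (2 * 1))) 0 :=
      ((hasDerivAt_id (0 : ℝ)).const_mul 2).sin.const_mul _
    have e2 := (Real.hasDerivAt_arcsin (x := Real.cos (2 * φ) * Real.sin (2 * 0))
      (by simp) (by simp)).comp (0 : ℝ) e1
    refine e2.congr_deriv ?_
    simp; ring
  have dE : ∀ (D : 𝔸) (f : ℝ → ℝ) (f' : ℝ), HasDerivAt f f' 0 →
      HasDerivAt (fun t => NormedSpace.exp (f t • D)) (f' • (D * NormedSpace.exp (f 0 • D))) 0 :=
    fun D f f' hf => (hasDerivAt_exp_smul' D (f 0)).scomp 0 hf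
  have dL := (((hasDerivAt_exp_smul B 0).mul_const (NormedSpace.exp ((-2 * φ) • A))).mul
    (hasDerivAt_exp_smul B 0))
  have dR := ((dE A b 0 hdb).mul (dE B θ _ hdθ)).mul (dE A b 0 hdb)
  have h3 := dL.unique (dR.congr_of_eventuallyEq key)
  simp only [hb0, hθ0, zero_smul, NormedSpace.exp_zero, one_mul, mul_one, mul_zero,
    zero_add, add_zero] at h3
  have hsplit : NormedSpace.exp ((-2 * φ) • A) =
      NormedSpace.exp (-φ • A) * NormedSpace.exp (-φ • A) := by
    let _ : NormedAlgebra ℚ 𝔸 := NormedAlgebra.restrictScalars ℚ ℝ 𝔸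
    rw [← NormedSpace.exp_add_of_commute (Commute.refl _), ← add_smul]
    congr 2; ring
  set E := NormedSpace.exp (φ • A)
  set E' := NormedSpace.exp (-φ • A)
  have i1 : E * E' = 1 := exp_smul_mul_exp_neg_smul A φ
  have i2 : E' * E = 1 := exp_neg_smul_mul_exp_smul A φ
  rw [hsplit] at h3
  calc E * B * E' + E' * B * E
      = E * (B * (E' * E') ) * E + E * (E' * E' * B) * E := by
        have r1 : E * (B * (E' * E')) * E = E * B * E' * (E' * E) := by noncomm_ring
        have r2 : E * (E' * E' * B) * E = (E * E') * (E' * B * E) := by noncomm_ring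
        rw [r1, r2, i1, i2, mul_one, one_mul]
    _ = E * (B * (E' * E') + E' * E' * B) * E := by noncomm_ring
    _ = (2 * Real.cos (2 * φ)) • ((E * E') * B * (E' * E)) := by
        rw [h3]; simp only [mul_smul_comm, smul_mul_assoc]; congr 1; noncomm_ring
    _ = _ := by rw [i1, i2, one_mul, mul_one]

end OneParameterRelations

/-! ### Rotations in coordinate planes -/

section Quaternion

variable {R : Type*} [Ring R] [Algebra ℝ R]

/-- `cos t + sin t · i`, the exponential of `t i` when `i² = -1`. -/
def circ (i : R) (t : ℝ) : R := algebraMap ℝ R (Real.cos t) + Real.sin t • i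

theorem circ_add {i : R} (hi : i * i = -1) (s t : ℝ) : circ i (s + t) = circ i s * circ i t := by
  simp only [circ, Real.cos_add, Real.sin_add, Algebra.algebraMap_eq_smul_one, mul_add, add_mul,
    smul_mul_smul_comm, mul_one, one_mul, hi]
  module

theorem circ_neg (i : R) (t : ℝ) : circ i (-t) = circ (-i) t := by
  simp [circ]

theorem circ_zero (i : R) : circ i 0 = 1 := by simp [circ]

theorem circ_two_pi (i : R) : circ i (2 * Real.pi) = 1 := by simp [circ]

theorem circ_commute {i j : R} (h : i * j = j * i) (s t : ℝ) :
    circ i s * circ j t = circ j t * circ i s := by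
  simp only [circ, Algebra.algebraMap_eq_smul_one, mul_add, add_mul, smul_mul_smul_comm, mul_one,
    one_mul, h]
  module

theorem circ_factorization {i j : R} (hi : i * i = -1) (hj : j * j = -1) (hij : j * i = -(i * j))
    (φ t b θ : ℝ) (h1 : Real.sin θ = Real.cos (2 * φ) * Real.sin (2 * t))
    (h2 : Real.cos θ * Real.cos (2 * b) = Real.cos (2 * φ) * Real.cos (2 * t))
    (h3 : Real.cos θ * Real.sin (2 * b) = -Real.sin (2 * φ)) :
    circ j t * circ i (-2 * φ) * circ j t = circ i b * circ j θ * circ i b := by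
  have gen : ∀ (i j : R) (_ : i * i = -1) (_ : j * j = -1) (_ : j * i = -(i * j)) (t s : ℝ),
      circ j t * circ i s * circ j t =
        (Real.cos s * Real.cos (2 * t)) • (1 : R) + Real.sin s • i +
          (Real.cos s * Real.sin (2 * t)) • j := by
    intro i j hi hj hij t s
    have h4 : j * i * j = i := by rw [hij, neg_mul, mul_assoc, hj]; simp
    have h5 : circ j t * circ i s * circ j t =
        Real.cos s • (circ j t * circ j t) + Real.sin s • (circ j t * i * circ j t) := by
      rw [show circ i s = Real.cos s • 1 + Real.sin s • i by
        rw [circ, Algebra.algebraMap_eq_smul_one]]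
      simp only [mul_add, add_mul, mul_smul_comm, smul_mul_assoc, mul_one]
    have h6 : circ j t * i * circ j t = i := by
      simp only [circ, Algebra.algebraMap_eq_smul_one, mul_add, add_mul,
        mul_one, one_mul, mul_smul_comm, smul_mul_assoc, h4]
      rw [hij]
      have := Real.sin_sq_add_cos_sq t
      have e : Real.sin t • Real.sin t • i + Real.cos t • Real.cos t • i = i := by
        rw [smul_smul, smul_smul, ← add_smul, ← sq, ← sq, this, one_smul]
      refine Eq.trans ?_ e
      module
    rw [h5, h6, ← circ_add hj, ← two_mul, circ, Algebra.algebraMap_eq_smul_one]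
    module
  have hij' : i * j = -(j * i) := by rw [hij, neg_neg]
  rw [gen i j hi hj hij, gen j i hj hi hij', h1, h2, h3]
  have e1 : Real.cos (-2 * φ) = Real.cos (2 * φ) := by rw [neg_mul, Real.cos_neg]
  have e2 : Real.sin (-2 * φ) = -Real.sin (2 * φ) := by rw [neg_mul, Real.sin_neg]
  rw [e1, e2]
  abel

theorem circ_conj {i j : R} (hi : i * i = -1) (hij : j * i = -(i * j)) (t : ℝ) :
    circ i (Real.pi / 4) * circ j t * circ i (-(Real.pi / 4)) = circ (i * j) t := by
  have h1 : ∀ s, j * circ i s = circ i (-s) * j := by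
    intro s
    simp only [circ, Algebra.algebraMap_eq_smul_one, mul_add, add_mul, mul_smul_comm,
      smul_mul_assoc, mul_one, one_mul, Real.cos_neg, Real.sin_neg, hij]
    module
  have h2 : circ i (Real.pi / 4) * circ i (Real.pi / 4) = i := by
    rw [← circ_add hi, show Real.pi / 4 + Real.pi / 4 = Real.pi / 2 by ring]
    simp [circ]
  have h3 : circ i (Real.pi / 4) * circ i (-(Real.pi / 4)) = 1 := by
    rw [← circ_add hi, add_neg_cancel, circ_zero]
  calc circ i (Real.pi / 4) * circ j t * circ i (-(Real.pi / 4))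
      = Real.cos t • (circ i (Real.pi / 4) * circ i (-(Real.pi / 4))) +
        Real.sin t • (circ i (Real.pi / 4) * (j * circ i (-(Real.pi / 4)))) := by
        rw [show circ j t = Real.cos t • 1 + Real.sin t • j by
          rw [circ, Algebra.algebraMap_eq_smul_one]]
        simp only [mul_add, add_mul, mul_smul_comm, smul_mul_assoc, mul_one, mul_assoc]
    _ = _ := by
        rw [h1, neg_neg, ← mul_assoc, h2, h3, circ, Algebra.algebraMap_eq_smul_one]

end Quaternion

/-! ### Coordinate rotations in the spin group -/

section Rot

variable {n : ℕ}

/-- The basis vector of `ℝ^{2n}` with index `p`, in the Clifford algebra. -/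
abbrev ev (p : Fin n × Fin 2) : CliffordAlgebra (sqForm n) := vec (Pi.single p 1)

theorem ev_sq (p : Fin n × Fin 2) : ev p * ev p = 1 := vec_mul_self (sqForm_single p)

theorem sqForm_polar (x y : Fin n × Fin 2 → ℝ) :
    QuadraticMap.polar (sqForm n) x y = 2 * ∑ p, x p * y p := by
  simp only [QuadraticMap.polar, sqForm_apply, Pi.add_apply, Finset.mul_sum,
    ← Finset.sum_sub_distrib]
  exact Finset.sum_congr rfl fun p _ => by ring

theorem vec_mul_add_swap (x y : Fin n × Fin 2 → ℝ) :
    vec x * vec y + vec y * vec x = algebraMap ℝ _ (2 * ∑ p, x p * y p) := by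
  rw [vec, vec, CliffordAlgebra.ι_mul_ι_add_swap, sqForm_polar]

theorem ev_anticomm {p q : Fin n × Fin 2} (h : p ≠ q) : ev p * ev q = -(ev q * ev p) := by
  have := vec_mul_add_swap (Pi.single p 1) (Pi.single q (1 : ℝ))
  have h0 : ∑ r, (Pi.single p 1 : Fin n × Fin 2 → ℝ) r * (Pi.single q (1 : ℝ) : _ → ℝ) r = 0 := by
    refine Finset.sum_eq_zero fun r _ => ?_
    by_cases hr : r = p
    · subst hr; simp [h]
    · simp [Pi.single_apply, hr]
  rw [h0, mul_zero, map_zero] at this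
  exact eq_neg_of_add_eq_zero_left this

theorem biv_sq {p q : Fin n × Fin 2} (h : p ≠ q) : ev p * ev q * (ev p * ev q) = -1 := by
  calc ev p * ev q * (ev p * ev q) = ev p * (ev q * ev p) * ev q := by noncomm_ring
    _ = -(ev p * ev p * (ev q * ev q)) := by
        rw [ev_anticomm h.symm]; noncomm_ring
    _ = -1 := by rw [ev_sq, ev_sq, one_mul]

theorem circ_mem_spin {p q : Fin n × Fin 2} (h : p ≠ q) (t : ℝ) :
    circ (ev p * ev q) t ∈ Spin n := by
  have e1 : circ (ev p * ev q) t =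
      vec (Pi.single p 1) * vec (Real.cos t • Pi.single p 1 + Real.sin t • Pi.single q 1) := by
    rw [vec, vec, LinearMap.map_add, LinearMap.map_smul, LinearMap.map_smul, mul_add,
      mul_smul_comm, mul_smul_comm, vec_mul_self (sqForm_single _), circ,
      Algebra.algebraMap_eq_smul_one]
  rw [e1]
  refine vec_mul_vec_mem (sqForm_single _) ?_
  rw [sqForm_apply, ← Finset.sum_subset (Finset.subset_univ {p, q})]
  · rw [Finset.sum_pair h]
    simp [h, h.symm]
    nlinarith [Real.sin_sq_add_cos_sq t]
  · intro r _ hr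
    simp only [Finset.mem_insert, Finset.mem_singleton, not_or] at hr
    simp [hr.1, hr.2]

/-- The element `cos (θ/2) + sin (θ/2) e_p e_q` of `Spin(2n)`, and `1` if `p = q`. -/
def rot (p q : Fin n × Fin 2) (θ : ℝ) : Spin n :=
  if h : p ≠ q then ⟨circ (ev p * ev q) (θ / 2), circ_mem_spin h _⟩ else 1

theorem coe_rot {p q : Fin n × Fin 2} (h : p ≠ q) (θ : ℝ) :
    (rot p q θ : CliffordAlgebra (sqForm n)) = circ (ev p * ev q) (θ / 2) := by
  rw [rot, dif_pos h]

theorem rot_self (p : Fin n × Fin 2) (θ : ℝ) : rot p p θ = 1 := by simp [rot]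

theorem rot_zero (p q : Fin n × Fin 2) : rot p q 0 = 1 := by
  by_cases h : p = q
  · rw [h, rot_self]
  · apply Subtype.ext; rw [coe_rot h, zero_div, circ_zero]; rfl

theorem rot_add (p q : Fin n × Fin 2) (s t : ℝ) : rot p q (s + t) = rot p q s * rot p q t := by
  by_cases h : p = q
  · simp [h, rot_self]
  · apply Subtype.ext
    rw [Submonoid.coe_mul, coe_rot h, coe_rot h, coe_rot h, add_div, circ_add (biv_sq h)]

theorem rot_inv (p q : Fin n × Fin 2) (t : ℝ) : (rot p q t)⁻¹ = rot p q (-t) := by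
  rw [inv_eq_iff_mul_eq_one, ← rot_add, add_neg_cancel, rot_zero]

theorem rot_swap (p q : Fin n × Fin 2) (t : ℝ) : rot q p t = rot p q (-t) := by
  by_cases h : p = q
  · simp [h, rot_self]
  · apply Subtype.ext
    rw [coe_rot h, coe_rot (Ne.symm h), neg_div, circ_neg, ev_anticomm h, neg_neg]

theorem rot_four_pi (p q : Fin n × Fin 2) : rot p q (4 * Real.pi) = 1 := by
  by_cases h : p = q
  · rw [h, rot_self]
  · apply Subtype.ext
    rw [coe_rot h, show 4 * Real.pi / 2 = 2 * Real.pi by ring, circ_two_pi]; rfl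

theorem torusElt_eq_rot (j : Fin n) (θ : ℝ) : torusElt j θ = rot (j, 1) (j, 0) θ := by
  apply Subtype.ext
  rw [coe_rot (by simp)]; rfl

theorem biv_commute {p q r s : Fin n × Fin 2} (h1 : p ≠ r) (h2 : p ≠ s) (h3 : q ≠ r) (h4 : q ≠ s) :
    ev p * ev q * (ev r * ev s) = ev r * ev s * (ev p * ev q) := by
  calc ev p * ev q * (ev r * ev s) = ev p * (ev q * ev r) * ev s := by noncomm_ring
    _ = -((ev p * ev r) * (ev q * ev s)) := by rw [ev_anticomm h3]; noncomm_ring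
    _ = -((ev r * ev p) * (ev s * ev q)) := by rw [ev_anticomm h1, ev_anticomm h4]; noncomm_ring
    _ = -(ev r * (ev p * ev s) * ev q) := by noncomm_ring
    _ = _ := by rw [ev_anticomm h2]; noncomm_ring

theorem rot_commute {p q r s : Fin n × Fin 2} (h1 : p ≠ r) (h2 : p ≠ s) (h3 : q ≠ r) (h4 : q ≠ s)
    (x y : ℝ) : rot p q x * rot r s y = rot r s y * rot p q x := by
  by_cases hpq : p = q
  · simp [hpq, rot_self]
  by_cases hrs : r = s
  · simp [hrs, rot_self]
  apply Subtype.ext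
  rw [Submonoid.coe_mul, Submonoid.coe_mul, coe_rot hpq, coe_rot hrs,
    circ_commute (biv_commute h1 h2 h3 h4)]

theorem biv_mul {p q r : Fin n × Fin 2} : ev p * ev q * (ev q * ev r) = ev p * ev r := by
  calc ev p * ev q * (ev q * ev r) = ev p * (ev q * ev q) * ev r := by noncomm_ring
    _ = _ := by rw [ev_sq, mul_one]

theorem biv_anticomm {p q r : Fin n × Fin 2} (h1 : p ≠ q) (h2 : q ≠ r) (h3 : p ≠ r) :
    ev q * ev r * (ev p * ev q) = -(ev p * ev q * (ev q * ev r)) := by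
  rw [biv_mul]
  calc ev q * ev r * (ev p * ev q) = ev q * (ev r * ev p) * ev q := by noncomm_ring
    _ = -((ev q * ev p) * (ev r * ev q)) := by rw [ev_anticomm h3.symm]; noncomm_ring
    _ = -((ev p * ev q) * (ev q * ev r)) := by
        rw [ev_anticomm h1, ev_anticomm h2]; noncomm_ring
    _ = _ := by rw [biv_mul]

theorem rot_factorization {p q r : Fin n × Fin 2} (h1 : p ≠ q) (h2 : q ≠ r) (h3 : p ≠ r)
    (φ t b θ : ℝ) (e1 : Real.sin θ = Real.cos (2 * φ) * Real.sin (2 * t))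
    (e2 : Real.cos θ * Real.cos (2 * b) = Real.cos (2 * φ) * Real.cos (2 * t))
    (e3 : Real.cos θ * Real.sin (2 * b) = -Real.sin (2 * φ)) :
    rot q r (t * 2) * rot p q (-2 * φ * 2) * rot q r (t * 2) =
      rot p q (b * 2) * rot q r (θ * 2) * rot p q (b * 2) := by
  apply Subtype.ext
  simp only [Submonoid.coe_mul, coe_rot h1, coe_rot h2, mul_div_cancel_right₀ _ (two_ne_zero' ℝ)]
  exact circ_factorization (biv_sq h1) (biv_sq h2) (biv_anticomm h1 h2 h3) φ t b θ e1 e2 e3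

theorem rot_conj {p q r : Fin n × Fin 2} (h1 : p ≠ q) (h2 : q ≠ r) (h3 : p ≠ r) (t : ℝ) :
    rot p q (Real.pi / 4 * 2) * rot q r (t * 2) * rot p q (-(Real.pi / 4) * 2) =
      rot p r (t * 2) := by
  apply Subtype.ext
  simp only [Submonoid.coe_mul, coe_rot h1, coe_rot h2, coe_rot h3,
    mul_div_cancel_right₀ _ (two_ne_zero' ℝ)]
  rw [circ_conj (biv_sq h1) (biv_anticomm h1 h2 h3), biv_mul]

theorem continuous_rot (p q : Fin n × Fin 2) : Continuous fun θ => rot p q θ := by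
  by_cases h : p = q
  · simp only [h, rot_self]
    exact (continuous_const : Continuous fun _ : ℝ => (1 : Spin n))
  · rw [continuous_induced_rng]
    let τ : TopologicalSpace (CliffordAlgebra (sqForm n)) :=
      moduleTopology ℝ (CliffordAlgebra (sqForm n))
    have hm : IsModuleTopology ℝ (CliffordAlgebra (sqForm n)) := ⟨rfl⟩
    have h1 : ContinuousSMul ℝ (CliffordAlgebra (sqForm n)) :=
      IsModuleTopology.toContinuousSMul ℝ (CliffordAlgebra (sqForm n))
    have h2 : ContinuousAdd (CliffordAlgebra (sqForm n)) :=
      IsModuleTopology.toContinuousAdd ℝ (CliffordAlgebra (sqForm n))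
    have : (Subtype.val ∘ fun θ => rot p q θ) = fun θ : ℝ =>
        Real.cos (θ / 2) • (1 : CliffordAlgebra (sqForm n)) + Real.sin (θ / 2) • (ev p * ev q) := by
      funext θ
      simp only [Function.comp, coe_rot h, circ, Algebra.algebraMap_eq_smul_one]
    rw [this]
    have hc : Continuous fun θ : ℝ => Real.cos (θ / 2) := by fun_prop
    have hs : Continuous fun θ : ℝ => Real.sin (θ / 2) := by fun_prop
    have hk : ∀ x : CliffordAlgebra (sqForm n), Continuous fun _ : ℝ => x :=
      fun x => continuous_const
    exact (hc.smul (hk 1)).add (hs.smul (hk (ev p * ev q)))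

end Rot

/-! ### The infinitesimal generators of a representation -/

section Gen

attribute [local instance] Matrix.linftyOpNormedRing Matrix.linftyOpNormedAlgebra

variable {n : ℕ} {V : Type*} [AddCommGroup V] [Module ℂ V] [FiniteDimensional ℂ V]
  {σ : Representation ℂ (Spin n) V}

/-- The matrix of an endomorphism in a fixed basis.  Matrices carry a Banach algebra structure,
which is used for all exponentials. -/
def toMat (V : Type*) [AddCommGroup V] [Module ℂ V] [FiniteDimensional ℂ V] :
    Module.End ℂ V ≃ₐ[ℂ] Matrix (Fin (Module.finrank ℂ V)) (Fin (Module.finrank ℂ V)) ℂ :=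
  LinearMap.toMatrixAlgEquiv (Module.finBasis ℂ V)

theorem exists_rotGen (hσ : IsContinuousRep σ) (p q : Fin n × Fin 2) :
    ∃ X : Module.End ℂ V, ∀ θ : ℝ,
      toMat V (σ (rot p q θ)) = NormedSpace.exp (θ • toMat V X) := by
  obtain ⟨A, hA⟩ := exists_generator (fun θ => toMat V (σ (rot p q θ))) (by
    refine continuous_matrix fun i j => ?_
    have h := (hσ (Module.finBasis ℂ V j) ((Module.finBasis ℂ V).coord i)).comp
      (continuous_rot p q)
    refine h.congr fun θ => ?_
    simp [toMat, LinearMap.toMatrixAlgEquiv_apply])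
    (by simp [rot_zero]) (fun s t => by simp [rot_add])
  exact ⟨(toMat V).symm A, fun θ => by rw [AlgEquiv.apply_symm_apply]; exact hA θ⟩

/-- The generator `X_{pq}` of the one-parameter group `θ ↦ σ (rot p q θ)`. -/
def rotGen (hσ : IsContinuousRep σ) (p q : Fin n × Fin 2) : Module.End ℂ V :=
  (exists_rotGen hσ p q).choose

theorem toMat_rot (hσ : IsContinuousRep σ) (p q : Fin n × Fin 2) (θ : ℝ) :
    toMat V (σ (rot p q θ)) = NormedSpace.exp (θ • toMat V (rotGen hσ p q)) :=
  (exists_rotGen hσ p q).choose_spec θ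

theorem rotGen_swap (hσ : IsContinuousRep σ) (p q : Fin n × Fin 2) :
    rotGen hσ q p = -rotGen hσ p q := by
  apply (toMat V).injective
  refine generator_unique fun t => ?_
  have h := toMat_rot hσ q p t
  rw [rot_swap, toMat_rot hσ p q] at h
  rw [map_neg, smul_neg, ← neg_smul]
  exact h.symm

theorem rotGen_self (hσ : IsContinuousRep σ) (p : Fin n × Fin 2) : rotGen hσ p p = 0 := by
  apply (toMat V).injective
  exact generator_unique fun t => (toMat_rot hσ p p t).symm.trans
    (by rw [rot_self, map_one, map_one, map_zero, smul_zero, NormedSpace.exp_zero])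

theorem rotGen_commute (hσ : IsContinuousRep σ) {p q r s : Fin n × Fin 2} (h1 : p ≠ r)
    (h2 : p ≠ s) (h3 : q ≠ r) (h4 : q ≠ s) :
    rotGen hσ p q * rotGen hσ r s = rotGen hσ r s * rotGen hσ p q := by
  apply (toMat V).injective
  rw [map_mul, map_mul]
  refine generator_commute fun x y => ?_
  have h := congrArg (fun g => toMat V (σ g)) (rot_commute h1 h2 h3 h4 x y)
  simp only [map_mul, toMat_rot hσ] at h
  exact h

theorem rotGen_bracket (hσ : IsContinuousRep σ) {p q r : Fin n × Fin 2} (h1 : p ≠ q)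
    (h2 : q ≠ r) (h3 : p ≠ r) :
    rotGen hσ p q * rotGen hσ q r - rotGen hσ q r * rotGen hσ p q = rotGen hσ p r := by
  apply (toMat V).injective
  have e : ∀ (a b : Fin n × Fin 2) (t : ℝ), toMat V (σ (rot a b (t * 2))) =
      NormedSpace.exp (t • (2 : ℝ) • toMat V (rotGen hσ a b)) :=
    fun a b t => by rw [toMat_rot, smul_smul]
  have key : ((2 : ℝ) • toMat V (rotGen hσ p q)) * ((2 : ℝ) • toMat V (rotGen hσ q r)) -
      ((2 : ℝ) • toMat V (rotGen hσ q r)) * ((2 : ℝ) • toMat V (rotGen hσ p q)) =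
      (2 : ℝ) • ((2 : ℝ) • toMat V (rotGen hσ p r)) := by
    refine commutator_eq_of_quaternion (fun φ t b θ e1 e2 e3 => ?_) (fun t => ?_)
    · have h := congrArg (fun g => toMat V (σ g)) (rot_factorization h1 h2 h3 φ t b θ e1 e2 e3)
      simp only [map_mul, e] at h
      exact h
    · have h := congrArg (fun g => toMat V (σ g)) (rot_conj h1 h2 h3 t)
      simp only [map_mul, e] at h
      exact h
  rw [map_sub, map_mul, map_mul]
  rw [smul_mul_smul_comm, smul_mul_smul_comm, ← smul_sub, smul_smul] at key
  exact smul_right_injective _ (by norm_num : (2 * 2 : ℝ) ≠ 0) key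

/-- The commutation relations of `𝔰𝔬(2n)`. -/
theorem rotGen_lie (hσ : IsContinuousRep σ) (p q r s : Fin n × Fin 2) :
    rotGen hσ p q * rotGen hσ r s - rotGen hσ r s * rotGen hσ p q =
      (if q = r then rotGen hσ p s else 0) - (if p = r then rotGen hσ q s else 0) -
        (if q = s then rotGen hσ p r else 0) + (if p = s then rotGen hσ q r else 0) := by
  have sw := rotGen_swap hσ
  have z := rotGen_self hσ
  by_cases hpq : p = q
  · subst hpq; simp [z]
  by_cases hrs : r = s
  · subst hrs; simp [z]
  by_cases h1 : q = r
  · subst h1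
    by_cases h2 : p = s
    · subst h2
      rw [sw q p]
      simp [hpq, Ne.symm hpq, z]
    · simp [hpq, h2, hrs, rotGen_bracket hσ hpq hrs h2]
  by_cases h2 : p = s
  · subst h2
    have := rotGen_bracket hσ (Ne.symm hpq) (Ne.symm hrs) h1
    simp only [Ne.symm hpq, h1, Ne.symm hrs, if_true, if_false, ← this]
    rw [sw p r, sw q p]
    noncomm_ring
  by_cases h3 : q = s
  · subst h3
    by_cases h4 : p = r
    · subst h4
      simp [hpq, Ne.symm hpq, z]
    · have := rotGen_bracket hσ hpq h1 h4
      simp only [hpq, h1, h4, if_true, if_false, ← this]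
      rw [sw q r]
      noncomm_ring
  by_cases h4 : p = r
  · subst h4
    have := rotGen_bracket hσ (Ne.symm hpq) h2 h3
    simp only [h1, h2, h3, if_true, if_false, ← this]
    rw [sw q p]
    noncomm_ring
  · simp [h1, h2, h3, h4, rotGen_commute hσ h4 h2 h1 h3]

theorem hasDerivAt_coeff_rot (hσ : IsContinuousRep σ) (p q : Fin n × Fin 2) (f : Module.Dual ℂ V)
    (v : V) (θ : ℝ) :
    HasDerivAt (fun θ : ℝ => f (σ (rot p q θ) v)) (f (σ (rot p q θ) (rotGen hσ p q v))) θ := by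
  -- `L` reads off the matrix coefficient from the matrix.
  let L : Matrix (Fin (Module.finrank ℂ V)) (Fin (Module.finrank ℂ V)) ℂ →ₗ[ℝ] ℂ :=
    (f ∘ₗ (LinearMap.applyₗ v) ∘ₗ (toMat V).symm.toLinearMap).restrictScalars ℝ
  have h : HasDerivAt (fun θ => L (toMat V (σ (rot p q θ))))
      (L (toMat V (σ (rot p q θ) * rotGen hσ p q))) θ := by
    rw [map_mul]
    simp only [toMat_rot hσ]
    exact (LinearMap.toContinuousLinearMap L).hasFDerivAt.comp_hasDerivAt θ
      (hasDerivAt_exp_smul (toMat V (rotGen hσ p q)) θ)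
  have e : ∀ T : Module.End ℂ V, L (toMat V T) = f (T v) := fun T => by simp [L]
  exact (h.congr_deriv (e _)).congr_of_eventuallyEq (Filter.Eventually.of_forall fun t =>
      (e _).symm)

theorem rot_mem_of_rotGen_mem (hσ : IsContinuousRep σ) (W : Submodule ℂ V) (p q : Fin n × Fin 2)
    (hW : ∀ w ∈ W, rotGen hσ p q w ∈ W) (θ : ℝ) : ∀ w ∈ W, σ (rot p q θ) w ∈ W := by
  let S : Subalgebra ℝ (Matrix (Fin (Module.finrank ℂ V)) (Fin (Module.finrank ℂ V)) ℂ) :=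
    { carrier := {T | ∀ w ∈ W, (toMat V).symm T w ∈ W}
      mul_mem' := fun {a b} ha hb w hw => by
        rw [map_mul]; exact ha _ (hb _ hw)
      add_mem' := fun {a b} ha hb w hw => by
        rw [map_add]; exact W.add_mem (ha _ hw) (hb _ hw)
      algebraMap_mem' := fun r w hw => by
        have : (algebraMap ℝ (Matrix (Fin (Module.finrank ℂ V)) (Fin (Module.finrank ℂ V)) ℂ)) r =
          algebraMap ℂ _ (r : ℂ) := rfl
        rw [this, AlgEquiv.commutes]
        simpa using W.smul_mem (r : ℂ) hw }
  have hcl : IsClosed (S : Set (Matrix (Fin (Module.finrank ℂ V)) (Fin (Module.finrank ℂ V)) ℂ)) :=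
    Submodule.closed_of_finiteDimensional (Subalgebra.toSubmodule S)
  have hA : θ • toMat V (rotGen hσ p q) ∈ S := by
    refine S.smul_mem ?_ θ
    intro w hw
    rw [AlgEquiv.symm_apply_apply]
    exact hW w hw
  have hexp : NormedSpace.exp (θ • toMat V (rotGen hσ p q)) ∈ S := by
    have hs := NormedSpace.exp_series_hasSum_exp' (𝕂 := ℝ) (θ • toMat V (rotGen hσ p q))
    refine hcl.mem_of_tendsto hs (Filter.Eventually.of_forall fun s => ?_)
    exact Subalgebra.sum_mem S fun i _ => S.smul_mem (pow_mem hA i) _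
  rw [← toMat_rot] at hexp
  intro w hw
  have := hexp w hw
  rwa [AlgEquiv.symm_apply_apply] at this

end Gen

section Eigen

variable {n : ℕ} {V : Type*} [AddCommGroup V] [Module ℂ V] [FiniteDimensional ℂ V]
  {σ : Representation ℂ (Spin n) V}

theorem rot_apply_of_eigen (hσ : IsContinuousRep σ) (p q : Fin n × Fin 2) {c : ℂ} {v : V}
    (hv : rotGen hσ p q v = c • v) (θ : ℝ) : σ (rot p q θ) v = Complex.exp (c * θ) • v := by
  refine (Module.forall_dual_apply_eq_zero_iff ℂ _).1 ?_ |> sub_eq_zero.1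
  intro f
  have hd : ∀ t : ℝ, HasDerivAt (fun t : ℝ => Complex.exp (-c * t) * f (σ (rot p q t) v)) 0 t := by
    intro t
    have h1 : HasDerivAt (fun t : ℝ => Complex.exp (-c * t)) (Complex.exp (-c * t) * (-c * 1)) t :=
      ((Complex.ofRealCLM.hasDerivAt (x := t)).const_mul (-c)).cexp
    have h2 := h1.mul (hasDerivAt_coeff_rot hσ p q f v t)
    refine h2.congr_deriv ?_
    rw [hv, map_smul, map_smul, smul_eq_mul]
    ring
  have h := eq_of_hasDerivAt_zero hd θ 0
  simp only [rot_zero, map_one, Module.End.one_apply, Complex.ofReal_zero, mul_zero,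
    Complex.exp_zero, one_mul] at h
  rw [map_sub, map_smul, smul_eq_mul, ← h, ← mul_assoc, ← Complex.exp_add]
  simp

theorem rotGen_apply_of_rot (hσ : IsContinuousRep σ) (p q : Fin n × Fin 2) {c : ℂ} {v : V}
    (hv : ∀ θ : ℝ, σ (rot p q θ) v = Complex.exp (c * θ) • v) : rotGen hσ p q v = c • v := by
  refine (Module.forall_dual_apply_eq_zero_iff ℂ _).1 ?_ |> sub_eq_zero.1
  intro f
  have h1 := hasDerivAt_coeff_rot hσ p q f v 0
  have h2 : HasDerivAt (fun t : ℝ => Complex.exp (c * t) * f v)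
      (Complex.exp (c * (0 : ℝ)) * (c * 1) * f v) 0 :=
    (((Complex.ofRealCLM.hasDerivAt (x := 0)).const_mul c).cexp).mul_const (f v)
  have h3 := h1.unique (h2.congr_of_eventuallyEq
    (Filter.Eventually.of_forall fun t => by simp [hv]))
  simp only [rot_zero, map_one, Module.End.one_apply, Complex.ofReal_zero, mul_zero,
    Complex.exp_zero, one_mul, mul_one] at h3
  rw [map_sub, h3, map_smul, smul_eq_mul, sub_self]

/-- As `rot p q` has period `4π`, its generator is diagonalizable: `σ (rot p q θ)` acts on
`v` with `(X - c)² v = 0` by `exp (cθ) (1 + θ (X - c))`, and periodicity kills the linear term. -/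
theorem rotGen_sub_sq (hσ : IsContinuousRep σ) (p q : Fin n × Fin 2) {c : ℂ} {v w : V}
    (hv : rotGen hσ p q v = c • v + w) (hw : rotGen hσ p q w = c • w) : w = 0 := by
  refine (Module.forall_dual_apply_eq_zero_iff ℂ _).1 ?_
  intro f
  have key : ∀ g : Module.Dual ℂ V, ∀ θ : ℝ,
      Complex.exp (-c * θ) * g (σ (rot p q θ) v) - θ * g w = g v := by
    intro g θ
    have hd : ∀ t : ℝ, HasDerivAt
        (fun t : ℝ => Complex.exp (-c * t) * g (σ (rot p q t) v) - t * g w) 0 t := by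
      intro t
      have h1 : HasDerivAt (fun t : ℝ => Complex.exp (-c * t)) (Complex.exp (-c * t) *
          (-c * 1)) t :=
        ((Complex.ofRealCLM.hasDerivAt (x := t)).const_mul (-c)).cexp
      have h2 := (h1.mul (hasDerivAt_coeff_rot hσ p q g v t)).sub
        ((Complex.ofRealCLM.hasDerivAt (x := t)).mul_const (g w))
      refine h2.congr_deriv ?_
      have h3 : Complex.exp (-c * t) * Complex.exp (c * t) = 1 := by
        rw [← Complex.exp_add]; simp
      rw [hv, map_add, map_smul, map_add, map_smul, rot_apply_of_eigen hσ p q hw, map_smul,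
        smul_eq_mul, smul_eq_mul]
      simp only [Complex.ofRealCLM_apply, Complex.ofReal_one]
      linear_combination (g w) * h3
    have h := eq_of_hasDerivAt_zero hd θ 0
    simpa [rot_zero] using h
  by_contra hne
  have hw' : w ≠ 0 := fun h => hne (by rw [h, map_zero])
  -- `w` is an eigenvector, so periodicity forces `exp (4πc) = 1`.
  have h1 : Complex.exp (c * (4 * Real.pi : ℝ)) = 1 := by
    have h2 := rot_apply_of_eigen hσ p q hw (4 * Real.pi)
    rw [rot_four_pi, map_one, Module.End.one_apply] at h2
    by_contra h3
    have h4 : (1 - Complex.exp (c * (4 * Real.pi : ℝ))) • w = 0 := by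
      rw [sub_smul, one_smul, ← h2, sub_self]
    rcases smul_eq_zero.1 h4 with h5 | h5
    · exact h3 (sub_eq_zero.1 h5).symm
    · exact hw' h5
  have h5 := key f (4 * Real.pi)
  rw [rot_four_pi, map_one, Module.End.one_apply, neg_mul, Complex.exp_neg, h1, inv_one, one_mul,
    sub_eq_self] at h5
  rcases mul_eq_zero.1 h5 with h6 | h6
  · have : (4 * Real.pi : ℝ) = 0 := by exact_mod_cast h6
    linarith [Real.pi_pos]
  · exact hne h6

/-- The eigenvalues of the generators are imaginary. -/
theorem rotGen_eigen_re (hσ : IsContinuousRep σ) (p q : Fin n × Fin 2) {c : ℂ} {v : V}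
    (hv0 : v ≠ 0) (hv : rotGen hσ p q v = c • v) : c.re = 0 := by
  have h2 := rot_apply_of_eigen hσ p q hv (4 * Real.pi)
  rw [rot_four_pi, map_one, Module.End.one_apply] at h2
  have h1 : Complex.exp (c * (4 * Real.pi : ℝ)) = 1 := by
    by_contra h3
    have h4 : (1 - Complex.exp (c * (4 * Real.pi : ℝ))) • v = 0 := by
      rw [sub_smul, one_smul, ← h2, sub_self]
    rcases smul_eq_zero.1 h4 with h5 | h5
    · exact h3 (sub_eq_zero.1 h5).symm
    · exact hv0 h5
  have h3 := congrArg norm h1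
  rw [Complex.norm_exp, norm_one, Real.exp_eq_one_iff, Complex.re_mul_ofReal] at h3
  rcases mul_eq_zero.1 h3 with h | h
  · exact h
  · linarith [Real.pi_pos]

end Eigen

/-! ### Coordinate rotations generate the spin group -/

section Generation

variable {n : ℕ}

/-- Conjugation by a basis vector. -/
def conjBasis (p : Fin n × Fin 2) (m : Spin n) : Spin n :=
  ⟨ev p * m * ev p, conj_mem (sqForm_single p) m.2⟩

theorem coe_conjBasis (p : Fin n × Fin 2) (m : Spin n) :
    (conjBasis p m : CliffordAlgebra (sqForm n)) = ev p * m * ev p := rfl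

theorem conjBasis_one (p : Fin n × Fin 2) : conjBasis p 1 = 1 := by
  apply Subtype.ext
  rw [coe_conjBasis, Submonoid.coe_one, mul_one, ev_sq]

theorem conjBasis_mul (p : Fin n × Fin 2) (a b : Spin n) :
    conjBasis p (a * b) = conjBasis p a * conjBasis p b := by
  apply Subtype.ext
  rw [Submonoid.coe_mul, coe_conjBasis, coe_conjBasis, coe_conjBasis, Submonoid.coe_mul]
  calc ev p * ((a : CliffordAlgebra (sqForm n)) * b) * ev p
      = ev p * a * 1 * b * ev p := by noncomm_ring
    _ = _ := by rw [← ev_sq p]; noncomm_ring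

theorem conjBasis_inv (p : Fin n × Fin 2) (a : Spin n) :
    conjBasis p a⁻¹ = (conjBasis p a)⁻¹ := by
  rw [eq_inv_iff_mul_eq_one, ← conjBasis_mul, inv_mul_cancel, conjBasis_one]

theorem circ_conj_left {R : Type*} [Ring R] [Algebra ℝ R] {u i j : R} (hu : u * u = 1)
    (h : u * i * u = j) (t : ℝ) : u * circ i t * u = circ j t := by
  rw [circ, circ, ← h, Algebra.algebraMap_eq_smul_one]
  simp only [mul_add, add_mul, mul_smul_comm, smul_mul_assoc, mul_one, hu]

theorem conjBasis_rot_of_ne {p q r : Fin n × Fin 2} (hp : r ≠ p) (hq : r ≠ q) (θ : ℝ) :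
    conjBasis r (rot p q θ) = rot p q θ := by
  by_cases h : p = q
  · rw [h, rot_self, conjBasis_one]
  · apply Subtype.ext
    rw [coe_conjBasis, coe_rot h]
    refine circ_conj_left (ev_sq r) ?_ _
    calc ev r * (ev p * ev q) * ev r = ev r * ev p * (ev q * ev r) := by noncomm_ring
      _ = ev p * (ev r * ev r) * ev q := by
        rw [ev_anticomm hp, ev_anticomm hq.symm]; noncomm_ring
      _ = _ := by rw [ev_sq, mul_one]

theorem conjBasis_rot_left (p q : Fin n × Fin 2) (θ : ℝ) :
    conjBasis p (rot p q θ) = rot p q (-θ) := by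
  by_cases h : p = q
  · rw [h, rot_self, rot_self, conjBasis_one]
  · rw [← rot_swap]
    apply Subtype.ext
    rw [coe_conjBasis, coe_rot h, coe_rot (Ne.symm h)]
    refine circ_conj_left (ev_sq p) ?_ _
    calc ev p * (ev p * ev q) * ev p = (ev p * ev p) * ev q * ev p := by noncomm_ring
      _ = _ := by rw [ev_sq, one_mul]

theorem conjBasis_rot_right (p q : Fin n × Fin 2) (θ : ℝ) :
    conjBasis q (rot p q θ) = rot p q (-θ) := by
  rw [rot_swap q p, conjBasis_rot_left, neg_neg, rot_swap q p, neg_neg]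

/-- The subgroup generated by the rotations in coordinate planes. -/
def rotSubgroup (n : ℕ) : Subgroup (Spin n) :=
  Subgroup.closure {g | ∃ (p q : Fin n × Fin 2) (θ : ℝ), g = rot p q θ}

theorem rot_mem_rotSubgroup (p q : Fin n × Fin 2) (θ : ℝ) : rot p q θ ∈ rotSubgroup n :=
  Subgroup.subset_closure ⟨p, q, θ, rfl⟩

theorem conjBasis_mem_rotSubgroup (r : Fin n × Fin 2) {h : Spin n} (hh : h ∈ rotSubgroup n) :
    conjBasis r h ∈ rotSubgroup n := by
  induction hh using Subgroup.closure_induction with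
  | mem x hx =>
    obtain ⟨p, q, θ, rfl⟩ := hx
    by_cases hp : r = p
    · subst hp; rw [conjBasis_rot_left]; exact rot_mem_rotSubgroup _ _ _
    by_cases hq : r = q
    · subst hq; rw [conjBasis_rot_right]; exact rot_mem_rotSubgroup _ _ _
    rw [conjBasis_rot_of_ne hp hq]; exact rot_mem_rotSubgroup _ _ _
  | one => rw [conjBasis_one]; exact one_mem _
  | mul x y _ _ hx hy => rw [conjBasis_mul]; exact mul_mem hx hy
  | inv x _ hx => rw [conjBasis_inv]; exact inv_mem hx

theorem vec_eq_sum (x : Fin n × Fin 2 → ℝ) : vec x = ∑ r, x r • ev r := by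
  have : x = ∑ r, x r • (Pi.single r 1 : Fin n × Fin 2 → ℝ) := by
    funext s
    simp [Finset.sum_apply, Pi.single_apply]
  conv_lhs => rw [this]
  simp [vec, map_sum]

theorem rot_conj_ev_of_ne {p q r : Fin n × Fin 2} (hp : r ≠ p) (hq : r ≠ q) (θ : ℝ) :
    (rot p q θ : CliffordAlgebra (sqForm n)) * ev r * (rot p q (-θ) : Spin n) = ev r := by
  have h1 := conjBasis_rot_of_ne hp hq θ
  have h2 : ev r * (rot p q θ : CliffordAlgebra (sqForm n)) * ev r = rot p q θ :=
    congrArg Subtype.val h1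
  have h3 : (rot p q θ : CliffordAlgebra (sqForm n)) * (rot p q (-θ) : Spin n) = 1 := by
    rw [← Submonoid.coe_mul, ← rot_add, add_neg_cancel, rot_zero]; rfl
  calc (rot p q θ : CliffordAlgebra (sqForm n)) * ev r * (rot p q (-θ) : Spin n)
      = ev r * (rot p q θ : CliffordAlgebra (sqForm n)) * (ev r * ev r) *
        (rot p q (-θ) : Spin n) := by
        conv_lhs => rw [← h2]
        noncomm_ring
    _ = ev r * ((rot p q θ : CliffordAlgebra (sqForm n)) * (rot p q (-θ) : Spin n)) := by
        rw [ev_sq]; noncomm_ring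
    _ = ev r := by rw [h3, mul_one]

theorem circ_mul_left {p q : Fin n × Fin 2} (h : p ≠ q) (θ : ℝ) :
    circ (ev p * ev q) (θ / 2) * ev p * circ (ev p * ev q) (-θ / 2) =
      Real.cos θ • ev p - Real.sin θ • ev q := by
  have h1 : ev p * circ (ev p * ev q) (-θ / 2) = circ (ev p * ev q) (θ / 2) * ev p := by
    have h2 : ev p * (ev p * ev q) = -(ev p * ev q * ev p) := by
      rw [mul_assoc, ev_anticomm h.symm]; noncomm_ring
    rw [neg_div]
    simp only [circ, Algebra.algebraMap_eq_smul_one, mul_add, add_mul, mul_smul_comm,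
      smul_mul_assoc, mul_one, one_mul, Real.cos_neg, Real.sin_neg, h2]
    module
  rw [mul_assoc, h1, ← mul_assoc, ← circ_add (biv_sq h), add_halves, circ,
    Algebra.algebraMap_eq_smul_one, add_mul, smul_mul_assoc, one_mul, smul_mul_assoc, mul_assoc,
    ev_anticomm h.symm, mul_neg, ← mul_assoc, ev_sq, one_mul, smul_neg, sub_eq_add_neg]

theorem rot_conj_ev_left {p q : Fin n × Fin 2} (h : p ≠ q) (θ : ℝ) :
    (rot p q θ : CliffordAlgebra (sqForm n)) * ev p * (rot p q (-θ) : Spin n) =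
      Real.cos θ • ev p - Real.sin θ • ev q := by
  rw [coe_rot h, coe_rot h, circ_mul_left h]

theorem rot_conj_ev_right {p q : Fin n × Fin 2} (h : p ≠ q) (θ : ℝ) :
    (rot p q θ : CliffordAlgebra (sqForm n)) * ev q * (rot p q (-θ) : Spin n) =
      Real.cos θ • ev q + Real.sin θ • ev p := by
  rw [rot_swap q p, rot_swap q p, neg_neg]
  have := rot_conj_ev_left h.symm (-θ)
  rw [neg_neg] at this
  rw [this, Real.cos_neg, Real.sin_neg]
  module

theorem rot_conj_vec {p q : Fin n × Fin 2} (h : p ≠ q) (θ : ℝ) (x : Fin n × Fin 2 → ℝ) :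
    (rot p q θ : CliffordAlgebra (sqForm n)) * vec x * (rot p q (-θ) : Spin n) =
      vec (Function.update (Function.update x p (Real.cos θ * x p + Real.sin θ * x q)) q
        (Real.cos θ * x q - Real.sin θ * x p)) := by
  rw [vec_eq_sum, vec_eq_sum, Finset.mul_sum, Finset.sum_mul,
    ← Finset.add_sum_erase _ _ (Finset.mem_univ p),
    ← Finset.add_sum_erase _ _ (Finset.mem_erase.2 ⟨h.symm, Finset.mem_univ q⟩),
    ← Finset.add_sum_erase Finset.univ (fun r => Function.update _ _ _ r • ev r)
      (Finset.mem_univ p),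
    ← Finset.add_sum_erase (Finset.univ.erase p) (fun r => Function.update _ _ _ r • ev r)
      (Finset.mem_erase.2 ⟨h.symm, Finset.mem_univ q⟩), ← add_assoc, ← add_assoc]
  congr 1
  · simp only [mul_smul_comm, smul_mul_assoc, rot_conj_ev_left h, rot_conj_ev_right h,
      Function.update_self, Function.update_of_ne h]
    module
  · refine Finset.sum_congr rfl fun r hr => ?_
    simp only [Finset.mem_erase] at hr
    rw [mul_smul_comm, smul_mul_assoc, rot_conj_ev_of_ne hr.2.1 hr.1, Function.update_of_ne hr.1,
      Function.update_of_ne hr.2.1]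

/-- Two orthogonal coordinates can be rotated into one. -/
theorem exists_angle (a b : ℝ) : ∃ θ : ℝ, Real.cos θ * b - Real.sin θ * a = 0 := by
  refine ⟨Complex.arg ⟨a, b⟩, ?_⟩
  have h1 := Complex.norm_mul_cos_arg ⟨a, b⟩
  have h2 := Complex.norm_mul_sin_arg ⟨a, b⟩
  simp only at h1 h2
  by_cases h0 : (⟨a, b⟩ : ℂ) = 0
  · have ha : a = 0 := congrArg Complex.re h0
    have hb : b = 0 := congrArg Complex.im h0
    simp [ha, hb]
  · have : ‖(⟨a, b⟩ : ℂ)‖ ≠ 0 := by simpa using h0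
    apply mul_left_cancel₀ this
    linear_combination b * h1 - a * h2

/-- A unit vector is carried to a basis vector by finitely many coordinate rotations, each of which
removes one coordinate. -/
theorem exists_conj_ev (p₀ : Fin n × Fin 2) (S : Finset (Fin n × Fin 2)) (hS : p₀ ∉ S) :
    ∀ x : Fin n × Fin 2 → ℝ, sqForm n x = 1 → (∀ r, r ≠ p₀ → r ∉ S → x r = 0) →
      ∃ h ∈ rotSubgroup n, vec x = h * ev p₀ * (h⁻¹ : Spin n) := by
  induction S using Finset.induction_on with
  | empty =>
    intro x hx h0
    have hx' : x = x p₀ • (Pi.single p₀ 1 : Fin n × Fin 2 → ℝ) := by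
      funext r
      by_cases hr : r = p₀
      · subst hr; simp
      · simp [hr, h0 r hr (by simp)]
    have hsq : x p₀ * x p₀ = 1 := by
      rw [sqForm_apply, Finset.sum_eq_single p₀ (fun r _ hr => by rw [h0 r hr (by simp)]; simp)
        (by simp)] at hx
      exact hx
    rcases mul_self_eq_one_iff.1 hsq with h1 | h1
    · refine ⟨1, one_mem _, ?_⟩
      rw [hx', h1]; simp
    · obtain ⟨q, hq⟩ : ∃ q, p₀ ≠ q := by
        refine ⟨(p₀.1, p₀.2 + 1), fun h => ?_⟩
        have := congrArg Prod.snd h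
        simp at this
      refine ⟨rot p₀ q Real.pi, rot_mem_rotSubgroup _ _ _, ?_⟩
      rw [rot_inv, rot_conj_ev_left hq, hx', h1]
      simp
  | insert q S hqS ih =>
    intro x hx h0
    simp only [Finset.mem_insert, not_or] at hS
    obtain ⟨θ, hθ⟩ := exists_angle (x p₀) (x q)
    have hconj := rot_conj_vec hS.1 θ x
    rw [hθ] at hconj
    set y := Function.update (Function.update x p₀ (Real.cos θ * x p₀ + Real.sin θ * x q)) q 0
      with hy
    have hinv : ∀ t : ℝ, (rot p₀ q t : CliffordAlgebra (sqForm n)) * (rot p₀ q (-t) : Spin n) =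
        1 := by
      intro t
      rw [← Submonoid.coe_mul, ← rot_add, add_neg_cancel, rot_zero]; rfl
    have hinv' : ((rot p₀ q (-θ) : Spin n) : CliffordAlgebra (sqForm n)) * (rot p₀ q θ : Spin n) =
        1 := by
      simpa using hinv (-θ)
    have hy1 : sqForm n y = 1 := by
      have h1 : vec y * vec y = 1 := by
        rw [← hconj]
        calc (rot p₀ q θ : CliffordAlgebra (sqForm n)) * vec x * (rot p₀ q (-θ) : Spin n) *
            ((rot p₀ q θ : CliffordAlgebra (sqForm n)) * vec x * (rot p₀ q (-θ) : Spin n))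
            = (rot p₀ q θ : CliffordAlgebra (sqForm n)) * vec x *
              (((rot p₀ q (-θ) : Spin n) : CliffordAlgebra (sqForm n)) * (rot p₀ q θ : Spin n)) *
              vec x * (rot p₀ q (-θ) : Spin n) := by noncomm_ring
          _ = (rot p₀ q θ : CliffordAlgebra (sqForm n)) * (vec x * vec x) *
              (rot p₀ q (-θ) : Spin n) := by rw [hinv']; noncomm_ring
          _ = 1 := by rw [vec_mul_self hx, mul_one, hinv]
      rw [CliffordAlgebra.ι_sq_scalar] at h1
      have := (algebraMap ℝ (CliffordAlgebra (sqForm n))).injective (h1.trans (map_one _).symm)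
      exact this
    obtain ⟨h, hh, hv⟩ := ih hS.2 y hy1 (by
      intro r hr hrS
      by_cases hrq : r = q
      · subst hrq; simp [hy]
      · rw [hy, Function.update_of_ne hrq, Function.update_of_ne hr]
        exact h0 r hr (by simp [hrq, hrS]))
    refine ⟨rot p₀ q (-θ) * h, mul_mem (rot_mem_rotSubgroup _ _ _) hh, ?_⟩
    rw [mul_inv_rev, rot_inv, neg_neg, Submonoid.coe_mul, Submonoid.coe_mul]
    calc vec x = (((rot p₀ q (-θ) : Spin n) : CliffordAlgebra (sqForm n)) * (rot p₀ q θ : Spin n)) *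
          vec x * (((rot p₀ q (-θ) : Spin n) : CliffordAlgebra (sqForm n)) * (rot p₀ q θ : Spin n)) := by
          rw [hinv', one_mul, mul_one]
      _ = ((rot p₀ q (-θ) : Spin n) : CliffordAlgebra (sqForm n)) *
          ((rot p₀ q θ : CliffordAlgebra (sqForm n)) * vec x * (rot p₀ q (-θ) : Spin n)) *
          (rot p₀ q θ : Spin n) := by noncomm_ring
      _ = _ := by rw [hconj, hv]; noncomm_ring

/-- Here `h e h⁻¹ = h (e h⁻¹ e) e`, and conjugation by a basis vector preserves `rotSubgroup`. -/
theorem exists_rot_mul_ev (p₀ : Fin n × Fin 2) {x : Fin n × Fin 2 → ℝ} (hx : sqForm n x = 1) :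
    ∃ h ∈ rotSubgroup n, vec x = h * ev p₀ := by
  obtain ⟨h, hh, hv⟩ := exists_conj_ev p₀ (Finset.univ.erase p₀) (by simp) x hx
    (by intro r hr hr'; simp [hr] at hr')
  refine ⟨h * conjBasis p₀ h⁻¹, mul_mem hh (conjBasis_mem_rotSubgroup _ (inv_mem hh)), ?_⟩
  rw [hv, Submonoid.coe_mul, coe_conjBasis]
  calc (h : CliffordAlgebra (sqForm n)) * ev p₀ * (h⁻¹ : Spin n)
      = h * ev p₀ * (h⁻¹ : Spin n) * (ev p₀ * ev p₀) := by rw [ev_sq, mul_one]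
    _ = _ := by noncomm_ring

theorem ev_mul_coe (p₀ : Fin n × Fin 2) (h : Spin n) :
    ev p₀ * (h : CliffordAlgebra (sqForm n)) = conjBasis p₀ h * ev p₀ := by
  rw [coe_conjBasis, mul_assoc, ev_sq, mul_one]

theorem coe_mul_coe_inv (h : Spin n) : (h : CliffordAlgebra (sqForm n)) * (h⁻¹ : Spin n) = 1 := by
  rw [← Submonoid.coe_mul, mul_inv_cancel, Submonoid.coe_one]

/-- Up to a scalar, each element of the Lipschitz group is `h` or `h e_{p₀}`, with `h` a product of
coordinate rotations. -/
theorem lipschitz_decomp (p₀ : Fin n × Fin 2) (u : (CliffordAlgebra (sqForm n))ˣ)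
    (hu : u ∈ lipschitzGroup (sqForm n)) : ∃ (c : ℝ), c ≠ 0 ∧ ∃ h ∈ rotSubgroup n,
      (u : CliffordAlgebra (sqForm n)) = c • (h : CliffordAlgebra (sqForm n)) ∨
      (u : CliffordAlgebra (sqForm n)) = c • (h * ev p₀) := by
  induction hu using Subgroup.closure_induction with
  | mem u hu =>
    obtain ⟨x, hx⟩ := hu
    have hx0 : x ≠ 0 := by
      rintro rfl
      rw [map_zero] at hx
      exact u.ne_zero hx.symm
    have hpos : 0 < sqForm n x := by
      rw [sqForm_apply]
      obtain ⟨r, hr⟩ := Function.ne_iff.1 hx0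
      exact Finset.sum_pos' (fun r _ => mul_self_nonneg _)
        ⟨r, Finset.mem_univ r, mul_self_pos.2 hr⟩
    set c := Real.sqrt (sqForm n x) with hc
    have hc0 : 0 < c := Real.sqrt_pos.2 hpos
    have hunit : sqForm n (c⁻¹ • x) = 1 := by
      rw [QuadraticMap.map_smul, smul_eq_mul, ← Real.mul_self_sqrt hpos.le, ← hc]
      field_simp
    obtain ⟨h, hh, hv⟩ := exists_rot_mul_ev p₀ hunit
    refine ⟨c, hc0.ne', h, hh, Or.inr ?_⟩
    rw [← hv, vec, map_smul, smul_smul, mul_inv_cancel₀ hc0.ne', one_smul, hx]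
  | one => exact ⟨1, one_ne_zero, 1, one_mem _, Or.inl (by simp)⟩
  | mul a b _ _ ha hb =>
    obtain ⟨c, hc, h, hh, ha⟩ := ha
    obtain ⟨d, hd, k, hk, hb⟩ := hb
    refine ⟨c * d, mul_ne_zero hc hd, ?_⟩
    have hck := conjBasis_mem_rotSubgroup p₀ hk
    rcases ha with ha | ha <;> rcases hb with hb | hb
    · refine ⟨h * k, mul_mem hh hk, Or.inl ?_⟩
      rw [Units.val_mul, ha, hb, smul_mul_smul_comm, Submonoid.coe_mul]
    · refine ⟨h * k, mul_mem hh hk, Or.inr ?_⟩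
      rw [Units.val_mul, ha, hb, smul_mul_smul_comm, Submonoid.coe_mul, mul_assoc]
    · refine ⟨h * conjBasis p₀ k, mul_mem hh hck, Or.inr ?_⟩
      rw [Units.val_mul, ha, hb, smul_mul_smul_comm, Submonoid.coe_mul, mul_assoc, ev_mul_coe,
        ← mul_assoc]
    · refine ⟨h * conjBasis p₀ k, mul_mem hh hck, Or.inl ?_⟩
      rw [Units.val_mul, ha, hb, smul_mul_smul_comm, Submonoid.coe_mul, ← mul_assoc,
        mul_assoc (h : CliffordAlgebra (sqForm n)), ev_mul_coe, ← mul_assoc, mul_assoc _ (ev p₀),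
            ev_sq, mul_one]
  | inv a _ ha =>
    obtain ⟨c, hc, h, hh, ha⟩ := ha
    refine ⟨c⁻¹, inv_ne_zero hc, ?_⟩
    rcases ha with ha | ha
    · refine ⟨h⁻¹, inv_mem hh, Or.inl ?_⟩
      rw [Units.inv_eq_of_mul_eq_one_right]
      rw [ha, smul_mul_smul_comm, mul_inv_cancel₀ hc, coe_mul_coe_inv, one_smul]
    · refine ⟨conjBasis p₀ h⁻¹, conjBasis_mem_rotSubgroup p₀ (inv_mem hh), Or.inr ?_⟩
      rw [Units.inv_eq_of_mul_eq_one_right]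
      rw [ha, smul_mul_smul_comm, mul_inv_cancel₀ hc, ← ev_mul_coe, one_smul]
      calc (h : CliffordAlgebra (sqForm n)) * ev p₀ * (ev p₀ * (h⁻¹ : Spin n))
          = h * (ev p₀ * ev p₀) * (h⁻¹ : Spin n) := by noncomm_ring
        _ = 1 := by rw [ev_sq, mul_one, coe_mul_coe_inv]

/-- Coordinate rotations generate `Spin(2n)`.  In the decomposition of an element of the Lipschitz
group, evenness excludes the factor `e_{p₀}` and the norm condition forces the scalar to be `± 1`.
-/
theorem mem_rotSubgroup [NeZero n] (g : Spin n) : g ∈ rotSubgroup n := by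
  let p₀ : Fin n × Fin 2 := (0, 0)
  let q₀ : Fin n × Fin 2 := (0, 1)
  have hpq : p₀ ≠ q₀ := by simp [p₀, q₀]
  have hg := g.2
  obtain ⟨⟨⟨u, hu, hu1⟩, hun⟩, hev⟩ := hg
  obtain ⟨c, hc, h, hh, hd⟩ := lipschitz_decomp p₀ u hu
  have hu2 : (u : CliffordAlgebra (sqForm n)) = g := hu1
  rw [hu2] at hd
  have inv : ∀ h : Spin n, CliffordAlgebra.involute (h : CliffordAlgebra (sqForm n)) = h :=
    fun h => spinGroup.involute_eq h.2
  have hgne : (g : CliffordAlgebra (sqForm n)) ≠ 0 := by rw [← hu2]; exact u.ne_zero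
  rcases hd with hd | hd
  · have h1 : star (g : CliffordAlgebra (sqForm n)) * g = 1 := spinGroup.star_mul_self_of_mem g.2
    have h2 : star (h : CliffordAlgebra (sqForm n)) * h = 1 := spinGroup.star_mul_self_of_mem h.2
    have h3 : star (c • (h : CliffordAlgebra (sqForm n))) =
        c • star (h : CliffordAlgebra (sqForm n)) := by
      rw [CliffordAlgebra.star_smul]
    rw [hd, h3, smul_mul_smul_comm, h2, ← Algebra.algebraMap_eq_smul_one] at h1
    have h4 := (algebraMap ℝ (CliffordAlgebra (sqForm n))).injective (h1.trans (map_one _).symm)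
    rcases mul_self_eq_one_iff.1 h4 with h5 | h5
    · have : g = h := Subtype.ext (by rw [hd, h5, one_smul])
      rw [this]; exact hh
    -- `-1` is the rotation by `2π`.
    · have : g = rot p₀ q₀ (2 * Real.pi) * h := by
        apply Subtype.ext
        rw [hd, h5, Submonoid.coe_mul, coe_rot hpq, show 2 * Real.pi / 2 = Real.pi by ring, circ]
        simp
      rw [this]; exact mul_mem (rot_mem_rotSubgroup _ _ _) hh
  · exfalso
    have h1 := inv g
    rw [hd, map_smul, map_mul, inv, CliffordAlgebra.involute_ι, mul_neg, smul_neg] at h1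
    rw [← hd] at h1
    have h2 : (2 : ℝ) • (g : CliffordAlgebra (sqForm n)) = 0 := by
      rw [two_smul]; nth_rewrite 1 [← h1]; simp
    exact hgne ((smul_eq_zero.1 h2).resolve_left two_ne_zero)

variable {V : Type*} [AddCommGroup V] [Module ℂ V] [FiniteDimensional ℂ V]
  {σ : Representation ℂ (Spin n) V}

/-- A subspace that is stable under the generators is a subrepresentation. -/
theorem mem_of_rotGen_mem [NeZero n] (hσ : IsContinuousRep σ) (W : Submodule ℂ V)
    (hW : ∀ p q, ∀ w ∈ W, rotGen hσ p q w ∈ W) (g : Spin n) : ∀ w ∈ W, σ g w ∈ W := by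
  have : (∀ w ∈ W, σ g w ∈ W) ∧ (∀ w ∈ W, σ g⁻¹ w ∈ W) := by
    induction mem_rotSubgroup g using Subgroup.closure_induction with
    | mem x hx =>
      obtain ⟨p, q, θ, rfl⟩ := hx
      rw [rot_inv]
      exact ⟨rot_mem_of_rotGen_mem hσ W p q (hW p q) θ,
        rot_mem_of_rotGen_mem hσ W p q (hW p q) (-θ)⟩
    | one => simp
    | mul x y _ _ hx hy =>
      refine ⟨fun w hw => ?_, fun w hw => ?_⟩
      · rw [map_mul]; exact hx.1 _ (hy.1 _ hw)
      · rw [mul_inv_rev, map_mul]; exact hy.2 _ (hx.2 _ hw)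
    | inv x _ hx => rw [inv_inv]; exact ⟨hx.2, hx.1⟩
  exact this.1

end Generation

/-! ### Weights -/

section Cartan

variable {n : ℕ} {V : Type*} [AddCommGroup V] [Module ℂ V] [FiniteDimensional ℂ V]
  {σ : Representation ℂ (Spin n) V}

/-- The element `H_j` of the Cartan subalgebra, with the eigenvalue `μ_j` on the weight space of
weight `μ`. -/
def cartan (hσ : IsContinuousRep σ) (j : Fin n) : Module.End ℂ V :=
  -Complex.I • rotGen hσ (j, 1) (j, 0)

theorem rotGen_eq_cartan (hσ : IsContinuousRep σ) (j : Fin n) :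
    rotGen hσ (j, 1) (j, 0) = Complex.I • cartan hσ j := by
  rw [cartan, smul_smul]; simp

theorem rotGen_apply_iff_cartan (hσ : IsContinuousRep σ) (j : Fin n) (c : ℂ) (v : V) :
    rotGen hσ (j, 1) (j, 0) v = (Complex.I * c) • v ↔ cartan hσ j v = c • v := by
  rw [rotGen_eq_cartan, LinearMap.smul_apply, mul_smul]
  exact (smul_right_injective V Complex.I_ne_zero).eq_iff

theorem torusElt_apply_iff_cartan (hσ : IsContinuousRep σ) (j : Fin n) (c : ℂ) (v : V) :
    (∀ θ : ℝ, σ (torusElt j θ) v = Complex.exp (Complex.I * c * θ) • v) ↔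
      cartan hσ j v = c • v := by
  simp only [torusElt_eq_rot]
  rw [← rotGen_apply_iff_cartan]
  exact ⟨fun h => rotGen_apply_of_rot hσ _ _ h, fun h => rot_apply_of_eigen hσ _ _ h⟩

theorem isWeight_iff (hσ : IsContinuousRep σ) (μ : Fin n → ℝ) :
    IsWeight σ μ ↔ ∃ v : V, v ≠ 0 ∧ ∀ j, cartan hσ j v = (μ j : ℂ) • v := by
  simp only [IsWeight, torusElt_apply_iff_cartan hσ]

theorem cartan_commute (hσ : IsContinuousRep σ) (i j : Fin n) :
    Commute (cartan hσ i) (cartan hσ j) := by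
  by_cases h : i = j
  · rw [h]
  · refine Commute.smul_left (Commute.smul_right ?_ _) _
    exact rotGen_commute hσ (by simp [h]) (by simp) (by simp) (by simp [h])

theorem maxGenEigenspace_eq_eigenspace_of_sq {W : Type*} [AddCommGroup W] [Module ℂ W]
    (f : Module.End ℂ W) (c : ℂ)
    (h : ∀ v w : W, f v = c • v + w → f w = c • w → w = 0) :
    f.maxGenEigenspace c = f.eigenspace c := by
  apply le_antisymm
  · intro v hv
    rw [Module.End.mem_maxGenEigenspace] at hv
    obtain ⟨k, hk⟩ := hv
    induction k with
    | zero => simp at hk; simp [hk]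
    | succ k ih =>
      rcases k with _ | k
      · rw [Module.End.mem_eigenspace_iff]
        simpa [sub_eq_zero] using hk
      · refine ih ?_
        rw [pow_succ', Module.End.mul_apply]
        set u := ((f - c • 1) ^ k) v with hu
        have h1 : (f - c • 1) ((f - c • 1) u) = 0 := by
          rw [pow_succ', pow_succ', Module.End.mul_apply, Module.End.mul_apply] at hk
          exact hk
        refine h u _ ?_ ?_
        · simp
        · have := sub_eq_zero.1 h1
          simpa using this
  · intro v hv
    exact Module.End.mem_maxGenEigenspace _ _ _ |>.2 ⟨1, by
      rw [Module.End.mem_eigenspace_iff] at hv; simp [hv]⟩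

theorem maxGenEigenspace_cartan (hσ : IsContinuousRep σ) (j : Fin n) (c : ℂ) :
    (cartan hσ j).maxGenEigenspace c = (cartan hσ j).eigenspace c := by
  apply maxGenEigenspace_eq_eigenspace_of_sq
  intro v w hv hw
  have h1 : rotGen hσ (j, 1) (j, 0) v = (Complex.I * c) • v + Complex.I • w := by
    rw [rotGen_eq_cartan, LinearMap.smul_apply, hv, smul_add, smul_smul]
  have h2 : rotGen hσ (j, 1) (j, 0) (Complex.I • w) = (Complex.I * c) • (Complex.I • w) := by
    rw [map_smul, (rotGen_apply_iff_cartan hσ j c w).2 hw, smul_comm]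
  exact (smul_eq_zero.1 (rotGen_sub_sq hσ _ _ h1 h2)).resolve_left Complex.I_ne_zero

/-- A basis of simultaneous eigenvectors of the maximal torus: the Cartan generators commute, and
their generalized eigenspaces are eigenspaces. -/
theorem exists_weightBasis (hσ : IsContinuousRep σ) :
    ∃ (b : Module.Basis (Fin (Module.finrank ℂ V)) ℂ V)
      (wt : Fin (Module.finrank ℂ V) → Fin n → ℝ),
      ∀ i j, cartan hσ j (b i) = (wt i j : ℂ) • b i := by
  have htop :=
      Module.End.iSup_iInf_maxGenEigenspace_eq_top_of_iSup_maxGenEigenspace_eq_top_of_commute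
    (cartan hσ) (fun i j _ => cartan_commute hσ i j)
    (fun j => Module.End.iSup_maxGenEigenspace_eq_top _)
  simp only [maxGenEigenspace_cartan] at htop
  let s : Set V := {v | v ≠ 0 ∧ ∃ χ : Fin n → ℂ, ∀ j, cartan hσ j v = χ j • v}
  have hs : ⊤ ≤ Submodule.span ℂ s := by
    rw [← htop]
    refine iSup_le fun χ v hv => ?_
    by_cases h0 : v = 0
    · rw [h0]; exact zero_mem _
    refine Submodule.subset_span ⟨h0, χ, fun j => ?_⟩
    rw [Submodule.mem_iInf] at hv
    exact Module.End.mem_eigenspace_iff.1 (hv j)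
  let b₀ := Module.Basis.ofSpan hs
  have := Module.Finite.finite_basis b₀
  let _ := Fintype.ofFinite (((linearIndepOn_empty ℂ id).extend (Set.empty_subset s)))
  let b := b₀.reindex (Fintype.equivFinOfCardEq (Module.finrank_eq_card_basis b₀).symm)
  have hb : ∀ i, b i ∈ s := fun i => by
    rw [Module.Basis.reindex_apply]
    exact Module.Basis.ofSpan_subset hs ⟨_, rfl⟩
  choose h0 χ hχ using hb
  refine ⟨b, fun i j => (χ i j).re, fun i j => ?_⟩
  rw [hχ]
  congr 1
  have h1 := rotGen_eigen_re hσ _ _ (h0 i) ((rotGen_apply_iff_cartan hσ j _ _).2 (hχ i j))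
  apply Complex.ext
  · simp
  · simpa using h1

theorem weight_mem_of_basis (hσ : IsContinuousRep σ) {ι : Type*} (b : Module.Basis ι ℂ V)
    (wt : ι → Fin n → ℝ) (hb : ∀ i j, cartan hσ j (b i) = (wt i j : ℂ) • b i) (μ : Fin n → ℝ) :
    IsWeight σ μ ↔ ∃ i, wt i = μ := by
  rw [isWeight_iff hσ]
  constructor
  · rintro ⟨v, hv0, hv⟩
    obtain ⟨i, hi⟩ : ∃ i, b.repr v i ≠ 0 := by
      by_contra h
      push Not at h
      exact hv0 (b.repr.map_eq_zero_iff.1 (Finsupp.ext h))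
    refine ⟨i, funext fun j => ?_⟩
    have h1 : ∀ w, b.repr (cartan hσ j w) i = (wt i j : ℂ) * b.repr w i := by
      intro w
      have h2 : (b.coord i) ∘ₗ cartan hσ j = (wt i j : ℂ) • b.coord i := by
        refine b.ext fun k => ?_
        simp only [LinearMap.comp_apply, hb, map_smul, LinearMap.smul_apply, smul_eq_mul,
          Module.Basis.coord_apply, Module.Basis.repr_self]
        by_cases hk : k = i
        · rw [hk]
        · simp [hk]
      exact congrArg (fun f => f w) h2
    have h2 := h1 v
    rw [hv, map_smul, Finsupp.smul_apply, smul_eq_mul] at h2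
    exact_mod_cast (mul_right_cancel₀ hi h2).symm
  · rintro ⟨i, rfl⟩
    exact ⟨b i, b.ne_zero i, hb i⟩

end Cartan

/-! ### Symmetries of the set of weights -/

section Flip

variable {n : ℕ} {R : Type*} [InvolutiveNeg R]

/-- The sign change of the coordinates in `S`. -/
def flipOn (S : Finset (Fin n)) (μ : Fin n → R) : Fin n → R := fun i => if i ∈ S then -μ i else μ i

theorem flipOn_empty (μ : Fin n → R) : flipOn ∅ μ = μ := by
  funext i; simp [flipOn]

theorem flipOn_flipOn_singleton_self (a : Fin n) (μ : Fin n → R) :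
    flipOn {a} (flipOn {a} μ) = μ := by
  funext i; by_cases h : i = a <;> simp [flipOn, h]

theorem flipOn_insert {a : Fin n} {S : Finset (Fin n)} (ha : a ∉ S) (μ : Fin n → R) :
    flipOn (insert a S) μ = flipOn S (flipOn {a} μ) := by
  funext i
  by_cases h : i = a
  · subst h; simp [flipOn, ha]
  · simp [flipOn, h]

theorem flipOn_univ (μ : Fin n → R) : flipOn Finset.univ μ = fun i => -μ i := by
  funext i; simp [flipOn]

/-- A function that is invariant under sign changes of two coordinates sees only the parity of the
number of sign changes. -/
theorem flipOn_invariant {γ : Type*} (f : (Fin n → R) → γ)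
    (hf : ∀ j k, j ≠ k → ∀ μ, f (flipOn {j} (flipOn {k} μ)) = f μ) (l : Fin n)
    (S : Finset (Fin n)) :
    ∀ μ, f (flipOn S μ) = if Even S.card then f μ else f (flipOn {l} μ) := by
  have h1 : ∀ a μ, f (flipOn {a} μ) = f (flipOn {l} μ) := by
    intro a μ
    by_cases h : a = l
    · rw [h]
    · rw [← hf l a (Ne.symm h), flipOn_flipOn_singleton_self]
  have h2 : ∀ a μ, f (flipOn {l} (flipOn {a} μ)) = f μ := by
    intro a μ
    by_cases h : a = l
    · rw [h, flipOn_flipOn_singleton_self]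
    · rw [hf l a (Ne.symm h)]
  induction S using Finset.induction_on with
  | empty => intro μ; simp [flipOn_empty]
  | insert a S ha ih =>
    intro μ
    rw [flipOn_insert ha, ih, Finset.card_insert_of_notMem ha]
    by_cases hS : Even S.card
    · rw [if_pos hS, if_neg (by rw [Nat.even_add_one, not_not]; exact hS), h1]
    · rw [if_neg hS, if_pos (by rw [Nat.even_add_one]; exact hS), h2]

end Flip

section Weyl

variable {n : ℕ}

theorem coe_conj_circ {R : Type*} [Ring R] [Algebra ℝ R] {s t a b a' b' : R} (hst : s * t = 1)
    (hts : t * s = 1) (ha : s * a * t = a') (hb : s * b * t = b') (θ : ℝ) :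
    s * circ (a * b) θ * t = circ (a' * b') θ := by
  have : s * (a * b) * t = a' * b' := by
    rw [← ha, ← hb]
    calc s * (a * b) * t = s * a * 1 * b * t := by noncomm_ring
      _ = _ := by rw [← hts]; noncomm_ring
  rw [circ, circ, ← this, Algebra.algebraMap_eq_smul_one]
  simp only [mul_add, add_mul, mul_smul_comm, smul_mul_assoc, mul_one, hst]

theorem coe_inv_mul_coe (h : Spin n) : ((h⁻¹ : Spin n) : CliffordAlgebra (sqForm n)) * h = 1 := by
  rw [← Submonoid.coe_mul, inv_mul_cancel, Submonoid.coe_one]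

/-- A spin element that realizes the transposition of the planes `j` and `k`. -/
def swapElt (j k : Fin n) : Spin n :=
  rot (j, 0) (k, 0) (Real.pi / 2) * rot (j, 1) (k, 1) (Real.pi / 2)

/-- A spin element that realizes the sign change of the coordinates `j` and `k`. -/
def flipElt (j k : Fin n) : Spin n := rot (j, 0) (k, 0) Real.pi

/-- The quarter turns in the planes `(j, a)`, `(k, a)` carry `e_{k,a}` to `e_{j,a}` and `e_{j,a}` to
`-e_{k,a}`; the signs cancel in the bivectors that define the torus. -/
theorem swapElt_conj_torusElt {j k : Fin n} (h : j ≠ k) (i : Fin n) (θ : ℝ) :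
    swapElt j k * torusElt i θ * (swapElt j k)⁻¹ = torusElt (Equiv.swap j k i) θ := by
  have hjk : ∀ a, ((j, a) : Fin n × Fin 2) ≠ (k, a) := fun a => by simp [h]
  have key : ∀ a : Fin 2, ∃ ε : ℝ, ε * ε = 1 ∧ ∀ b,
      (rot (j, a) (k, a) (Real.pi / 2) : CliffordAlgebra (sqForm n)) * ev (i, b) *
        (rot (j, a) (k, a) (-(Real.pi / 2)) : Spin n) =
      if b = a then ε • ev (Equiv.swap j k i, b) else ev (i, b) := by
    intro a
    by_cases hj : i = j
    · refine ⟨-1, by norm_num, fun b => ?_⟩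
      subst hj
      by_cases hb : b = a
      · subst hb
        rw [rot_conj_ev_left (hjk b)]
        simp
      · rw [if_neg hb, rot_conj_ev_of_ne (by simp [hb]) (by simp [hb])]
    by_cases hk : i = k
    · refine ⟨1, by norm_num, fun b => ?_⟩
      subst hk
      by_cases hb : b = a
      · subst hb
        rw [rot_conj_ev_right (hjk b)]
        simp
      · rw [if_neg hb, rot_conj_ev_of_ne (by simp [hb]) (by simp [hb])]
    · refine ⟨1, by norm_num, fun b => ?_⟩
      rw [rot_conj_ev_of_ne (by simp [hj]) (by simp [hk]), Equiv.swap_apply_of_ne_of_ne hj hk]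
      simp
  obtain ⟨ε, hε, k0⟩ := key 0
  obtain ⟨δ, hδ, k1⟩ := key 1
  -- The two quarter turns introduce the same sign in both coordinates of the plane.
  have hεδ : ε = δ := by
    have key2 : ∀ a : Fin 2, ∀ ε : ℝ,
        (rot (j, a) (k, a) (Real.pi / 2) : CliffordAlgebra (sqForm n)) *
        ev (i, a) * (rot (j, a) (k, a) (-(Real.pi / 2)) : Spin n) = ε • ev (Equiv.swap j k i, a) →
        ε = if i = j then -1 else 1 := by
      intro a ε he
      have inj : ∀ (x y : ℝ) (p : Fin n × Fin 2), x • ev p = y • ev p → x = y := by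
        intro x y p hxy
        have := congrArg (fun z => z * ev p) hxy
        simp only [smul_mul_assoc, ev_sq, ← Algebra.algebraMap_eq_smul_one] at this
        exact (algebraMap ℝ (CliffordAlgebra (sqForm n))).injective this
      by_cases hj : i = j
      · subst hj
        rw [rot_conj_ev_left (hjk a)] at he
        refine inj _ _ (k, a) ?_
        rw [Equiv.swap_apply_left] at he
        rw [← he]; simp
      by_cases hk : i = k
      · subst hk
        rw [rot_conj_ev_right (hjk a)] at he
        refine inj _ _ (j, a) ?_
        rw [Equiv.swap_apply_right] at he
        rw [← he]; simp [hj]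
      · rw [rot_conj_ev_of_ne (by simp [hj]) (by simp [hk]),
          Equiv.swap_apply_of_ne_of_ne hj hk] at he
        refine inj _ _ (i, a) ?_
        rw [← he]; simp [hj]
    rw [key2 0 ε (by simpa using k0 0), key2 1 δ (by simpa using k1 1)]
  have inv : (swapElt j k)⁻¹ =
      rot (j, 1) (k, 1) (-(Real.pi / 2)) * rot (j, 0) (k, 0) (-(Real.pi / 2)) := by
    rw [swapElt, mul_inv_rev, rot_inv, rot_inv]
  have c0 : (swapElt j k : CliffordAlgebra (sqForm n)) * ev (i, 0) * ((swapElt j k)⁻¹ : Spin n) =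
      ε • ev (Equiv.swap j k i, 0) := by
    rw [inv, swapElt, Submonoid.coe_mul, Submonoid.coe_mul]
    have e0 := k0 0
    have e1 := k1 0
    simp only [if_true, Fin.isValue, zero_ne_one, if_false] at e0 e1
    rw [← e0]
    nth_rewrite 2 [← e1]
    noncomm_ring
  have c1 : (swapElt j k : CliffordAlgebra (sqForm n)) * ev (i, 1) * ((swapElt j k)⁻¹ : Spin n) =
      ε • ev (Equiv.swap j k i, 1) := by
    rw [inv, swapElt, Submonoid.coe_mul, Submonoid.coe_mul]
    have e1 := k1 1
    simp only [if_true] at e1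
    have e0 : (rot (j, 0) (k, 0) (Real.pi / 2) : CliffordAlgebra (sqForm n)) *
        ev (Equiv.swap j k i, 1) * (rot (j, 0) (k, 0) (-(Real.pi / 2)) : Spin n) =
        ev (Equiv.swap j k i, 1) := rot_conj_ev_of_ne (by simp) (by simp) _
    rw [hεδ, ← e0]
    calc _ = (rot (j, 0) (k, 0) (Real.pi / 2) : CliffordAlgebra (sqForm n)) *
          ((rot (j, 1) (k, 1) (Real.pi / 2) : CliffordAlgebra (sqForm n)) * ev (i, 1) *
            (rot (j, 1) (k, 1) (-(Real.pi / 2)) : Spin n)) *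
          (rot (j, 0) (k, 0) (-(Real.pi / 2)) : Spin n) := by noncomm_ring
      _ = _ := by rw [e1, mul_smul_comm, smul_mul_assoc]
  apply Subtype.ext
  rw [Submonoid.coe_mul, Submonoid.coe_mul, torusElt_eq_rot, torusElt_eq_rot, coe_rot (by simp),
    coe_rot (by simp), coe_conj_circ (coe_mul_coe_inv _) (coe_inv_mul_coe _) c1 c0,
    smul_mul_smul_comm, hε, one_smul]

theorem flipElt_conj_torusElt {j k : Fin n} (h : j ≠ k) (i : Fin n) (θ : ℝ) :
    flipElt j k * torusElt i θ * (flipElt j k)⁻¹ =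
      torusElt i (if i = j ∨ i = k then -θ else θ) := by
  have hjk : ((j, 0) : Fin n × Fin 2) ≠ (k, 0) := by simp [h]
  have c1 : (flipElt j k : CliffordAlgebra (sqForm n)) * ev (i, 1) * ((flipElt j k)⁻¹ : Spin n) =
      ev (i, 1) := by
    rw [flipElt, rot_inv, rot_conj_ev_of_ne (by simp) (by simp)]
  have c0 : (flipElt j k : CliffordAlgebra (sqForm n)) * ev (i, 0) * ((flipElt j k)⁻¹ : Spin n) =
      if i = j ∨ i = k then -ev (i, 0) else ev (i, 0) := by
    rw [flipElt, rot_inv]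
    by_cases hj : i = j
    · subst hj; rw [rot_conj_ev_left hjk]; simp
    by_cases hk : i = k
    · subst hk; rw [rot_conj_ev_right hjk]; simp
    rw [rot_conj_ev_of_ne (by simp [hj]) (by simp [hk])]; simp [hj, hk]
  apply Subtype.ext
  rw [Submonoid.coe_mul, Submonoid.coe_mul, torusElt_eq_rot, torusElt_eq_rot, coe_rot (by simp),
    coe_rot (by simp), coe_conj_circ (coe_mul_coe_inv _) (coe_inv_mul_coe _) c1 c0]
  split_ifs
  · rw [mul_neg, neg_div, circ_neg]
  · rfl

theorem conjBasis_torusElt (l i : Fin n) (θ : ℝ) :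
    conjBasis (l, 0) (torusElt i θ) = torusElt i (if i = l then -θ else θ) := by
  rw [torusElt_eq_rot, torusElt_eq_rot]
  by_cases h : i = l
  · subst h; rw [conjBasis_rot_right]; simp
  · rw [conjBasis_rot_of_ne (by simp) (by simp [Ne.symm h])]; simp [h]

variable {V : Type*} [AddCommGroup V] [Module ℂ V] {σ : Representation ℂ (Spin n) V}

/-- `v` is a simultaneous eigenvector of the torus, of weight `μ`. -/
def IsWeightVec (σ : Representation ℂ (Spin n) V) (μ : Fin n → ℝ) (v : V) : Prop :=
  ∀ (j : Fin n) (θ : ℝ), σ (torusElt j θ) v = Complex.exp (Complex.I * μ j * θ) • v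

theorem IsWeightVec.swap {μ : Fin n → ℝ} {v : V} (hv : IsWeightVec σ μ v) {j k : Fin n}
    (h : j ≠ k) : IsWeightVec σ (μ ∘ Equiv.swap j k) (σ (swapElt j k) v) := by
  intro i θ
  have h1 := swapElt_conj_torusElt h (Equiv.swap j k i) θ
  rw [Equiv.swap_apply_self] at h1
  have h2 : torusElt i θ * swapElt j k = swapElt j k * torusElt (Equiv.swap j k i) θ := by
    rw [← h1]; group
  rw [← Module.End.mul_apply, ← map_mul, h2, map_mul, Module.End.mul_apply, hv, map_smul]
  rfl

theorem IsWeightVec.flip {μ : Fin n → ℝ} {v : V} (hv : IsWeightVec σ μ v) {j k : Fin n}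
    (h : j ≠ k) : IsWeightVec σ (flipOn {j} (flipOn {k} μ)) (σ (flipElt j k) v) := by
  intro i θ
  have h1 := flipElt_conj_torusElt h i (if i = j ∨ i = k then -θ else θ)
  have h2 : torusElt i θ * flipElt j k =
      flipElt j k * torusElt i (if i = j ∨ i = k then -θ else θ) := by
    have : (if i = j ∨ i = k then -(if i = j ∨ i = k then -θ else θ)
        else (if i = j ∨ i = k then -θ else θ)) = θ := by split_ifs <;> simp
    rw [this] at h1
    rw [← h1]; group
  rw [← Module.End.mul_apply, ← map_mul, h2, map_mul, Module.End.mul_apply, hv, map_smul]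
  congr 2
  by_cases hj : i = j
  · subst hj; simp [flipOn, h]
  by_cases hk : i = k
  · subst hk; simp [flipOn, hj]
  · simp [flipOn, hj, hk]

theorem sigma_ne_zero (g : Spin n) {v : V} (hv : v ≠ 0) : σ g v ≠ 0 := by
  intro h
  apply hv
  have := congrArg (σ g⁻¹) h
  rwa [map_zero, ← Module.End.mul_apply, ← map_mul, inv_mul_cancel, map_one] at this

theorem IsWeight.swap {μ : Fin n → ℝ} (hμ : IsWeight σ μ) {j k : Fin n} (h : j ≠ k) :
    IsWeight σ (μ ∘ Equiv.swap j k) := by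
  obtain ⟨v, hv0, hv⟩ := hμ
  exact ⟨_, sigma_ne_zero _ hv0, IsWeightVec.swap hv h⟩

theorem IsWeight.flip {μ : Fin n → ℝ} (hμ : IsWeight σ μ) {j k : Fin n} (h : j ≠ k) :
    IsWeight σ (flipOn {j} (flipOn {k} μ)) := by
  obtain ⟨v, hv0, hv⟩ := hμ
  exact ⟨_, sigma_ne_zero _ hv0, IsWeightVec.flip hv h⟩

theorem flipOn_comm {R : Type*} [InvolutiveNeg R] (j k : Fin n) (μ : Fin n → R) :
    flipOn {j} (flipOn {k} μ) = flipOn {k} (flipOn {j} μ) := by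
  funext i
  simp only [flipOn, Finset.mem_singleton]
  split_ifs <;> rfl

theorem isWeight_flip_flip {j k : Fin n} (h : j ≠ k) (μ : Fin n → ℝ) :
    IsWeight σ (flipOn {j} (flipOn {k} μ)) = IsWeight σ μ := by
  refine propext ⟨fun hμ => ?_, fun hμ => hμ.flip h⟩
  have := hμ.flip h
  rwa [flipOn_comm j k μ, flipOn_flipOn_singleton_self, ← flipOn_comm,
    flipOn_flipOn_singleton_self] at this

theorem isWeight_w0Rep [NeZero n] (μ : Fin n → ℝ) :
    IsWeight (w0Rep σ) μ ↔ IsWeight σ (flipOn {lastIdx n} μ) := by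
  have h1 : ∀ (i : Fin n) (θ : ℝ), w0Rep σ (torusElt i θ) =
      σ (torusElt i (if i = lastIdx n then -θ else θ)) := fun i θ => by
    rw [← conjBasis_torusElt]; rfl
  refine exists_congr fun v => and_congr_right fun _ => ?_
  constructor
  · intro h i θ
    have h2 := h i (if i = lastIdx n then -θ else θ)
    rw [h1] at h2
    by_cases hi : i = lastIdx n
    · simp only [hi, if_true, neg_neg] at h2
      simp [hi, flipOn, h2]
    · simp only [hi, if_false] at h2
      simp [hi, flipOn, h2]
  · intro h i θ
    rw [h1, h]
    by_cases hi : i = lastIdx n <;> simp [hi, flipOn]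

/-- The weights of the contragredient are the negatives of the weights. -/
theorem isWeight_dual [FiniteDimensional ℂ V] (hσ : IsContinuousRep σ) (μ : Fin n → ℝ) :
    IsWeight σ.dual μ ↔ IsWeight σ (fun i => -μ i) := by
  obtain ⟨b, wt, hb⟩ := exists_weightBasis hσ
  have hb' : ∀ i j (θ : ℝ), σ (torusElt j θ) (b i) = Complex.exp (Complex.I * wt i j * θ) • b i :=
    fun i j => (torusElt_apply_iff_cartan hσ j _ _).2 (hb i j)
  have inv : ∀ (j : Fin n) (θ : ℝ), (torusElt j θ)⁻¹ = torusElt j (-θ) := fun j θ => by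
    rw [torusElt_eq_rot, torusElt_eq_rot, rot_inv]
  have hd : ∀ (f : Module.Dual ℂ V) i j (θ : ℝ), σ.dual (torusElt j θ) f (b i) =
      Complex.exp (-(Complex.I * wt i j * θ)) * f (b i) := by
    intro f i j θ
    rw [Representation.dual_apply, inv, Module.Dual.transpose_apply, LinearMap.comp_apply, hb',
      map_smul, smul_eq_mul]
    congr 2; push_cast; ring
  rw [weight_mem_of_basis hσ b wt hb]
  constructor
  · rintro ⟨f, hf0, hf⟩
    obtain ⟨i, hi⟩ : ∃ i, f (b i) ≠ 0 := by
      by_contra h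
      push Not at h
      exact hf0 (b.ext h)
    refine ⟨i, funext fun j => ?_⟩
    have h1 : ∀ θ : ℝ, Complex.exp (Complex.I * μ j * θ) =
        Complex.exp (-(Complex.I * wt i j * θ)) := by
      intro θ
      have h2 := congrArg (fun g : Module.Dual ℂ V => g (b i)) (hf j θ)
      simp only [hd, LinearMap.smul_apply, smul_eq_mul] at h2
      exact (mul_right_cancel₀ hi h2).symm
    -- Differentiation at `θ = 0` compares the exponents.
    have h2 : ∀ c : ℂ, HasDerivAt (fun θ : ℝ => Complex.exp (c * θ)) c 0 := by
      intro c
      have := ((Complex.ofRealCLM.hasDerivAt (x := 0)).const_mul c).cexp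
      simpa using this
    have h3 := (h2 (Complex.I * μ j)).unique ((h2 (-(Complex.I * wt i j))).congr_of_eventuallyEq
      (Filter.Eventually.of_forall fun θ => by simpa [neg_mul] using h1 θ))
    rw [← mul_neg] at h3
    have h4 := mul_left_cancel₀ Complex.I_ne_zero h3
    have h5 : μ j = -wt i j := by exact_mod_cast h4
    rw [h5, neg_neg]
  · rintro ⟨i, hi⟩
    refine ⟨b.coord i, fun h => ?_, fun j θ => b.ext fun k => ?_⟩
    · have := congrArg (fun g : Module.Dual ℂ V => g (b i)) h
      simp at this
    · rw [hd, LinearMap.smul_apply, smul_eq_mul]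
      by_cases hk : k = i
      · subst hk
        rw [hi]; congr 2; push_cast; ring
      · simp [hk]

end Weyl

/-! ### Positive roots and highest weights -/

section Roots

theorem mem_posRoots {r : ℕ} {α : Fin r → ℤ} : α ∈ posRoots r ↔
    ∃ i j, i < j ∧ (α = Pi.single i 1 + Pi.single j 1 ∨ α = Pi.single i 1 - Pi.single j 1) := by
  simp only [posRoots, Finset.mem_union, Finset.mem_image, Finset.mem_filter, Finset.mem_univ,
    true_and, Prod.exists]
  constructor
  · rintro (⟨i, j, h, rfl⟩ | ⟨i, j, h, rfl⟩)
    · exact ⟨i, j, h, Or.inl rfl⟩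
    · exact ⟨i, j, h, Or.inr rfl⟩
  · rintro ⟨i, j, h, rfl | rfl⟩
    · exact Or.inl ⟨i, j, h, rfl⟩
    · exact Or.inr ⟨i, j, h, rfl⟩

theorem height_pos {r : ℕ} {α : Fin r → ℤ} (h : α ∈ posRoots r) :
    0 < ∑ i : Fin r, ((r : ℝ) - (i : ℕ)) * (α i : ℝ) := by
  obtain ⟨i, j, hij, h⟩ := mem_posRoots.1 h
  have hi : ((i : ℕ) : ℝ) < (j : ℕ) := by exact_mod_cast hij
  have hj : ((j : ℕ) : ℝ) < r := by exact_mod_cast j.2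
  have s1 : ∀ k : Fin r, ∑ l : Fin r,
      ((r : ℝ) - (l : ℕ)) * ((Pi.single k (1 : ℤ) : Fin r → ℤ) l : ℝ) =
      (r : ℝ) - (k : ℕ) := by
    intro k
    rw [Finset.sum_eq_single k]
    · simp
    · intro b _ hb; simp [hb]
    · simp
  rcases h with rfl | rfl
  · simp only [Pi.add_apply, Int.cast_add, mul_add, Finset.sum_add_distrib, s1]; linarith
  · simp only [Pi.sub_apply, Int.cast_sub, mul_sub, Finset.sum_sub_distrib, s1]; linarith

variable {n : ℕ} {V : Type*} [AddCommGroup V] [Module ℂ V] {σ : Representation ℂ (Spin n) V}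

/-- Two highest weights differ by a sum of positive roots in both directions, and positive roots
have positive height. -/
theorem isHighestWeight_unique {Λ Λ' : Fin n → ℝ} (h : IsHighestWeight σ Λ)
    (h' : IsHighestWeight σ Λ') : Λ = Λ' := by
  obtain ⟨c, hc⟩ := h.2 _ h'.1
  obtain ⟨c', hc'⟩ := h'.2 _ h.1
  have hsum : ∀ (d : (Fin n → ℤ) → ℕ) (x : Fin n → ℝ),
      (∀ i, x i = ∑ α ∈ posRoots n, (d α : ℝ) * (α i : ℝ)) →
      ∑ i : Fin n, ((n : ℝ) - (i : ℕ)) * x i =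
        ∑ α ∈ posRoots n, (d α : ℝ) * ∑ i : Fin n, ((n : ℝ) - (i : ℕ)) * (α i : ℝ) := by
    intro d x hx
    simp only [hx, Finset.mul_sum]
    rw [Finset.sum_comm]
    exact Finset.sum_congr rfl fun α _ => Finset.sum_congr rfl fun i _ => by ring
  have h1 := hsum c _ hc
  have h2 := hsum c' _ hc'
  have h3 : ∑ i : Fin n, ((n : ℝ) - (i : ℕ)) * (Λ i - Λ' i) =
      -∑ i : Fin n, ((n : ℝ) - (i : ℕ)) * (Λ' i - Λ i) := by
    rw [← Finset.sum_neg_distrib]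
    exact Finset.sum_congr rfl fun i _ => by ring
  have hnn : ∀ d : (Fin n → ℤ) → ℕ, ∀ α ∈ posRoots n,
      0 ≤ (d α : ℝ) * ∑ i : Fin n, ((n : ℝ) - (i : ℕ)) * (α i : ℝ) := fun d α hα =>
    mul_nonneg (Nat.cast_nonneg _) (height_pos hα).le
  have h4 : ∑ α ∈ posRoots n, (c α : ℝ) * ∑ i : Fin n, ((n : ℝ) - (i : ℕ)) * (α i : ℝ) = 0 := by
    have p1 := Finset.sum_nonneg (hnn c)
    have p2 := Finset.sum_nonneg (hnn c')
    linarith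
  have h5 := (Finset.sum_eq_zero_iff_of_nonneg (hnn c)).1 h4
  funext i
  have h6 := hc i
  rw [Finset.sum_eq_zero] at h6
  · linarith
  · intro α hα
    rcases mul_eq_zero.1 (h5 α hα) with h7 | h7
    · rw [h7, zero_mul]
    · exact absurd h7 (height_pos hα).ne'

theorem highestWeight_eq {Λ : Fin n → ℝ} (h : IsHighestWeight σ Λ) : highestWeight σ = Λ := by
  have hex : ∃ Λ, IsHighestWeight σ Λ := ⟨Λ, h⟩
  rw [highestWeight, dif_pos hex]
  exact isHighestWeight_unique hex.choose_spec h

theorem flipOn_last_mem_posRoots [NeZero n] {α : Fin n → ℤ} (h : α ∈ posRoots n) :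
    flipOn {lastIdx n} α ∈ posRoots n := by
  obtain ⟨i, j, hij, h⟩ := mem_posRoots.1 h
  rw [mem_posRoots]
  have hi : i ≠ lastIdx n := by
    rintro rfl
    have h1 : n - 1 < (j : ℕ) := hij
    have := j.2
    omega
  refine ⟨i, j, hij, ?_⟩
  by_cases hj : j = lastIdx n
  · rcases h with rfl | rfl
    · right; funext k
      by_cases hk : k = lastIdx n
      · subst hk; simp [flipOn, hj, hi.symm]
      · simp [flipOn, hj, hk]
    · left; funext k
      by_cases hk : k = lastIdx n
      · subst hk; simp [flipOn, hj, hi.symm]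
      · simp [flipOn, hj, hk]
  · rcases h with rfl | rfl
    · left; funext k
      by_cases hk : k = lastIdx n
      · subst hk; simp [flipOn, Ne.symm hj, hi.symm]
      · simp [flipOn, hk]
    · right; funext k
      by_cases hk : k = lastIdx n
      · subst hk; simp [flipOn, Ne.symm hj, hi.symm]
      · simp [flipOn, hk]

theorem isHighestWeight_w0Rep_of [NeZero n] {Λ : Fin n → ℝ}
    (h : IsHighestWeight σ (flipOn {lastIdx n} Λ)) : IsHighestWeight (w0Rep σ) Λ := by
  refine ⟨(isWeight_w0Rep Λ).2 h.1, fun μ hμ => ?_⟩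
  obtain ⟨c, hc⟩ := h.2 _ ((isWeight_w0Rep μ).1 hμ)
  refine ⟨fun α => c (flipOn {lastIdx n} α), fun i => ?_⟩
  have h1 : ∑ α ∈ posRoots n, (c (flipOn {lastIdx n} α) : ℝ) * (α i : ℝ) =
      ∑ α ∈ posRoots n, (c α : ℝ) * ((flipOn {lastIdx n} α i : ℤ) : ℝ) := by
    refine Finset.sum_bij' (fun α _ => flipOn {lastIdx n} α) (fun α _ => flipOn {lastIdx n} α)
      (fun α hα => flipOn_last_mem_posRoots hα) (fun α hα => flipOn_last_mem_posRoots hα)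
      (fun α _ => flipOn_flipOn_singleton_self _ _) (fun α _ => flipOn_flipOn_singleton_self _ _)
      (fun α _ => ?_)
    rw [flipOn_flipOn_singleton_self]
  rw [h1]
  have h2 := hc i
  by_cases hi : i = lastIdx n
  · simp only [flipOn, hi, Finset.mem_singleton, if_true, Int.cast_neg, mul_neg,
      Finset.sum_neg_distrib] at h2 ⊢
    linarith
  · simpa [flipOn, hi] using h2

theorem w0Rep_w0Rep_isWeight [NeZero n] (μ : Fin n → ℝ) :
    IsWeight (w0Rep (w0Rep σ)) μ ↔ IsWeight σ μ := by
  rw [isWeight_w0Rep, isWeight_w0Rep, flipOn_flipOn_singleton_self]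

theorem isHighestWeight_congr {W : Type*} [AddCommGroup W] [Module ℂ W]
    {τ : Representation ℂ (Spin n) W} (h : ∀ μ, IsWeight τ μ ↔ IsWeight σ μ) (Λ : Fin n → ℝ) :
    IsHighestWeight τ Λ ↔ IsHighestWeight σ Λ := by
  simp only [IsHighestWeight, h]

theorem isHighestWeight_w0Rep [NeZero n] (Λ : Fin n → ℝ) :
    IsHighestWeight (w0Rep σ) Λ ↔ IsHighestWeight σ (flipOn {lastIdx n} Λ) := by
  refine ⟨fun h => ?_, isHighestWeight_w0Rep_of⟩
  rw [← isHighestWeight_congr w0Rep_w0Rep_isWeight]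
  refine isHighestWeight_w0Rep_of ?_
  rwa [flipOn_flipOn_singleton_self]

theorem highestWeight_congr {W : Type*} [AddCommGroup W] [Module ℂ W]
    {τ : Representation ℂ (Spin n) W} (h : ∀ Λ, IsHighestWeight τ Λ ↔ IsHighestWeight σ Λ) :
    highestWeight τ = highestWeight σ := by
  by_cases hex : ∃ Λ, IsHighestWeight σ Λ
  · obtain ⟨Λ, hΛ⟩ := hex
    rw [highestWeight_eq hΛ, highestWeight_eq ((h Λ).2 hΛ)]
  · have hex' : ¬∃ Λ, IsHighestWeight τ Λ := by simpa only [h] using hex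
    rw [highestWeight, highestWeight, dif_neg hex, dif_neg hex']

theorem highestWeight_w0Rep [NeZero n] :
    highestWeight (w0Rep σ) = flipOn {lastIdx n} (highestWeight σ) := by
  by_cases hex : ∃ Λ, IsHighestWeight σ Λ
  · obtain ⟨Λ, hΛ⟩ := hex
    rw [highestWeight_eq hΛ]
    refine highestWeight_eq ((isHighestWeight_w0Rep _).2 ?_)
    rwa [flipOn_flipOn_singleton_self]
  · have hex' : ¬∃ Λ, IsHighestWeight (w0Rep σ) Λ := by
      rintro ⟨Λ, h⟩
      exact hex ⟨_, (isHighestWeight_w0Rep Λ).1 h⟩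
    rw [highestWeight, highestWeight, dif_neg hex, dif_neg hex']
    funext i; simp [flipOn]

/-- The contragredient has the weights of `σ` or of `w₀σ`: the sign change of all coordinates is
an even or odd number of single sign changes. -/
theorem highestWeight_dual [NeZero n] [FiniteDimensional ℂ V] (hσ : IsContinuousRep σ) :
    highestWeight σ.dual = highestWeight σ ∨ highestWeight σ.dual = highestWeight (w0Rep σ) := by
  have h := flipOn_invariant (IsWeight σ) (fun j k hjk μ => isWeight_flip_flip hjk μ) (lastIdx n)
    Finset.univ
  simp only [flipOn_univ] at h
  by_cases hn : Even (Finset.univ : Finset (Fin n)).card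
  · left
    refine highestWeight_congr (isHighestWeight_congr fun μ => ?_)
    rw [isWeight_dual hσ, h, if_pos hn]
  · right
    refine highestWeight_congr (isHighestWeight_congr fun μ => ?_)
    rw [isWeight_dual hσ, h, if_neg hn, isWeight_w0Rep]

end Roots

/-! ### The function `Ω` in coordinates -/

section Explicit

variable {n : ℕ}

theorem killing_single [NeZero n] (x : Fin (n + 1) → ℂ) (i j : Fin (n + 1)) (ε : ℤ) :
    killing x (toDual (Pi.single i 1 + ε • Pi.single j 1)) = (1 / (4 * n)) * (x i + ε * x j) := by
  simp only [killing, toDual, Pi.add_apply, Pi.smul_apply, smul_eq_mul, Int.cast_add, Int.cast_mul,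
    mul_add, Finset.sum_add_distrib]
  congr 2
  · rw [Finset.sum_eq_single i]
    · simp
    · intro b _ hb; simp [hb]
    · simp
  · rw [Finset.sum_eq_single j]
    · simp; ring
    · intro b _ hb; simp [hb]
    · simp

theorem killing_root [NeZero n] {i j : Fin (n + 1)} (hij : i ≠ j) {ε : ℤ} (hε : ε * ε = 1) :
    killing (toDual (Pi.single i 1 + ε • Pi.single j 1 : Fin (n + 1) → ℤ))
      (toDual (Pi.single i 1 + ε • Pi.single j 1)) = (1 / (4 * n)) * 2 := by
  rw [killing_single]
  have : (ε : ℂ) * ε = 1 := by exact_mod_cast hε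
  simp [toDual, hij, hij.symm]
  left; rw [this]; norm_num

theorem atCoroot_root [NeZero n] (x : Fin (n + 1) → ℂ) {i j : Fin (n + 1)} (hij : i ≠ j) {ε : ℤ}
    (hε : ε * ε = 1) : atCoroot x (Pi.single i 1 + ε • Pi.single j 1) = x i + ε * x j := by
  have hn : (n : ℂ) ≠ 0 := Nat.cast_ne_zero.2 (NeZero.ne n)
  rw [atCoroot, killing_root hij hε, killing_single]
  field_simp

theorem atCoroot_add [NeZero n] (x : Fin (n + 1) → ℂ) {i j : Fin (n + 1)} (hij : i ≠ j) :
    atCoroot x (Pi.single i 1 + Pi.single j 1) = x i + x j := by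
  have := atCoroot_root x hij (ε := 1) (by norm_num)
  simpa using this

theorem atCoroot_sub [NeZero n] (x : Fin (n + 1) → ℂ) {i j : Fin (n + 1)} (hij : i ≠ j) :
    atCoroot x (Pi.single i 1 - Pi.single j 1) = x i - x j := by
  have := atCoroot_root x hij (ε := -1) (by norm_num)
  simpa [sub_eq_add_neg] using this

/-- The pairs of indices `i < j`. -/
def ltPairs (r : ℕ) : Finset (Fin r × Fin r) := Finset.univ.filter fun p => p.1 < p.2

theorem mem_ltPairs {r : ℕ} {p : Fin r × Fin r} : p ∈ ltPairs r ↔ p.1 < p.2 := by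
  simp [ltPairs]

theorem single_add_injOn {r : ℕ} : Set.InjOn
    (fun p : Fin r × Fin r => (Pi.single p.1 1 + Pi.single p.2 1 : Fin r → ℤ)) (ltPairs r) := by
  rintro ⟨i, j⟩ h ⟨k, l⟩ h' he
  have h1 : i < j := mem_ltPairs.1 h
  have h2 : k < l := mem_ltPairs.1 h'
  have hv := fun m => congrFun he m
  simp only [Pi.add_apply, Pi.single_apply] at hv
  have a1 := hv i
  have a2 := hv j
  have a3 := hv k
  have a4 := hv l
  simp only [h1.ne, h1.ne', h2.ne, h2.ne', if_true, if_false] at a1 a2 a3 a4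
  by_cases e1 : i = k
  · subst e1
    by_cases e2 : j = l
    · rw [e2]
    · simp [h1.ne', e2] at a2
  · exfalso
    have e2 : i = l := by by_contra e2; simp [e1, e2] at a1
    have e3 : j = k := by
      by_contra e3
      have e4 : j ≠ l := fun h => h1.ne (e2.trans h.symm)
      simp [e3, e4] at a2
    rw [e2, e3] at h1
    exact absurd h1 h2.not_gt

theorem single_sub_injOn {r : ℕ} : Set.InjOn
    (fun p : Fin r × Fin r => (Pi.single p.1 1 - Pi.single p.2 1 : Fin r → ℤ)) (ltPairs r) := by
  rintro ⟨i, j⟩ h ⟨k, l⟩ h' he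
  have h1 : i < j := mem_ltPairs.1 h
  have h2 : k < l := mem_ltPairs.1 h'
  have hv := fun m => congrFun he m
  simp only [Pi.sub_apply, Pi.single_apply] at hv
  have a1 := hv i
  have a2 := hv j
  simp only [h1.ne, h1.ne', if_true, if_false] at a1 a2
  have e1 : i = k := by
    by_contra e1
    simp only [e1, if_false] at a1
    split_ifs at a1 <;> omega
  have e2 : j = l := by
    by_contra e2
    simp only [e2, if_false] at a2
    split_ifs at a2 <;> omega
  rw [e1, e2]

theorem single_add_ne_single_sub {r : ℕ} {i j k l : Fin r} (hkl : k ≠ l) :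
    (Pi.single i 1 + Pi.single j 1 : Fin r → ℤ) ≠ Pi.single k 1 - Pi.single l 1 := by
  intro h
  have := congrFun h l
  simp only [Pi.add_apply, Pi.sub_apply, Pi.single_apply, hkl.symm, if_true, if_false] at this
  split_ifs at this <;> omega

theorem posRoots_eq (r : ℕ) : posRoots r =
    ((ltPairs r).image fun p => Pi.single p.1 1 + Pi.single p.2 1) ∪
      (ltPairs r).image fun p => Pi.single p.1 1 - Pi.single p.2 1 := rfl

theorem posRoots_disjoint (r : ℕ) : Disjoint
    ((ltPairs r).image fun p => (Pi.single p.1 1 + Pi.single p.2 1 : Fin r → ℤ))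
    ((ltPairs r).image fun p => Pi.single p.1 1 - Pi.single p.2 1) := by
  rw [Finset.disjoint_left]
  intro α h1 h2
  obtain ⟨p, hp, rfl⟩ := Finset.mem_image.1 h1
  obtain ⟨q, hq, he⟩ := Finset.mem_image.1 h2
  exact single_add_ne_single_sub (mem_ltPairs.1 hq).ne he.symm

theorem sum_posRoots {M : Type*} [AddCommMonoid M] (r : ℕ) (f : (Fin r → ℤ) → M) :
    ∑ α ∈ posRoots r, f α = ∑ p ∈ ltPairs r, (f (Pi.single p.1 1 + Pi.single p.2 1) +
      f (Pi.single p.1 1 - Pi.single p.2 1)) := by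
  rw [posRoots_eq, Finset.sum_union (posRoots_disjoint r), Finset.sum_image single_add_injOn,
    Finset.sum_image single_sub_injOn, Finset.sum_add_distrib]

theorem prod_posRoots {M : Type*} [CommMonoid M] (r : ℕ) (f : (Fin r → ℤ) → M) :
    ∏ α ∈ posRoots r, f α = ∏ p ∈ ltPairs r, (f (Pi.single p.1 1 + Pi.single p.2 1) *
      f (Pi.single p.1 1 - Pi.single p.2 1)) := by
  rw [posRoots_eq, Finset.prod_union (posRoots_disjoint r), Finset.prod_image single_add_injOn,
    Finset.prod_image single_sub_injOn, Finset.prod_mul_distrib]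

theorem prod_ltPairs_succ {M : Type*} [CommMonoid M] (r : ℕ)
    (f : Fin (r + 1) × Fin (r + 1) → M) :
    ∏ p ∈ ltPairs (r + 1), f p = (∏ j : Fin r, f (0, j.succ)) *
      ∏ p ∈ ltPairs r, f (p.1.succ, p.2.succ) := by
  have h0 : ∀ r, ∀ g : Fin r × Fin r → M, ∏ p ∈ ltPairs r, g p =
      ∏ i : Fin r, ∏ j : Fin r, if i < j then g (i, j) else 1 := by
    intro r g
    rw [ltPairs, Finset.prod_filter, Fintype.prod_prod_type]
  rw [h0, h0, Fin.prod_univ_succ]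
  congr 1
  · rw [Fin.prod_univ_succ]; simp
  · refine Finset.prod_congr rfl fun i _ => ?_
    rw [Fin.prod_univ_succ]; simp

theorem sum_ltPairs_succ {M : Type*} [AddCommMonoid M] (r : ℕ)
    (f : Fin (r + 1) × Fin (r + 1) → M) :
    ∑ p ∈ ltPairs (r + 1), f p = (∑ j : Fin r, f (0, j.succ)) +
      ∑ p ∈ ltPairs r, f (p.1.succ, p.2.succ) :=
  prod_ltPairs_succ (M := Multiplicative M) r f

/-- `∏_{i<j} (x_i² - x_j²)`, the product of the positive roots of `D_r`. -/
def rootProd {r : ℕ} {R : Type*} [CommRing R] (x : Fin r → R) : R :=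
  ∏ p ∈ ltPairs r, (x p.1 ^ 2 - x p.2 ^ 2)

theorem rootProd_congr {r : ℕ} {R : Type*} [CommRing R] {x y : Fin r → R}
    (h : ∀ i, x i ^ 2 = y i ^ 2) : rootProd x = rootProd y :=
  Finset.prod_congr rfl fun p _ => by rw [h, h]

theorem bigPi_eq [NeZero n] (x : Fin (n + 1) → ℂ) : bigPi x =
    rootProd fun j : Fin n => x j.succ := by
  rw [bigPi, posRootsM, Finset.prod_filter, prod_posRoots, prod_ltPairs_succ, rootProd]
  have h1 : ∀ j : Fin n, (j.succ : Fin (n + 1)) ≠ 0 := Fin.succ_ne_zero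
  have h2 : ∀ j : Fin n, (0 : Fin (n + 1)) ≠ j.succ := fun j => (h1 j).symm
  rw [Finset.prod_eq_one, one_mul]
  · refine Finset.prod_congr rfl fun p hp => ?_
    have hp' : p.1.succ ≠ p.2.succ := fun h => (mem_ltPairs.1 hp).ne (Fin.succ_injective _ h)
    have z1 : (Pi.single p.1.succ 1 + Pi.single p.2.succ 1 : Fin (n + 1) → ℤ) 0 = 0 := by
      simp [h2]
    have z2 : (Pi.single p.1.succ 1 - Pi.single p.2.succ 1 : Fin (n + 1) → ℤ) 0 = 0 := by
      simp [h2]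
    rw [if_pos z1, if_pos z2, atCoroot_add _ hp', atCoroot_sub _ hp']
    ring
  · intro j _
    have z1 : ¬(Pi.single 0 1 + Pi.single j.succ 1 : Fin (n + 1) → ℤ) 0 = 0 := by
      simp [h2]
    have z2 : ¬(Pi.single 0 1 - Pi.single j.succ 1 : Fin (n + 1) → ℤ) 0 = 0 := by
      simp [h2]
    rw [if_neg z1, if_neg z2, one_mul]

theorem sum_posRootsA {M : Type*} [AddCommMonoid M] (f : (Fin (n + 1) → ℤ) → M) :
    ∑ α ∈ posRootsA n, f α = ∑ j : Fin n, (f (Pi.single 0 1 + Pi.single j.succ 1) +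
      f (Pi.single 0 1 - Pi.single j.succ 1)) := by
  rw [posRootsA, Finset.sum_filter, sum_posRoots, sum_ltPairs_succ]
  have h1 : ∀ j : Fin n, (j.succ : Fin (n + 1)) ≠ 0 := Fin.succ_ne_zero
  have h2 : ∀ j : Fin n, (0 : Fin (n + 1)) ≠ j.succ := fun j => (h1 j).symm
  rw [add_comm, Finset.sum_eq_zero, zero_add]
  · refine Finset.sum_congr rfl fun j _ => ?_
    have z1 : (Pi.single 0 1 + Pi.single j.succ 1 : Fin (n + 1) → ℤ) 0 ≠ 0 := by
      simp [h2]
    have z2 : (Pi.single 0 1 - Pi.single j.succ 1 : Fin (n + 1) → ℤ) 0 ≠ 0 := by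
      simp [h2]
    rw [if_pos z1, if_pos z2]
  · intro p hp
    have z1 : ¬(Pi.single p.1.succ 1 + Pi.single p.2.succ 1 : Fin (n + 1) → ℤ) 0 ≠ 0 := by
      simp [h2]
    have z2 : ¬(Pi.single p.1.succ 1 - Pi.single p.2.succ 1 : Fin (n + 1) → ℤ) 0 ≠ 0 := by
      simp [h2]
    rw [if_neg z1, if_neg z2, zero_add]

/-- The reflection in `e_1 ± e_j` exchanges the first coordinate and the coordinate `j`, up to a
sign that `Π` does not see. -/
theorem bigPi_reflect [NeZero n] (x : Fin (n + 1) → ℂ) (j : Fin n) {ε : ℤ} (hε : ε * ε = 1) :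
    bigPi (reflect (Pi.single 0 1 + ε • Pi.single j.succ 1) x) =
      rootProd (Function.update (fun i : Fin n => x i.succ) j (x 0)) := by
  have h2 : (0 : Fin (n + 1)) ≠ j.succ := (Fin.succ_ne_zero j).symm
  have hε' : (ε : ℂ) * ε = 1 := by exact_mod_cast hε
  have hr : reflect (Pi.single 0 1 + ε • Pi.single j.succ 1) x =
      x - (x 0 + ε * x j.succ) • toDual (Pi.single 0 1 + ε • Pi.single j.succ 1) := by
    rw [← atCoroot_root x h2 hε]; rfl
  rw [bigPi_eq, hr]
  refine rootProd_congr fun i => ?_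
  by_cases hi : i = j
  · subst hi
    simp [toDual]
    linear_combination (x i.succ ^ 2 * ((ε : ℂ) * ε - 1) + 2 * ε * x 0 * x i.succ + x 0 ^ 2) * hε'
  · have : i.succ ≠ j.succ := fun h => hi (Fin.succ_injective _ h)
    simp [toDual, hi, this]

/-- The summand of index `j` in `Ω`, without the polynomial factor. -/
def psiSum (z a : ℂ) : ℂ :=
  Complex.digamma (1 + (z + a)) + Complex.digamma (1 - (z + a)) +
    (Complex.digamma (1 + (z - a)) + Complex.digamma (1 - (z - a)))

theorem psiSum_neg (z a : ℂ) : psiSum z (-a) = psiSum z a := by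
  simp only [psiSum, sub_neg_eq_add, ← sub_eq_add_neg]
  ring

/-- `λ_σ` on `𝔟`: the coordinates `k_j + ρ_j`. -/
def shifted (k : Fin n → ℝ) (j : Fin n) : ℂ := (k j : ℂ) + (rho n j : ℂ)

theorem omegaExpr_eq [NeZero n] (d : ℕ) (k : Fin n → ℝ) (lam : ℝ) : omegaExpr d k lam =
    -2 * d * (Real.eulerMascheroniConstant : ℂ) - (1 / 2) * ∑ j : Fin n,
      rootProd (Function.update (shifted k) j (Complex.I * lam)) /
        rootProd (fun j => (rho n j : ℂ)) * psiSum (Complex.I * lam) (shifted k j) := by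
  rw [omegaExpr, sum_posRootsA]
  congr 2
  refine Finset.sum_congr rfl fun j _ => ?_
  have h2 : (0 : Fin (n + 1)) ≠ j.succ := (Fin.succ_ne_zero j).symm
  have b1 := bigPi_reflect (lamSigma k lam) j (ε := 1) (by norm_num)
  have b2 := bigPi_reflect (lamSigma k lam) j (ε := -1) (by norm_num)
  rw [one_smul] at b1
  rw [neg_smul, one_smul, ← sub_eq_add_neg] at b2
  rw [b1, b2, atCoroot_add _ h2, atCoroot_sub _ h2, bigPi_eq, ← mul_add]
  rfl

theorem rho_last [NeZero n] : rho n (lastIdx n) = 0 := by simp [rho, lastIdx]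

theorem shifted_flip_last [NeZero n] (k : Fin n → ℝ) :
    shifted (flipOn {lastIdx n} k) = flipOn {lastIdx n} (shifted k) := by
  funext j
  by_cases hj : j = lastIdx n
  · subst hj; simp [shifted, flipOn, rho_last]
  · simp [shifted, flipOn, hj]

/-- The last coordinate of `ρ` is zero, so the sign change passes to `λ_σ`, of which `Ω` sees only
the squares of the coordinates. -/
theorem omegaExpr_flip_last [NeZero n] (d : ℕ) (k : Fin n → ℝ) :
    omegaExpr d (flipOn {lastIdx n} k) = omegaExpr d k := by
  funext lam
  rw [omegaExpr_eq, omegaExpr_eq]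
  congr 2
  refine Finset.sum_congr rfl fun j _ => ?_
  rw [shifted_flip_last]
  congr 1
  · congr 1
    refine rootProd_congr fun i => ?_
    by_cases hi : i = j
    · subst hi; simp
    · rw [Function.update_of_ne hi, Function.update_of_ne hi, flipOn]
      split_ifs <;> ring
  · rw [flipOn]
    split_ifs
    · rw [psiSum_neg]
    · rfl

variable {V : Type*} [AddCommGroup V] [Module ℂ V] {σ : Representation ℂ (Spin n) V}

theorem Omega_w0Rep [NeZero n] (lam : ℝ) : Omega (w0Rep σ) lam = Omega σ lam := by
  rw [Omega, Omega, highestWeight_w0Rep, omegaExpr_flip_last]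

theorem Omega_dual [NeZero n] [FiniteDimensional ℂ V] (hσ : IsContinuousRep σ) (lam : ℝ) :
    Omega σ.dual lam = Omega σ lam := by
  rw [Omega, Omega, Subspace.dual_finrank_eq]
  rcases highestWeight_dual hσ with h | h
  · rw [h]
  · rw [h, highestWeight_w0Rep, omegaExpr_flip_last]

end Explicit

/-! ### Root vectors -/

section RootVectors

variable {n : ℕ}

/-- The index `-a`. -/
def negIdx (a : Fin n × Bool) : Fin n × Bool := (a.1, !a.2)

theorem negIdx_negIdx (a : Fin n × Bool) : negIdx (negIdx a) = a := by simp [negIdx]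

theorem negIdx_inj {a b : Fin n × Bool} : negIdx a = negIdx b ↔ a = b :=
  ⟨fun h => by rw [← negIdx_negIdx a, h, negIdx_negIdx], fun h => by rw [h]⟩

theorem eq_negIdx_comm {a b : Fin n × Bool} : a = negIdx b ↔ b = negIdx a :=
  ⟨fun h => by rw [h, negIdx_negIdx], fun h => by rw [h, negIdx_negIdx]⟩

/-- The sign of the index `a`. -/
def sgnIdx (a : Fin n × Bool) : ℤ := if a.2 then 1 else -1

/-- The weight `± e_j` of the isotropic vector with index `a = (j, ±)`. -/
def idxWeight (a : Fin n × Bool) : Fin n → ℤ := Pi.single a.1 (sgnIdx a)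

/-- The isotropic vector `e_{j,0} ∓ i e_{j,1}` of `ℂ^{2n}`, of weight `± e_j`. -/
def isoVec (a : Fin n × Bool) (p : Fin n × Fin 2) : ℂ :=
  if p.1 = a.1 then (if p.2 = 0 then 1 else -(sgnIdx a) * Complex.I) else 0

theorem sum_isoVec_mul (a b : Fin n × Bool) :
    ∑ p, isoVec a p * isoVec b p = if b = negIdx a then 2 else 0 := by
  rw [Fintype.sum_prod_type, Finset.sum_eq_single a.1]
  · obtain ⟨i, s⟩ := a
    obtain ⟨j, t⟩ := b
    rw [Fin.sum_univ_two]
    by_cases h : i = j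
    · subst h
      cases s <;> cases t <;> simp [isoVec, negIdx, sgnIdx] <;> norm_num
    · simp [isoVec, negIdx, h, Ne.symm h]
  · intro i _ hi
    simp [isoVec, hi]
  · simp

variable {A : Type*} [Ring A] [Algebra ℂ A]

/-- The bilinear extension of the generators `X_{pq}` to pairs of vectors of `ℂ^{2n}`. -/
def biGen (X : Fin n × Fin 2 → Fin n × Fin 2 → A) (u w : Fin n × Fin 2 → ℂ) : A :=
  ∑ p, ∑ q, (u p * w q) • X p q

theorem biGen_lie (X : Fin n × Fin 2 → Fin n × Fin 2 → A)
    (hX : ∀ p q r s, X p q * X r s - X r s * X p q =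
      (if q = r then X p s else 0) - (if p = r then X q s else 0) -
        (if q = s then X p r else 0) + (if p = s then X q r else 0))
    (u w u' w' : Fin n × Fin 2 → ℂ) :
    biGen X u w * biGen X u' w' - biGen X u' w' * biGen X u w =
      (∑ p, w p * u' p) • biGen X u w' - (∑ p, u p * u' p) • biGen X w w' -
        (∑ p, w p * w' p) • biGen X u u' + (∑ p, u p * w' p) • biGen X w u' := by
  have h1 : biGen X u w * biGen X u' w' - biGen X u' w' * biGen X u w =
      ∑ p, ∑ q, ∑ r, ∑ s, (u p * w q * u' r * w' s) • (X p q * X r s - X r s * X p q) := by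
    have e1 : biGen X u w * biGen X u' w' =
        ∑ p, ∑ q, ∑ r, ∑ s, (u p * w q * u' r * w' s) • (X p q * X r s) := by
      simp only [biGen, Finset.sum_mul, Finset.mul_sum, smul_mul_smul_comm, ← mul_assoc]
      calc _ = ∑ r, ∑ p, ∑ s, ∑ q, (u p * w q * u' r * w' s) • (X p q * X r s) :=
            Finset.sum_congr rfl fun r _ => Finset.sum_comm
        _ = ∑ p, ∑ r, ∑ s, ∑ q, (u p * w q * u' r * w' s) • (X p q * X r s) := Finset.sum_comm
        _ = ∑ p, ∑ r, ∑ q, ∑ s, (u p * w q * u' r * w' s) • (X p q * X r s) :=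
            Finset.sum_congr rfl fun p _ => Finset.sum_congr rfl fun r _ => Finset.sum_comm
        _ = _ := Finset.sum_congr rfl fun p _ => Finset.sum_comm
    have e2 : biGen X u' w' * biGen X u w =
        ∑ p, ∑ q, ∑ r, ∑ s, (u p * w q * u' r * w' s) • (X r s * X p q) := by
      simp only [biGen, Finset.sum_mul, Finset.mul_sum, smul_mul_smul_comm]
      refine Finset.sum_congr rfl fun p _ => Finset.sum_congr rfl fun q _ =>
        Finset.sum_congr rfl fun r _ => Finset.sum_congr rfl fun s _ => ?_
      congr 1
      ring
    rw [e1, e2]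
    simp only [smul_sub, Finset.sum_sub_distrib]
  rw [h1]
  simp only [hX, smul_add, smul_sub, Finset.sum_add_distrib, Finset.sum_sub_distrib, smul_ite,
    smul_zero]
  have f1 : ∑ p, ∑ q, ∑ r, ∑ s, (if q = r then (u p * w q * u' r * w' s) • X p s else 0) =
      (∑ p, w p * u' p) • biGen X u w' := by
    have : ∀ p q, ∑ r, ∑ s, (if q = r then (u p * w q * u' r * w' s) • X p s else 0) =
        (w q * u' q) • ∑ s, (u p * w' s) • X p s := by
      intro p q
      rw [Finset.sum_eq_single q (fun r _ hr => by simp [Ne.symm hr]) (by simp), Finset.smul_sum]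
      refine Finset.sum_congr rfl fun s _ => ?_
      rw [if_pos rfl, smul_smul]; congr 1; ring
    simp only [this]
    rw [Finset.sum_comm]
    simp only [← Finset.smul_sum, ← Finset.sum_smul]
    rfl
  have f2 : ∑ p, ∑ q, ∑ r, ∑ s, (if p = r then (u p * w q * u' r * w' s) • X q s else 0) =
      (∑ p, u p * u' p) • biGen X w w' := by
    have : ∀ p q, ∑ r, ∑ s, (if p = r then (u p * w q * u' r * w' s) • X q s else 0) =
        (u p * u' p) • ∑ s, (w q * w' s) • X q s := by
      intro p q
      rw [Finset.sum_eq_single p (fun r _ hr => by simp [Ne.symm hr]) (by simp), Finset.smul_sum]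
      refine Finset.sum_congr rfl fun s _ => ?_
      rw [if_pos rfl, smul_smul]; congr 1; ring
    simp only [this]
    simp only [← Finset.smul_sum, ← Finset.sum_smul]
    rfl
  have f3 : ∑ p, ∑ q, ∑ r, ∑ s, (if q = s then (u p * w q * u' r * w' s) • X p r else 0) =
      (∑ p, w p * w' p) • biGen X u u' := by
    have : ∀ p q, ∑ r, ∑ s, (if q = s then (u p * w q * u' r * w' s) • X p r else 0) =
        (w q * w' q) • ∑ r, (u p * u' r) • X p r := by
      intro p q
      rw [Finset.smul_sum]
      refine Finset.sum_congr rfl fun r _ => ?_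
      rw [Finset.sum_eq_single q (fun r _ hr => by simp [Ne.symm hr]) (by simp)]
      rw [if_pos rfl, smul_smul]; congr 1; ring
    simp only [this]
    rw [Finset.sum_comm]
    simp only [← Finset.smul_sum, ← Finset.sum_smul]
    rfl
  have f4 : ∑ p, ∑ q, ∑ r, ∑ s, (if p = s then (u p * w q * u' r * w' s) • X q r else 0) =
      (∑ p, u p * w' p) • biGen X w u' := by
    have : ∀ p q, ∑ r, ∑ s, (if p = s then (u p * w q * u' r * w' s) • X q r else 0) =
        (u p * w' p) • ∑ r, (w q * u' r) • X q r := by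
      intro p q
      rw [Finset.smul_sum]
      refine Finset.sum_congr rfl fun r _ => ?_
      rw [Finset.sum_eq_single p (fun r _ hr => by simp [Ne.symm hr]) (by simp)]
      rw [if_pos rfl, smul_smul]; congr 1; ring
    simp only [this]
    simp only [← Finset.smul_sum, ← Finset.sum_smul]
    rfl
  rw [f1, f2, f3, f4]

/-- The root vector `E_{ab}` of root `wt a + wt b`; the `E_{a,-a}` span the Cartan subalgebra. -/
def rootVec (X : Fin n × Fin 2 → Fin n × Fin 2 → A) (a b : Fin n × Bool) : A :=
  (1 / 2 : ℂ) • biGen X (isoVec a) (isoVec b)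

theorem rootVec_swap (X : Fin n × Fin 2 → Fin n × Fin 2 → A) (hs : ∀ p q, X q p = -X p q)
    (a b : Fin n × Bool) : rootVec X b a = -rootVec X a b := by
  rw [rootVec, rootVec, ← smul_neg, biGen, biGen, Finset.sum_comm]
  congr 1
  simp only [← Finset.sum_neg_distrib]
  refine Finset.sum_congr rfl fun p _ => Finset.sum_congr rfl fun q _ => ?_
  rw [hs p q, smul_neg, mul_comm]

theorem rootVec_self (X : Fin n × Fin 2 → Fin n × Fin 2 → A) (hs : ∀ p q, X q p = -X p q)
    (a : Fin n × Bool) : rootVec X a a = 0 := by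
  have h := rootVec_swap X hs a a
  have h2 : (2 : ℂ) • rootVec X a a = 0 := by
    rw [two_smul]; nth_rewrite 1 [h]; simp
  exact (smul_eq_zero_iff_right two_ne_zero).1 h2

theorem rootVec_lie (X : Fin n × Fin 2 → Fin n × Fin 2 → A)
    (hX : ∀ p q r s, X p q * X r s - X r s * X p q =
      (if q = r then X p s else 0) - (if p = r then X q s else 0) -
        (if q = s then X p r else 0) + (if p = s then X q r else 0))
    (a b c d : Fin n × Bool) :
    rootVec X a b * rootVec X c d - rootVec X c d * rootVec X a b =
      (if c = negIdx b then rootVec X a d else 0) - (if c = negIdx a then rootVec X b d else 0) -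
        (if d = negIdx b then rootVec X a c else 0) +
        (if d = negIdx a then rootVec X b c else 0) := by
  simp only [rootVec]
  rw [smul_mul_smul_comm, smul_mul_smul_comm, ← smul_sub, biGen_lie X hX]
  simp only [sum_isoVec_mul]
  split_ifs <;> module

/-- The Casimir operator `∑ E_{ab} E_{-b,-a}`. -/
def casimir (E : Fin n × Bool → Fin n × Bool → A) : A :=
  ∑ a, ∑ b, E a b * E (negIdx b) (negIdx a)

/-- In the commutator of `E_{cd}` with the Casimir operator, each of the eight terms is one of the
contractions `∑_b E_{cb} E_{-b,d}` and `∑_b E_{db} E_{-b,c}`, up to sign, and they cancel. -/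
theorem casimir_commute {A : Type*} [Ring A] (E : Fin n × Bool → Fin n × Bool → A)
    (hs : ∀ a b, E b a = -E a b)
    (hE : ∀ a b c d, E a b * E c d - E c d * E a b =
      (if c = negIdx b then E a d else 0) - (if c = negIdx a then E b d else 0) -
        (if d = negIdx b then E a c else 0) + (if d = negIdx a then E b c else 0))
    (c d : Fin n × Bool) : E c d * casimir E = casimir E * E c d := by
  rw [← sub_eq_zero]
  have h1 : E c d * casimir E - casimir E * E c d =
      ∑ a, ∑ b, ((E c d * E a b - E a b * E c d) * E (negIdx b) (negIdx a) +
        E a b * (E c d * E (negIdx b) (negIdx a) - E (negIdx b) (negIdx a) * E c d)) := by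
    simp only [casimir, Finset.mul_sum, Finset.sum_mul, ← Finset.sum_sub_distrib]
    refine Finset.sum_congr rfl fun a _ => Finset.sum_congr rfl fun b _ => ?_
    noncomm_ring
  set P : Fin n × Bool → Fin n × Bool → A := fun c d => ∑ b, E c b * E (negIdx b) d with hP
  have hP' : ∀ c d, ∑ b, E c b * E d (negIdx b) = -P c d := by
    intro c d
    rw [hP, ← Finset.sum_neg_distrib]
    refine Finset.sum_congr rfl fun b _ => ?_
    rw [hs (negIdx b) d, mul_neg]
  have hP'' : ∀ c d, ∑ b, E b c * E d (negIdx b) = P c d := by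
    intro c d
    refine Finset.sum_congr rfl fun b _ => ?_
    rw [hs (negIdx b) d, hs c b]; noncomm_ring
  rw [h1]
  simp only [hE, negIdx_inj, Finset.sum_add_distrib, add_mul, sub_mul, mul_add, mul_sub,
    Finset.sum_sub_distrib, ite_mul, mul_ite, zero_mul, mul_zero]
  have s1 : ∀ (x : Fin n × Bool) (f : Fin n × Bool → Fin n × Bool → A),
      ∑ a, ∑ b, (if a = x then f a b else 0) = ∑ b, f x b := fun x f => by
    rw [Finset.sum_eq_single x (fun r _ hr => by simp [hr]) (by simp)]; simp
  have s2 : ∀ (x : Fin n × Bool) (f : Fin n × Bool → Fin n × Bool → A),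
      ∑ a, ∑ b, (if b = x then f a b else 0) = ∑ a, f a x := fun x f => by
    refine Finset.sum_congr rfl fun a _ => ?_
    rw [Finset.sum_eq_single x (fun r _ hr => by simp [hr]) (by simp)]; simp
  rw [s1, s1, s2, s2, s2, s2, s1, s1]
  simp only [negIdx_negIdx, hP', hP'']
  have e1 : ∑ b, E c b * E (negIdx b) d = P c d := rfl
  have e2 : ∑ b, E d b * E (negIdx b) c = P d c := rfl
  rw [e1, e2]
  abel

theorem biGen_add_left (X : Fin n × Fin 2 → Fin n × Fin 2 → A) (u u' w : Fin n × Fin 2 → ℂ)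
    (c c' : ℂ) : biGen X (c • u + c' • u') w = c • biGen X u w + c' • biGen X u' w := by
  simp only [biGen, Finset.smul_sum, ← Finset.sum_add_distrib, smul_smul, ← add_smul]
  refine Finset.sum_congr rfl fun p _ => Finset.sum_congr rfl fun q _ => ?_
  congr 1; simp; ring

theorem biGen_add_right (X : Fin n × Fin 2 → Fin n × Fin 2 → A) (u w w' : Fin n × Fin 2 → ℂ)
    (c c' : ℂ) : biGen X u (c • w + c' • w') = c • biGen X u w + c' • biGen X u w' := by
  simp only [biGen, Finset.smul_sum, ← Finset.sum_add_distrib, smul_smul, ← add_smul]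
  refine Finset.sum_congr rfl fun p _ => Finset.sum_congr rfl fun q _ => ?_
  congr 1; simp; ring

theorem biGen_single (X : Fin n × Fin 2 → Fin n × Fin 2 → A) (p q : Fin n × Fin 2) :
    biGen X (Pi.single p 1) (Pi.single q 1) = X p q := by
  rw [biGen, Finset.sum_eq_single p (fun r _ hr => by simp [hr]) (by simp),
    Finset.sum_eq_single q (fun r _ hr => by simp [hr]) (by simp)]
  simp

theorem single_eq_isoVec (p : Fin n × Fin 2) : ∃ c c' : ℂ, (Pi.single p 1 : Fin n × Fin 2 → ℂ) =
    c • isoVec (p.1, true) + c' • isoVec (p.1, false) := by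
  obtain ⟨i, a⟩ := p
  fin_cases a
  · refine ⟨1 / 2, 1 / 2, funext fun r => ?_⟩
    obtain ⟨j, b⟩ := r
    by_cases h : j = i
    · subst h
      fin_cases b <;> simp [isoVec, sgnIdx]
      norm_num
    · simp [isoVec, h]
  · refine ⟨Complex.I / 2, -Complex.I / 2, funext fun r => ?_⟩
    obtain ⟨j, b⟩ := r
    by_cases h : j = i
    · subst h
      fin_cases b <;> simp [isoVec, sgnIdx]
      · ring
      · linear_combination Complex.I_mul_I
    · simp [isoVec, h]

/-- A subspace stable under the root vectors is stable under the generators. -/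
theorem gen_mem_of_rootVec_mem {V : Type*} [AddCommGroup V] [Module ℂ V]
    (X : Fin n × Fin 2 → Fin n × Fin 2 → Module.End ℂ V) (W : Submodule ℂ V)
    (hW : ∀ a b, ∀ w ∈ W, rootVec X a b w ∈ W) (p q : Fin n × Fin 2) : ∀ w ∈ W, X p q w ∈ W := by
  have h1 : ∀ a b, ∀ w ∈ W, biGen X (isoVec a) (isoVec b) w ∈ W := by
    intro a b w hw
    have := W.smul_mem 2 (hW a b w hw)
    rw [rootVec, LinearMap.smul_apply, smul_smul] at this
    simpa using this
  intro w hw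
  obtain ⟨c, c', h⟩ := single_eq_isoVec p
  obtain ⟨d, d', h'⟩ := single_eq_isoVec q
  rw [← biGen_single X p q, h, h', biGen_add_left, biGen_add_right, biGen_add_right]
  simp only [LinearMap.add_apply, LinearMap.smul_apply]
  exact W.add_mem (W.smul_mem _ (W.add_mem (W.smul_mem _ (h1 _ _ _ hw))
    (W.smul_mem _ (h1 _ _ _ hw))))
    (W.smul_mem _ (W.add_mem (W.smul_mem _ (h1 _ _ _ hw)) (W.smul_mem _ (h1 _ _ _ hw))))

end RootVectors

section RepRootVectors

variable {n : ℕ} {V : Type*} [AddCommGroup V] [Module ℂ V] [FiniteDimensional ℂ V]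
  {σ : Representation ℂ (Spin n) V}

/-- The action of the root vector with indices `a`, `b`. -/
def rootOp (hσ : IsContinuousRep σ) (a b : Fin n × Bool) : Module.End ℂ V :=
  rootVec (rotGen hσ) a b

theorem rootOp_swap (hσ : IsContinuousRep σ) (a b : Fin n × Bool) :
    rootOp hσ b a = -rootOp hσ a b := rootVec_swap _ (rotGen_swap hσ) a b

theorem rootOp_self (hσ : IsContinuousRep σ) (a : Fin n × Bool) :
    rootOp hσ a a = 0 := rootVec_self _ (rotGen_swap hσ) a

theorem rootOp_lie (hσ : IsContinuousRep σ) (a b c d : Fin n × Bool) :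
    rootOp hσ a b * rootOp hσ c d - rootOp hσ c d * rootOp hσ a b =
      (if c = negIdx b then rootOp hσ a d else 0) - (if c = negIdx a then rootOp hσ b d else 0) -
        (if d = negIdx b then rootOp hσ a c else 0) +
        (if d = negIdx a then rootOp hσ b c else 0) :=
  rootVec_lie _ (rotGen_lie hσ) a b c d

theorem rootOp_neg (hσ : IsContinuousRep σ) (a : Fin n × Bool) :
    rootOp hσ a (negIdx a) = (sgnIdx a : ℂ) • cartan hσ a.1 := by
  have key : ∀ j : Fin n, rootOp hσ (j, true) (j, false) = cartan hσ j := by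
    intro j
    have h1 : ∀ s : Bool, isoVec (j, s) = (1 : ℂ) • Pi.single (j, 0) 1 +
        (-(sgnIdx (j, s)) * Complex.I) • Pi.single (j, 1) (1 : ℂ) := by
      intro s
      funext r
      obtain ⟨i, b⟩ := r
      by_cases h : i = j
      · subst h
        fin_cases b <;> simp [isoVec]
      · simp [isoVec, h]
    rw [rootOp, rootVec, h1, h1, biGen_add_left, biGen_add_right, biGen_add_right]
    simp only [biGen_single, rotGen_self, rotGen_swap hσ (j, 1) (j, 0), cartan]
    simp [sgnIdx]
    module
  obtain ⟨j, s⟩ := a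
  cases s
  · have : negIdx (j, false) = (j, true) := rfl
    rw [this, rootOp_swap, key]; simp [sgnIdx]
  · have : negIdx (j, true) = (j, false) := rfl
    rw [this, key]; simp [sgnIdx]

theorem cartan_rootOp (hσ : IsContinuousRep σ) (j : Fin n) (c d : Fin n × Bool) :
    cartan hσ j * rootOp hσ c d = rootOp hσ c d * cartan hσ j +
      (((idxWeight c + idxWeight d) j : ℤ) : ℂ) • rootOp hσ c d := by
  have h := rootOp_lie hσ (j, true) (j, false) c d
  have h0 := rootOp_neg hσ (j, true)
  have e1 : negIdx (j, true) = (j, false) := rfl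
  have e2 : negIdx (j, false) = (j, true) := rfl
  simp only [e1] at h0
  rw [h0] at h
  simp only [sgnIdx, if_true, Int.cast_one, one_smul, e1, e2] at h
  rw [sub_eq_iff_eq_add] at h
  rw [h, add_comm]
  congr 1
  have s : ∀ a : Fin n × Bool, ((idxWeight a j : ℤ) : ℂ) =
      (if a = (j, true) then 1 else 0) - (if a = (j, false) then 1 else 0) := by
    rintro ⟨i, t⟩
    by_cases hi : i = j
    · subst hi; cases t <;> simp [idxWeight, sgnIdx]
    · simp [idxWeight, hi, Ne.symm hi]
  rw [Pi.add_apply, Int.cast_add, s, s]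
  have t1 : ∀ x, (if c = x then rootOp hσ x d else 0) =
      (if c = x then (1 : ℂ) else 0) • rootOp hσ c d := by
    intro x
    by_cases hx : c = x
    · subst hx; simp
    · simp [hx]
  have t2 : ∀ x, (if d = x then rootOp hσ x c else 0) =
      -((if d = x then (1 : ℂ) else 0) • rootOp hσ c d) := by
    intro x
    by_cases hx : d = x
    · subst hx; simp [rootOp_swap hσ c d]
    · simp [hx]
  rw [t1, t1, t2, t2]
  module

/-- The Casimir operator acts on an irreducible representation by a scalar. -/
theorem exists_casimir_scalar [NeZero n] (hσ : IsContinuousRep σ) (hirr : σ.IsIrreducible) :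
    ∃ κ : ℂ, casimir (rootOp hσ) = κ • 1 := by
  have hnt : Nontrivial V := by
    by_contra h
    rw [not_nontrivial_iff_subsingleton] at h
    have : (⊥ : Subrepresentation σ) = ⊤ := by
      apply Subrepresentation.toSubmodule_injective
      exact Subsingleton.elim _ _
    exact bot_ne_top this
  obtain ⟨κ, hκ⟩ := Module.End.exists_eigenvalue (casimir (rootOp hσ))
  refine ⟨κ, ?_⟩
  have hst : ∀ g : Spin n, ∀ w ∈ (casimir (rootOp hσ)).eigenspace κ,
      σ g w ∈ (casimir (rootOp hσ)).eigenspace κ := by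
    refine mem_of_rotGen_mem hσ _ (gen_mem_of_rootVec_mem _ _ fun a b w hw => ?_)
    rw [Module.End.mem_eigenspace_iff] at hw ⊢
    have hc := casimir_commute (rootOp hσ) (rootOp_swap hσ) (rootOp_lie hσ) a b
    have := congrArg (fun T => T w) hc
    simp only [Module.End.mul_apply, hw, map_smul] at this
    exact this.symm
  let W : Subrepresentation σ := ⟨(casimir (rootOp hσ)).eigenspace κ, fun g w hw => hst g w hw⟩
  rcases eq_bot_or_eq_top W with h | h
  · exact absurd (congrArg Subrepresentation.toSubmodule h) hκ
  · ext v
    have hv : v ∈ W.toSubmodule := by rw [h]; trivial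
    simpa using Module.End.mem_eigenspace_iff.1 hv

end RepRootVectors

/-! ### Dominant weights -/

section Dominant

variable {n : ℕ}

/-- Dominant weights of `D_n`: the conditions `k_i ≥ |k_j|` for `i < j` are the conditions on the
positive roots `e_i ± e_j`. -/
def IsDominant (d : Fin n → ℤ) : Prop := ∀ i j, i < j → |d j| ≤ d i

/-- Dominant weights in the interior of the Weyl chamber. -/
def IsStrictDominant (d : Fin n → ℤ) : Prop := ∀ i j, i < j → |d j| < d i

theorem IsStrictDominant.isDominant {d : Fin n → ℤ} (h : IsStrictDominant d) : IsDominant d :=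
  fun i j hij => (h i j hij).le

/-- The cone dual to the dominant Weyl chamber; it contains the positive roots. -/
def dualCone (n : ℕ) : AddSubmonoid (Fin n → ℤ) where
  carrier := {x | ∀ d, IsDominant d → 0 ≤ ∑ i, x i * d i}
  zero_mem' := fun d _ => by simp
  add_mem' := fun {x y} hx hy d hd => by
    simp only [Pi.add_apply, add_mul, Finset.sum_add_distrib]
    exact add_nonneg (hx d hd) (hy d hd)

theorem sum_single_mul (i : Fin n) (d : Fin n → ℤ) :
    ∑ l, (Pi.single i (1 : ℤ) : Fin n → ℤ) l * d l = d i := by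
  rw [Finset.sum_eq_single i (fun b _ hb => by simp [hb]) (by simp)]
  simp

theorem single_add_single_mem {i j : Fin n} (h : i < j) :
    (Pi.single i 1 + Pi.single j 1 : Fin n → ℤ) ∈ dualCone n := fun d hd => by
  simp only [Pi.add_apply, add_mul, Finset.sum_add_distrib, sum_single_mul]
  have := (abs_le.1 (hd i j h)).1
  linarith

theorem single_sub_single_mem {i j : Fin n} (h : i < j) :
    (Pi.single i 1 - Pi.single j 1 : Fin n → ℤ) ∈ dualCone n := fun d hd => by
  simp only [Pi.sub_apply, sub_mul, Finset.sum_sub_distrib, sum_single_mul]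
  have := (abs_le.1 (hd i j h)).2
  linarith

theorem posRoots_subset {α : Fin n → ℤ} (h : α ∈ posRoots n) : α ∈ dualCone n := by
  obtain ⟨i, j, hij, rfl | rfl⟩ := mem_posRoots.1 h
  · exact single_add_single_mem hij
  · exact single_sub_single_mem hij

/-- The pairing of the cone with an interior point of the chamber is positive: the point can be
moved by `± e_m` inside the chamber. -/
theorem abs_le_pairing {a x : Fin n → ℤ} (ha : IsStrictDominant a) (hx : x ∈ dualCone n)
    (m : Fin n) : |x m| ≤ ∑ i, x i * a i := by
  have h1 : ∀ s : ℤ, |s| = 1 → IsDominant (a + s • Pi.single m 1) := by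
    intro s hs i j hij
    have h0 := ha i j hij
    simp only [Pi.add_apply, Pi.smul_apply, smul_eq_mul]
    by_cases hi : m = i
    · subst hi
      have : (Pi.single m (1 : ℤ) : Fin n → ℤ) j = 0 := by simp [hij.ne']
      rw [this]
      have := neg_abs_le s
      simp
      omega
    · have : (Pi.single m (1 : ℤ) : Fin n → ℤ) i = 0 := by simp [Ne.symm hi]
      rw [this]
      have h2 : |a j + s * (Pi.single m (1 : ℤ) : Fin n → ℤ) j| ≤ |a j| + 1 := by
        refine (abs_add_le _ _).trans (add_le_add le_rfl ?_)
        rw [abs_mul, hs, one_mul]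
        by_cases hj : j = m
        · subst hj; simp
        · simp [hj]
      omega
  have h2 : ∀ s : ℤ, ∑ i, x i * (a + s • Pi.single m (1 : ℤ) : Fin n → ℤ) i =
      ∑ i, x i * a i + s * x m := by
    intro s
    simp only [Pi.add_apply, mul_add, Finset.sum_add_distrib, Pi.smul_apply, smul_eq_mul]
    congr 1
    rw [Finset.sum_eq_single m (fun b _ hb => by simp [hb]) (by simp)]
    simp [mul_comm]
  have h3 := hx _ (h1 1 (by simp))
  have h4 := hx _ (h1 (-1) (by simp))
  rw [h2] at h3 h4
  rw [abs_le]
  constructor <;> linarith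

theorem eq_zero_of_pairing_le {a x : Fin n → ℤ} (ha : IsStrictDominant a) (hx : x ∈ dualCone n)
    (h : ∑ i, x i * a i ≤ 0) : x = 0 := by
  funext m
  have := abs_le_pairing ha hx m
  exact abs_nonpos_iff.1 (this.trans h)

/-- A dominant weight below the interior point `a` of the chamber is shorter than `a`, unless it is
equal to `a`. -/
theorem eq_of_norm_le {a ν : Fin n → ℤ} (ha : IsStrictDominant a) (hν : IsDominant ν)
    (hx : a - ν ∈ dualCone n) (h : ∑ i, a i ^ 2 ≤ ∑ i, ν i ^ 2) : ν = a := by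
  have h1 := hx ν hν
  have h2 : ∑ i, (a - ν) i * a i ≤ 0 := by
    have : ∑ i, a i ^ 2 - ∑ i, ν i ^ 2 = ∑ i, (a - ν) i * a i + ∑ i, (a - ν) i * ν i := by
      rw [← Finset.sum_sub_distrib, ← Finset.sum_add_distrib]
      exact Finset.sum_congr rfl fun i _ => by simp only [Pi.sub_apply]; ring
    linarith
  exact (sub_eq_zero.1 (eq_zero_of_pairing_le ha hx h2)).symm

/-- An interior point of the chamber. -/
def chamberPoint (n : ℕ) (i : Fin n) : ℤ := (n : ℤ) - (i : ℕ)

theorem chamberPoint_strictDominant (n : ℕ) : IsStrictDominant (chamberPoint n) := by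
  intro i j hij
  have h1 : (i : ℕ) < j := hij
  have h2 := j.2
  rw [chamberPoint, chamberPoint, abs_of_nonneg] <;> omega

theorem eq_of_sub_mem {x y : Fin n → ℤ} (h : x - y ∈ dualCone n) (h' : y - x ∈ dualCone n) :
    x = y := by
  refine sub_eq_zero.1 (eq_zero_of_pairing_le (chamberPoint_strictDominant n) h ?_)
  have := h' _ (chamberPoint_strictDominant n).isDominant
  simp only [Pi.sub_apply, sub_mul, Finset.sum_sub_distrib] at this ⊢
  linarith

/-- A weight is dominant if its pairing with an interior point of the chamber does not increase
under the reflections. -/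
theorem isDominant_of_pairing_le {k : Fin n → ℤ}
    (h1 : ∀ i j, i < j → ∑ l, (k ∘ Equiv.swap i j) l * chamberPoint n l ≤
      ∑ l, k l * chamberPoint n l)
    (h2 : ∀ i j, i < j → ∑ l, flipOn {i} (flipOn {j} (k ∘ Equiv.swap i j)) l * chamberPoint n l ≤
      ∑ l, k l * chamberPoint n l) : IsDominant k := by
  intro i j hij
  have hd := chamberPoint_strictDominant n i j hij
  have hsum : ∀ x : Fin n → ℤ, (∀ l, l ≠ i → l ≠ j → x l = 0) →
      ∑ l, x l * chamberPoint n l = x i * chamberPoint n i + x j * chamberPoint n j := by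
    intro x hx
    rw [← Finset.sum_pair (f := fun l => x l * chamberPoint n l) hij.ne, eq_comm]
    refine Finset.sum_subset (Finset.subset_univ _) fun l _ hl => ?_
    simp only [Finset.mem_insert, Finset.mem_singleton, not_or] at hl
    rw [hx l hl.1 hl.2, zero_mul]
  have h1 := h1 i j hij
  have h2 := h2 i j hij
  have hsub : ∀ x : Fin n → ℤ, ∑ l, x l * chamberPoint n l ≤ ∑ l, k l * chamberPoint n l →
      0 ≤ ∑ l, (k - x) l * chamberPoint n l := by
    intro x hx
    simp only [Pi.sub_apply, sub_mul, Finset.sum_sub_distrib]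
    linarith
  replace h1 := hsub _ h1
  replace h2 := hsub _ h2
  rw [hsum _ (fun l h1 h2 => by simp [Equiv.swap_apply_of_ne_of_ne h1 h2])] at h1
  rw [hsum _ (fun l h1 h2 => by simp [flipOn, h1, h2, Equiv.swap_apply_of_ne_of_ne h1 h2])] at h2
  simp [flipOn, hij.ne, hij.ne'] at h1 h2
  rw [abs_lt] at hd
  rw [abs_le]
  constructor <;> nlinarith

end Dominant

section HighestWeight

variable {n : ℕ} {V : Type*} [AddCommGroup V] [Module ℂ V]
  {σ : Representation ℂ (Spin n) V}

theorem IsHighestWeight.integral {k : Fin n → ℤ} (hk : IsHighestWeight σ (fun j => (k j : ℝ)))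
    {μ : Fin n → ℝ} (hμ : IsWeight σ μ) :
    ∃ ν : Fin n → ℤ, (μ = fun j => (ν j : ℝ)) ∧ k - ν ∈ dualCone n := by
  obtain ⟨c, hc⟩ := hk.2 μ hμ
  refine ⟨k - ∑ α ∈ posRoots n, c α • α, funext fun j => ?_, ?_⟩
  · have := hc j
    have h : ∀ α : Fin n → ℤ, (c α • α) j = c α * α j := fun α => by simp
    simp only [Pi.sub_apply, Finset.sum_apply, h, Int.cast_sub, Int.cast_sum, Int.cast_mul,
      Int.cast_natCast]
    linarith
  · rw [sub_sub_cancel]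
    exact sum_mem fun α hα => nsmul_mem (posRoots_subset hα) _

theorem IsHighestWeight.isDominant {k : Fin n → ℤ}
    (hk : IsHighestWeight σ (fun j => (k j : ℝ))) : IsDominant k := by
  have key : ∀ ν : Fin n → ℤ, IsWeight σ (fun j => (ν j : ℝ)) →
      ∑ l, ν l * chamberPoint n l ≤ ∑ l, k l * chamberPoint n l := by
    intro ν hν
    obtain ⟨ν', h1, h2⟩ := hk.integral hν
    have : ν = ν' := funext fun l => by exact_mod_cast congrFun h1 l
    have h3 := h2 _ (chamberPoint_strictDominant n).isDominant
    simp only [Pi.sub_apply, sub_mul, Finset.sum_sub_distrib] at h3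
    rw [this]
    linarith
  refine isDominant_of_pairing_le (fun i j hij => key _ (hk.1.swap hij.ne)) fun i j hij => key _ ?_
  convert (hk.1.swap hij.ne).flip hij.ne using 1
  funext l
  simp only [flipOn, Function.comp]
  split_ifs <;> simp

variable [FiniteDimensional ℂ V]

/-- A basis of weight vectors of a representation with integral highest weight `k`. -/
structure WeightBasis (hσ : IsContinuousRep σ) (k : Fin n → ℤ) where
  /-- the basis -/
  b : Module.Basis (Fin (Module.finrank ℂ V)) ℂ V
  /-- the weights of its elements -/
  wt : Fin (Module.finrank ℂ V) → Fin n → ℤ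
  cartan_apply : ∀ i j, cartan hσ j (b i) = (wt i j : ℂ) • b i
  sub_mem : ∀ i, k - wt i ∈ dualCone n
  exists_eq : ∃ i, wt i = k

theorem nonempty_weightBasis (hσ : IsContinuousRep σ) {k : Fin n → ℤ}
    (hk : IsHighestWeight σ (fun j => (k j : ℝ))) : Nonempty (WeightBasis hσ k) := by
  obtain ⟨b, wt, hb⟩ := exists_weightBasis hσ
  have h1 : ∀ i, ∃ ν : Fin n → ℤ, (wt i = fun j => (ν j : ℝ)) ∧ k - ν ∈ dualCone n := fun i =>
    hk.integral ((weight_mem_of_basis hσ b wt hb (wt i)).2 ⟨i, rfl⟩)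
  choose ν hν hc using h1
  obtain ⟨i, hi⟩ := (weight_mem_of_basis hσ b wt hb _).1 hk.1
  refine ⟨⟨b, ν, fun i j => ?_, hc, i, funext fun j => ?_⟩⟩
  · rw [hb, hν]; simp
  · rw [hν] at hi
    exact_mod_cast congrFun hi j

variable {hσ : IsContinuousRep σ} {k : Fin n → ℤ}

theorem WeightBasis.repr_cartan (B : WeightBasis hσ k) (j : Fin n) (w : V)
    (i : Fin (Module.finrank ℂ V)) : B.b.repr (cartan hσ j w) i =
        (B.wt i j : ℂ) * B.b.repr w i := by
  conv_lhs => rw [← B.b.sum_repr w]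
  simp only [map_sum, map_smul, B.cartan_apply, Finsupp.coe_finsetSum, Finset.sum_apply,
    Finsupp.smul_apply, Module.Basis.repr_self, smul_eq_mul]
  rw [Finset.sum_eq_single i]
  · simp; ring
  · intro l _ hl; simp [hl]
  · simp

theorem WeightBasis.wt_eq_of_repr_ne_zero (B : WeightBasis hσ k) (c d : Fin n × Bool)
    {i l : Fin (Module.finrank ℂ V)} (h : B.b.repr (rootOp hσ c d (B.b l)) i ≠ 0) :
    B.wt i = idxWeight c + idxWeight d + B.wt l := by
  funext j
  have h1 := congrArg (fun T => B.b.repr (T (B.b l)) i) (cartan_rootOp hσ j c d)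
  simp only [Module.End.mul_apply, LinearMap.add_apply, LinearMap.smul_apply, map_add, map_smul,
    B.cartan_apply, B.repr_cartan, Finsupp.add_apply, Finsupp.smul_apply, smul_eq_mul] at h1
  rw [← add_mul] at h1
  have h2 := mul_right_cancel₀ h h1
  have h3 : B.wt i j = B.wt l j + (idxWeight c + idxWeight d) j := by exact_mod_cast h2
  rw [h3]; exact add_comm _ _

theorem eq_negIdx_of_idxWeight_add {c d : Fin n × Bool} (h : idxWeight c + idxWeight d = 0) :
    d = negIdx c := by
  obtain ⟨i, s⟩ := c
  obtain ⟨j, t⟩ := d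
  have h1 := congrFun h i
  by_cases hij : i = j
  · subst hij
    simp only [idxWeight, Pi.add_apply, Pi.single_eq_same] at h1
    cases s <;> cases t <;> simp [sgnIdx, negIdx] at h1 ⊢
  · simp [idxWeight, hij] at h1
    cases s <;> simp [sgnIdx] at h1

theorem mem_of_rootOp_mem [NeZero n] (hσ : IsContinuousRep σ) (hirr : σ.IsIrreducible)
    (W : Submodule ℂ V) (hW : ∀ c d, ∀ w ∈ W, rootOp hσ c d w ∈ W) (h0 : W ≠ ⊥) : W = ⊤ := by
  have hst := mem_of_rotGen_mem hσ W (gen_mem_of_rootVec_mem _ _ hW)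
  rcases eq_bot_or_eq_top (⟨W, fun g w hw => hst g w hw⟩ : Subrepresentation σ) with h | h
  · exact absurd (congrArg Subrepresentation.toSubmodule h) h0
  · exact congrArg Subrepresentation.toSubmodule h

/-- The highest weight has multiplicity one.  Lowering operators generate from a highest weight
vector a subspace that is stable under all root vectors, hence everything, while they never reach a
further basis vector of highest weight. -/
theorem WeightBasis.wt_injOn [NeZero n] (B : WeightBasis hσ k) (hirr : σ.IsIrreducible)
    {i₀ i₁ : Fin (Module.finrank ℂ V)} (h₀ : B.wt i₀ = k) (h₁ : B.wt i₁ = k) : i₁ = i₀ := by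
  by_contra hne
  -- The root of `E_{cd}` is negative on the chamber.
  let low : Fin n × Bool → Fin n × Bool → Prop := fun c d =>
    ∑ i, (idxWeight c + idxWeight d) i * chamberPoint n i < 0
  let S : Set (Submodule ℂ V) := {W | B.b i₀ ∈ W ∧ ∀ c d, low c d → ∀ w ∈ W, rootOp hσ c d w ∈ W}
  let W := sInf S
  have hv : B.b i₀ ∈ W := Submodule.mem_sInf.2 fun U hU => hU.1
  have hlow : ∀ c d, low c d → ∀ w ∈ W, rootOp hσ c d w ∈ W := fun c d h w hw =>
    Submodule.mem_sInf.2 fun U hU => hU.2 c d h w (Submodule.mem_sInf.1 hw U hU)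
  -- The largest part of `W` that root vectors map to `W` is again in `S`, hence equal to `W`.
  let W' : Submodule ℂ V := W ⊓ ⨅ c, ⨅ d, W.comap (rootOp hσ c d)
  have hmem : ∀ w, w ∈ W' ↔ w ∈ W ∧ ∀ c d, rootOp hσ c d w ∈ W := by
    intro w
    simp [W', Submodule.mem_iInf]
  have hW'S : W' ∈ S := by
    refine ⟨(hmem _).2 ⟨hv, fun c d => ?_⟩, fun c d hcd w hw => ?_⟩
    · by_cases hl : low c d
      · exact hlow c d hl _ hv
      by_cases hz : rootOp hσ c d (B.b i₀) = 0
      · rw [hz]; exact W.zero_mem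
      obtain ⟨i, hi⟩ : ∃ i, B.b.repr (rootOp hσ c d (B.b i₀)) i ≠ 0 := by
        by_contra h
        push Not at h
        exact hz (B.b.repr.map_eq_zero_iff.1 (Finsupp.ext h))
      have h2 := B.wt_eq_of_repr_ne_zero c d hi
      have h3 := B.sub_mem i
      rw [h2, h₀, sub_add_cancel_right] at h3
      have h4 : -(idxWeight c + idxWeight d) = 0 := by
        refine eq_zero_of_pairing_le (chamberPoint_strictDominant n) h3 ?_
        simp only [low, not_lt] at hl
        simp only [Pi.neg_apply, neg_mul, Finset.sum_neg_distrib]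
        linarith
      rw [eq_negIdx_of_idxWeight_add (neg_eq_zero.1 h4), rootOp_neg, LinearMap.smul_apply,
        B.cartan_apply]
      exact W.smul_mem _ (W.smul_mem _ hv)
    · rw [hmem] at hw ⊢
      refine ⟨hlow c d hcd w hw.1, fun a b => ?_⟩
      have h1 := congrArg (fun T => T w) (rootOp_lie hσ a b c d)
      simp only [Module.End.mul_apply, LinearMap.sub_apply] at h1
      rw [sub_eq_iff_eq_add] at h1
      rw [h1]
      refine W.add_mem ?_ (hlow c d hcd _ (hw.2 a b))
      have hite : ∀ (p : Prop) [Decidable p] (x y : Fin n × Bool),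
          (if p then rootOp hσ x y else 0) w ∈ W := by
        intro p _ x y
        split_ifs
        · exact hw.2 x y
        · exact W.zero_mem
      simp only [LinearMap.add_apply, LinearMap.sub_apply]
      exact W.add_mem (W.sub_mem (W.sub_mem (hite _ _ _) (hite _ _ _)) (hite _ _ _)) (hite _ _ _)
  have hstab : ∀ c d, ∀ w ∈ W, rootOp hσ c d w ∈ W := fun c d w hw =>
    ((hmem w).1 (sInf_le hW'S hw)).2 c d
  have htop := mem_of_rootOp_mem hσ hirr W hstab (fun h => B.b.ne_zero i₀ (by
    rw [h] at hv; exact (Submodule.mem_bot ℂ).1 hv))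
  -- No lowering operator reaches the weight `k`.
  have hker : LinearMap.ker (B.b.coord i₁) ∈ S := by
    refine ⟨by simp [Ne.symm hne], fun c d hcd w _ => ?_⟩
    rw [LinearMap.mem_ker, Module.Basis.coord_apply]
    have h0 : ∀ l, B.b.repr (rootOp hσ c d (B.b l)) i₁ = 0 := by
      intro l
      by_contra h
      have h2 := B.wt_eq_of_repr_ne_zero c d h
      have h3 := B.sub_mem l _ (chamberPoint_strictDominant n).isDominant
      have h4 : k - B.wt l = idxWeight c + idxWeight d := by
        rw [sub_eq_iff_eq_add, ← h2, h₁]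
      rw [h4] at h3
      exact absurd h3 (not_le.2 hcd)
    rw [← B.b.sum_repr w]
    simp only [map_sum, map_smul, Finsupp.coe_finsetSum, Finset.sum_apply, Finsupp.smul_apply, h0,
      smul_zero, Finset.sum_const_zero]
  have h1 : B.b i₁ ∈ LinearMap.ker (B.b.coord i₁) := sInf_le hker (by
    change B.b i₁ ∈ W; rw [htop]; trivial)
  simp at h1

end HighestWeight

/-! ### The group algebra of the weight lattice -/

section FormalCharacters

variable {n : ℕ}

/-- The group algebra of the lattice of integral weights; the monomial `single ν 1` is the formal
exponential `e^ν`. -/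
abbrev WeightAlg (n : ℕ) : Type := AddMonoidAlgebra ℂ (Fin n → ℤ)

/-- The formal exponential `e^ν`. -/
def fexp (ν : Fin n → ℤ) : WeightAlg n := AddMonoidAlgebra.single ν 1

theorem fexp_add (μ ν : Fin n → ℤ) : fexp (μ + ν) = fexp μ * fexp ν := by
  simp [fexp]

theorem fexp_zero : fexp (0 : Fin n → ℤ) = 1 := rfl

theorem fexp_mul_fexp_neg (ν : Fin n → ℤ) : fexp ν * fexp (-ν) = 1 := by
  rw [← fexp_add, add_neg_cancel, fexp_zero]

theorem coeff_fexp (μ ν : Fin n → ℤ) : (fexp μ).coeff ν = if μ = ν then 1 else 0 := by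
  rw [fexp, AddMonoidAlgebra.coeff_single, Finsupp.single_apply]

theorem single_eq_smul_fexp (ν : Fin n → ℤ) (r : ℂ) :
    (AddMonoidAlgebra.single ν r : WeightAlg n) = r • fexp ν := by
  simp [fexp, AddMonoidAlgebra.smul_single]

/-- Elements whose support lies in a given set of weights. -/
def SuppIn (f : WeightAlg n) (s : Set (Fin n → ℤ)) : Prop := ∀ ν, f.coeff ν ≠ 0 → ν ∈ s

theorem SuppIn.mono {f : WeightAlg n} {s t : Set (Fin n → ℤ)} (h : SuppIn f s) (hst : s ⊆ t) :
    SuppIn f t := fun ν hν => hst (h ν hν)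

theorem suppIn_fexp {ν : Fin n → ℤ} {s : Set (Fin n → ℤ)} (h : ν ∈ s) : SuppIn (fexp ν) s := by
  intro μ hμ
  rw [coeff_fexp] at hμ
  by_cases e : ν = μ
  · rwa [← e]
  · simp [e] at hμ

theorem SuppIn.add {f g : WeightAlg n} {s : Set (Fin n → ℤ)} (hf : SuppIn f s) (hg : SuppIn g s) :
    SuppIn (f + g) s := by
  intro ν hν
  by_cases h : f.coeff ν = 0
  · refine hg ν fun h' => hν ?_
    rw [AddMonoidAlgebra.coeff_add, Finsupp.add_apply, h, h', add_zero]
  · exact hf ν h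

theorem SuppIn.smul {f : WeightAlg n} {s : Set (Fin n → ℤ)} (hf : SuppIn f s) (c : ℂ) :
    SuppIn (c • f) s := by
  intro ν hν
  refine hf ν fun h => hν ?_
  rw [AddMonoidAlgebra.coeff_smul_apply, h, smul_zero]

theorem SuppIn.sub {f g : WeightAlg n} {s : Set (Fin n → ℤ)} (hf : SuppIn f s) (hg : SuppIn g s) :
    SuppIn (f - g) s := by
  have : f - g = f + (-1 : ℂ) • g := by rw [neg_one_smul, sub_eq_add_neg]
  rw [this]
  exact hf.add (hg.smul _)

theorem SuppIn.sum {ι : Type*} {t : Finset ι} {f : ι → WeightAlg n} {s : Set (Fin n → ℤ)}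
    (h : ∀ i ∈ t, SuppIn (f i) s) : SuppIn (∑ i ∈ t, f i) s := by
  intro ν hν
  rw [AddMonoidAlgebra.coeff_sum, Finsupp.finsetSum_apply] at hν
  obtain ⟨i, hi, h1⟩ := Finset.exists_ne_zero_of_sum_ne_zero hν
  exact h i hi ν h1

theorem exists_of_coeff_mul_ne_zero {f g : WeightAlg n} {ν : Fin n → ℤ}
    (h : (f * g).coeff ν ≠ 0) :
    ∃ μ μ', f.coeff μ ≠ 0 ∧ g.coeff μ' ≠ 0 ∧ μ + μ' = ν := by
  rw [AddMonoidAlgebra.coeff_mul] at h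
  obtain ⟨μ, hμ, h1⟩ := Finset.exists_ne_zero_of_sum_ne_zero h
  obtain ⟨μ', hμ', h2⟩ := Finset.exists_ne_zero_of_sum_ne_zero h1
  refine ⟨μ, μ', Finsupp.mem_support_iff.1 hμ, Finsupp.mem_support_iff.1 hμ', ?_⟩
  by_contra h3
  exact h2 (if_neg h3)

theorem SuppIn.mul {f g : WeightAlg n} {s t u : Set (Fin n → ℤ)} (hf : SuppIn f s)
    (hg : SuppIn g t) (h : ∀ μ ∈ s, ∀ ν ∈ t, μ + ν ∈ u) : SuppIn (f * g) u := by
  intro ν hν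
  obtain ⟨μ, μ', h1, h2, rfl⟩ := exists_of_coeff_mul_ne_zero hν
  exact h _ (hf _ h1) _ (hg _ h2)

/-- `f` has leading term `e^a`: the coefficient of `e^a` is `1`, and `a - ν` lies in the cone
`dualCone` for all weights `ν` of `f`. -/
def HasLeading (f : WeightAlg n) (a : Fin n → ℤ) : Prop :=
  f.coeff a = 1 ∧ SuppIn f {ν | a - ν ∈ dualCone n}

theorem HasLeading.mul {f g : WeightAlg n} {a b : Fin n → ℤ} (hf : HasLeading f a)
    (hg : HasLeading g b) : HasLeading (f * g) (a + b) := by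
  refine ⟨?_, hf.2.mul hg.2 fun μ hμ ν hν => ?_⟩
  · have key : ∀ μ μ', f.coeff μ ≠ 0 → g.coeff μ' ≠ 0 → μ + μ' = a + b → μ = a ∧ μ' = b := by
      intro μ μ' h1 h2 h3
      have h4 : a - μ ∈ dualCone n := hf.2 μ h1
      have h5 : b - μ' ∈ dualCone n := hg.2 μ' h2
      have e1 : b - μ' = μ - a := by
        rw [sub_eq_sub_iff_add_eq_add, add_comm b a, ← h3]
      rw [e1] at h5
      have e2 := eq_of_sub_mem h4 h5
      refine ⟨e2.symm, ?_⟩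
      rw [← e2] at h3
      exact add_left_cancel h3
    have ha : f.coeff a ≠ 0 := by rw [hf.1]; exact one_ne_zero
    have hb : g.coeff b ≠ 0 := by rw [hg.1]; exact one_ne_zero
    rw [AddMonoidAlgebra.coeff_mul, Finsupp.sum, Finset.sum_eq_single a, Finsupp.sum,
      Finset.sum_eq_single b]
    · rw [if_pos rfl, hf.1, hg.1, one_mul]
    · intro μ' h1 h2
      rw [if_neg]
      intro h3
      exact h2 (key a μ' ha (Finsupp.mem_support_iff.1 h1) h3).2
    · intro h; exact absurd (Finsupp.mem_support_iff.2 hb) h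
    · intro μ h1 h2
      refine Finset.sum_eq_zero fun μ' h3 => if_neg fun h4 => h2 ?_
      exact (key μ μ' (Finsupp.mem_support_iff.1 h1) (Finsupp.mem_support_iff.1 h3) h4).1
    · intro h; exact absurd (Finsupp.mem_support_iff.2 ha) h
  · have := add_mem (show a - μ ∈ dualCone n from hμ) (show b - ν ∈ dualCone n from hν)
    rw [Set.mem_ofPred_eq]
    convert this using 1
    abel

theorem hasLeading_one : HasLeading (1 : WeightAlg n) 0 := by
  rw [← fexp_zero]
  exact ⟨by rw [coeff_fexp, if_pos rfl], suppIn_fexp (by simp)⟩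

theorem HasLeading.prod {ι : Type*} {t : Finset ι} {f : ι → WeightAlg n} {a : ι → Fin n → ℤ}
    (h : ∀ i ∈ t, HasLeading (f i) (a i)) : HasLeading (∏ i ∈ t, f i) (∑ i ∈ t, a i) := by
  classical
  induction t using Finset.induction_on with
  | empty => simpa using hasLeading_one
  | insert i t hi ih =>
    rw [Finset.prod_insert hi, Finset.sum_insert hi]
    exact (h i (Finset.mem_insert_self _ _)).mul
      (ih fun j hj => h j (Finset.mem_insert_of_mem hj))

/-- The derivation `∂_m`, with `∂_m e^ν = ν_m e^ν`. -/
def derivLin (m : Fin n) : WeightAlg n →ₗ[ℂ] WeightAlg n where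
  toFun f := .ofCoeff (Finsupp.onFinset f.coeff.support (fun ν => (ν m : ℂ) * f.coeff ν)
    fun ν h => Finsupp.mem_support_iff.2 fun h' => h (by rw [h', mul_zero]))
  map_add' f g := by
    ext ν
    simp [mul_add]
  map_smul' c f := by
    ext ν
    simp [mul_left_comm]

theorem coeff_derivLin (m : Fin n) (f : WeightAlg n) (ν : Fin n → ℤ) :
    (derivLin m f).coeff ν = (ν m : ℂ) * f.coeff ν := rfl

theorem derivLin_fexp (m : Fin n) (ν : Fin n → ℤ) : derivLin m (fexp ν) = (ν m : ℂ) • fexp ν := by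
  ext μ
  rw [coeff_derivLin, AddMonoidAlgebra.coeff_smul_apply, coeff_fexp]
  by_cases h : ν = μ
  · simp [h]
  · simp [h]

theorem weightAlg_induction {p : WeightAlg n → Prop} (h0 : p 0)
    (hadd : ∀ f g, p f → p g → p (f + g))
    (hs : ∀ ν (c : ℂ), p (c • fexp ν)) (f : WeightAlg n) : p f :=
  AddMonoidAlgebra.induction_linear f h0 hadd fun ν c => by
    rw [single_eq_smul_fexp]; exact hs ν c

/-- The derivation `∂_m`, with `∂_m e^ν = ν_m e^ν`. -/
def dv (m : Fin n) : Derivation ℂ (WeightAlg n) (WeightAlg n) :=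
  Derivation.mk' (derivLin m) fun f g => by
    induction f using weightAlg_induction with
    | h0 => simp
    | hadd f f' h1 h2 => rw [add_mul, map_add, map_add, h1, h2]; simp only [smul_eq_mul]; ring
    | hs μ c =>
      induction g using weightAlg_induction with
      | h0 => simp
      | hadd g g' h1 h2 => rw [mul_add, map_add, map_add, h1, h2]; simp only [smul_eq_mul]; ring
      | hs ν d =>
        simp only [← fexp_add, map_smul, derivLin_fexp, smul_eq_mul,
          Algebra.smul_mul_assoc, Algebra.mul_smul_comm, smul_smul, Pi.add_apply, Int.cast_add]
        rw [add_comm ν μ, ← add_smul]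
        congr 1
        ring

theorem coeff_dv (m : Fin n) (f : WeightAlg n) (ν : Fin n → ℤ) :
    (dv m f).coeff ν = (ν m : ℂ) * f.coeff ν := rfl

theorem dv_fexp (m : Fin n) (ν : Fin n → ℤ) : dv m (fexp ν) = (ν m : ℂ) • fexp ν :=
  derivLin_fexp m ν

/-- The Laplace operator acts on a coefficient by the square of the norm of the weight. -/
theorem coeff_sum_dv_dv (f : WeightAlg n) (ν : Fin n → ℤ) :
    (∑ m, dv m (dv m f)).coeff ν = ((∑ m, ν m ^ 2 : ℤ) : ℂ) * f.coeff ν := by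
  rw [AddMonoidAlgebra.coeff_sum, Finsupp.finsetSum_apply]
  simp only [coeff_dv]
  push_cast
  rw [Finset.sum_mul]
  exact Finset.sum_congr rfl fun m _ => by ring

/-- The substitution of an additive endomorphism of the weight lattice. -/
def subst (φ : (Fin n → ℤ) →+ (Fin n → ℤ)) : WeightAlg n →+* WeightAlg n :=
  AddMonoidAlgebra.mapDomainRingHom ℂ φ

theorem subst_fexp (φ : (Fin n → ℤ) →+ (Fin n → ℤ)) (ν : Fin n → ℤ) :
    subst φ (fexp ν) = fexp (φ ν) := AddMonoidAlgebra.mapDomain_single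

theorem coeff_subst {φ : (Fin n → ℤ) →+ (Fin n → ℤ)} (hφ : Function.Injective φ) (f : WeightAlg n)
    (ν : Fin n → ℤ) : (subst φ f).coeff (φ ν) = f.coeff ν :=
  Finsupp.mapDomain_apply hφ f.coeff ν

/-- Permutation of coordinates. -/
def swapHom (i j : Fin n) : (Fin n → ℤ) →+ (Fin n → ℤ) where
  toFun ν := ν ∘ Equiv.swap i j
  map_zero' := rfl
  map_add' _ _ := rfl

theorem swapHom_apply (i j : Fin n) (ν : Fin n → ℤ) : swapHom i j ν = ν ∘ Equiv.swap i j := rfl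

theorem swapHom_injective (i j : Fin n) : Function.Injective (swapHom i j) :=
  (Equiv.swap i j).surjective.injective_comp_right

/-- Sign change of two coordinates. -/
def flipHom (i j : Fin n) : (Fin n → ℤ) →+ (Fin n → ℤ) where
  toFun ν := flipOn {i} (flipOn {j} ν)
  map_zero' := by funext l; simp [flipOn]
  map_add' μ ν := by
    funext l
    simp only [flipOn, Pi.add_apply]
    split_ifs <;> ring

theorem flipHom_apply (i j : Fin n) (ν : Fin n → ℤ) :
    flipHom i j ν = flipOn {i} (flipOn {j} ν) := rfl

theorem flipHom_injective (i j : Fin n) : Function.Injective (flipHom i j) := by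
  intro μ ν h
  rw [flipHom_apply, flipHom_apply] at h
  rw [← flipOn_flipOn_singleton_self j μ, ← flipOn_flipOn_singleton_self i (flipOn {j} μ), h,
    flipOn_flipOn_singleton_self, flipOn_flipOn_singleton_self]

end FormalCharacters

section WeylDenominator

variable {n : ℕ}

/-- `e^{e_i} + e^{-e_i}`. -/
def coordSum (i : Fin n) : WeightAlg n := fexp (idxWeight (i, true)) + fexp (idxWeight (i, false))

theorem idxWeight_false (i : Fin n) : idxWeight (i, false) = -idxWeight (i, true) := by
  simp [idxWeight, sgnIdx, Pi.single_neg]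

theorem idxWeight_true (i : Fin n) : idxWeight (i, true) = Pi.single i 1 := by
  simp [idxWeight, sgnIdx]

/-- The Weyl denominator of `D_n`.  The factor `e^{e_i} + e^{-e_i} - e^{e_j} - e^{-e_j}` belongs to
the two positive roots `e_i ± e_j`. -/
def weylDenom (n : ℕ) : WeightAlg n := ∏ p ∈ ltPairs n, (coordSum p.1 - coordSum p.2)

theorem hasLeading_coordSum_sub {i j : Fin n} (h : i < j) :
    HasLeading (coordSum i - coordSum j) (Pi.single i 1) := by
  have z : ∀ s : Bool, ¬idxWeight (j, s) = Pi.single i 1 := by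
    intro s e
    have := congrFun e i
    simp [idxWeight, h.ne] at this
  have z' : ¬idxWeight (i, false) = Pi.single i 1 := by
    intro e
    have := congrFun e i
    simp [idxWeight, sgnIdx] at this
  constructor
  · rw [AddMonoidAlgebra.coeff_sub, Finsupp.sub_apply, coordSum, coordSum,
      AddMonoidAlgebra.coeff_add, AddMonoidAlgebra.coeff_add, Finsupp.add_apply, Finsupp.add_apply]
    simp only [coeff_fexp, idxWeight_true i, if_neg (z _), if_neg z', if_true]
    simp
  · have m1 := single_add_single_mem h
    have m2 := single_sub_single_mem h
    refine SuppIn.sub (SuppIn.add (suppIn_fexp ?_) (suppIn_fexp ?_))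
      (SuppIn.add (suppIn_fexp ?_) (suppIn_fexp ?_)) <;> rw [Set.mem_ofPred_eq]
    · rw [idxWeight_true, sub_self]; exact zero_mem _
    · rw [idxWeight_false, idxWeight_true, sub_neg_eq_add]
      convert add_mem m1 m2 using 1
      abel
    · rw [idxWeight_true]; exact m2
    · rw [idxWeight_false, idxWeight_true, sub_neg_eq_add]; exact m1

/-- The half sum `ρ` of the positive roots, as an integral weight. -/
def rhoZ (n : ℕ) (i : Fin n) : ℤ := rho n i

theorem rhoZ_strictDominant (n : ℕ) : IsStrictDominant (rhoZ n) := by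
  intro i j hij
  have h1 : (i : ℕ) < j := hij
  have h2 := j.2
  simp only [rhoZ, rho]
  rw [abs_of_nonneg (by positivity)]
  omega

theorem sum_ltPairs_single (n : ℕ) :
    ∑ p ∈ ltPairs n, (Pi.single p.1 1 : Fin n → ℤ) = rhoZ n := by
  funext l
  rw [Finset.sum_apply, ltPairs, Finset.sum_filter, Fintype.sum_prod_type]
  rw [Finset.sum_eq_single l]
  · simp only [Pi.single_eq_same]
    rw [← Finset.sum_filter, Finset.sum_const, Finset.filter_lt_eq_Ioi, Fin.card_Ioi]
    simp only [rhoZ, rho, nsmul_eq_mul, mul_one]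
  · intro i _ hi
    refine Finset.sum_eq_zero fun j _ => ?_
    simp [Ne.symm hi]
  · simp

theorem hasLeading_weylDenom (n : ℕ) : HasLeading (weylDenom n) (rhoZ n) := by
  rw [← sum_ltPairs_single]
  exact HasLeading.prod fun p hp => hasLeading_coordSum_sub (mem_ltPairs.1 hp)

/-- A monic polynomial of degree `m` with value `x ^ m + x⁻ᵐ` at `x + x⁻¹` (for `m = 0`,
the constant `1`). -/
theorem exists_monic_eval_add_inv (R : Type*) [CommRing R] [Nontrivial R] (m : ℕ) :
    ∃ p : Polynomial R, p.Monic ∧ p.natDegree = m ∧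
      ∀ x y : R, x * y = 1 → p.eval (x + y) = if m = 0 then 1 else x ^ m + y ^ m := by
  rcases Nat.eq_zero_or_pos m with rfl | hm
  · exact ⟨1, Polynomial.monic_one, Polynomial.natDegree_one, fun x y _ => by simp⟩
  · have key : ∀ l : ℕ, (Polynomial.dickson 1 (1 : R) (l + 1)).Monic ∧
        (Polynomial.dickson 1 (1 : R) (l + 1)).natDegree = l + 1 := by
      intro l
      induction l using Nat.strong_induction_on with
      | _ l ih =>
        rcases l with _ | _ | l
        · simp [Polynomial.dickson_one, Polynomial.monic_X]
        · have e : Polynomial.dickson 1 (1 : R) (0 + 1 + 1) =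
              Polynomial.X ^ 2 - Polynomial.C (2 : R) := by
            rw [Polynomial.dickson_add_two]
            simp [Polynomial.dickson_one, Polynomial.dickson_zero]
            rw [map_ofNat]
            ring
          rw [e]
          exact ⟨Polynomial.monic_X_pow_sub_C _ two_ne_zero, Polynomial.natDegree_X_pow_sub_C⟩
        · obtain ⟨h1, h2⟩ := ih (l + 1) (by omega)
          obtain ⟨h3, h4⟩ := ih l (by omega)
          have hm1 : (Polynomial.X * Polynomial.dickson 1 (1 : R) (l + 1 + 1)).Monic :=
            Polynomial.monic_X.mul h1
          have hd1 : (Polynomial.X * Polynomial.dickson 1 (1 : R) (l + 1 + 1)).natDegree =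
              l + 3 := by
            rw [Polynomial.monic_X.natDegree_mul h1, Polynomial.natDegree_X, h2]; ring
          have hlt : (Polynomial.dickson 1 (1 : R) (l + 1)).degree <
              (Polynomial.X * Polynomial.dickson 1 (1 : R) (l + 1 + 1)).degree := by
            rw [Polynomial.degree_eq_natDegree h3.ne_zero,
                Polynomial.degree_eq_natDegree hm1.ne_zero,
              hd1, h4]
            exact_mod_cast (by omega : l + 1 < l + 3)
          have e : Polynomial.dickson 1 (1 : R) (l + 1 + 1 + 1) =
              Polynomial.X * Polynomial.dickson 1 (1 : R) (l + 1 + 1) -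
                Polynomial.dickson 1 (1 : R) (l + 1) := by
            rw [Polynomial.dickson_add_two]; simp
          rw [e]
          refine ⟨hm1.sub_of_left hlt, ?_⟩
          rw [Polynomial.natDegree_sub_eq_left_of_natDegree_lt (by rw [hd1, h4]; omega), hd1]
    obtain ⟨l, rfl⟩ := Nat.exists_eq_succ_of_ne_zero hm.ne'
    refine ⟨_, (key l).1, (key l).2, fun x y h => ?_⟩
    rw [if_neg (Nat.succ_ne_zero l)]
    exact Polynomial.dickson_one_one_eval_add_inv x y h (l + 1)

/-- The entries of the alternant of type `D_n`: `x ^ m + x⁻ᵐ`, or `1` if `m = 0`. -/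
def symPow {R : Type*} [CommRing R] (x y : R) (m : ℕ) : R := if m = 0 then 1 else x ^ m + y ^ m

/-- The Vandermonde determinant, with monic polynomials of degrees `n - 1, …, 0` in place of
powers. -/
theorem prod_ltPairs_sub_eq_det_eval {R : Type*} [CommRing R] (v : Fin n → R)
    (q : ℕ → Polynomial R) (hq1 : ∀ m, (q m).Monic) (hq2 : ∀ m, (q m).natDegree = m) :
    ∏ p ∈ ltPairs n, (v p.1 - v p.2) =
      (Matrix.of fun i j : Fin n => (q (rho n j)).eval (v i)).det := by
  have h1 := Matrix.det_eval_matrixOfPolynomials_eq_det_vandermonde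
    (fun i : Fin n => v i.rev) (fun j : Fin n => q j) (fun j => hq2 j) (fun j => hq1 j)
  have h2 : (Matrix.of fun i j : Fin n => (q (rho n j)).eval (v i)).det =
      (Matrix.of fun i j : Fin n => (q j).eval (v i.rev)).det := by
    rw [← Matrix.det_submatrix_equiv_self Fin.revPerm]
    congr 1
    ext i j
    simp only [Matrix.submatrix_apply, Matrix.of_apply, Fin.revPerm_apply]
    have : rho n j.rev = j := by
      have := j.2
      simp only [rho, Fin.val_rev]; omega
    rw [this]
  rw [h2, ← h1, Matrix.det_vandermonde]
  have h3 : ∏ i : Fin n, ∏ j ∈ Finset.Ioi i, (v j.rev - v i.rev) =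
      ∏ p ∈ ltPairs n, (v p.2.rev - v p.1.rev) := by
    rw [ltPairs, Finset.prod_filter, Fintype.prod_prod_type]
    refine Finset.prod_congr rfl fun i _ => ?_
    rw [← Finset.filter_lt_eq_Ioi, Finset.prod_filter]
  rw [h3]
  refine Finset.prod_bij' (fun p _ => (p.2.rev, p.1.rev)) (fun p _ => (p.2.rev, p.1.rev))
    ?_ ?_ ?_ ?_ ?_
  · intro p hp; rw [mem_ltPairs] at hp ⊢; simpa using hp
  · intro p hp; rw [mem_ltPairs] at hp ⊢; simpa using hp
  · intro p _; simp
  · intro p _; simp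
  · intro p _; simp

/-- The Weyl denominator formula for `D_n`, as a Vandermonde determinant. -/
theorem prod_ltPairs_sub_eq_det {R : Type*} [CommRing R] [Nontrivial R] (x y : Fin n → R)
    (h : ∀ i, x i * y i = 1) :
    ∏ p ∈ ltPairs n, ((x p.1 + y p.1) - (x p.2 + y p.2)) =
      (Matrix.of fun i j => symPow (x i) (y i) (rho n j)).det := by
  choose q hq1 hq2 hq3 using exists_monic_eval_add_inv R
  rw [prod_ltPairs_sub_eq_det_eval (fun i => x i + y i) q hq1 hq2]
  congr 1
  ext i j
  rw [Matrix.of_apply, Matrix.of_apply, hq3 _ _ _ (h i), symPow]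

theorem weylDenom_eq_det (n : ℕ) : weylDenom n = (Matrix.of fun i j : Fin n =>
    symPow (fexp (idxWeight (i, true))) (fexp (idxWeight (i, false))) (rho n j)).det := by
  rw [← prod_ltPairs_sub_eq_det (fun i : Fin n => fexp (idxWeight (i, true)))
    (fun i => fexp (idxWeight (i, false))) fun i => by rw [idxWeight_false, fexp_mul_fexp_neg]]
  rfl

theorem suppIn_symPow (i : Fin n) (m : ℕ) :
    SuppIn (symPow (fexp (idxWeight (i, true))) (fexp (idxWeight (i, false))) m)
      {ν | (∀ l, l ≠ i → ν l = 0) ∧ ν i ^ 2 = (m : ℤ) ^ 2} := by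
  have hp : ∀ (ν : Fin n → ℤ) (m : ℕ), fexp ν ^ m = fexp (m • ν) := by
    intro ν m
    induction m with
    | zero => simp [fexp_zero]
    | succ m ih => rw [pow_succ, ih, succ_nsmul, fexp_add]
  rw [symPow]
  split_ifs with h
  · rw [← fexp_zero]
    exact suppIn_fexp (by simp [h])
  · rw [hp, hp]
    refine SuppIn.add (suppIn_fexp ?_) (suppIn_fexp ?_)
    · refine ⟨fun l hl => ?_, ?_⟩
      · simp [idxWeight, hl]
      · simp [idxWeight, sgnIdx]
    · refine ⟨fun l hl => ?_, ?_⟩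
      · simp [idxWeight, hl]
      · simp [idxWeight, sgnIdx]

theorem suppIn_prod_symPow (π : Equiv.Perm (Fin n)) (t : Finset (Fin n)) :
    SuppIn (∏ j ∈ t, symPow (fexp (idxWeight (π j, true)))
      (fexp (idxWeight (π j, false))) (rho n j))
      {ν | (∀ l ∉ t, ν (π l) = 0) ∧ ∑ l ∈ t, ν (π l) ^ 2 = ∑ l ∈ t, rhoZ n l ^ 2} := by
  induction t using Finset.induction_on with
  | empty =>
    rw [Finset.prod_empty, ← fexp_zero]
    exact suppIn_fexp (by simp)
  | insert j t hj ih =>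
    rw [Finset.prod_insert hj]
    refine (suppIn_symPow (π j) (rho n j)).mul ih ?_
    rintro μ ⟨h1, h2⟩ ν ⟨h3, h4⟩
    constructor
    · intro l hl
      rw [Finset.mem_insert, not_or] at hl
      rw [Pi.add_apply, h3 l hl.2, h1 _ (fun h => hl.1 (π.injective h)), add_zero]
    · rw [Finset.sum_insert hj, Finset.sum_insert hj, Pi.add_apply, h3 j hj, add_zero, h2]
      congr 1
      rw [← h4]
      refine Finset.sum_congr rfl fun l hl => ?_
      rw [Pi.add_apply, h1 _ (fun h => hj (by rw [← π.injective h]; exact hl)), zero_add]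

/-- All weights of the Weyl denominator have the length of `ρ`. -/
theorem suppIn_weylDenom (n : ℕ) :
    SuppIn (weylDenom n) {ν | ∑ l, ν l ^ 2 = ∑ l, rhoZ n l ^ 2} := by
  rw [weylDenom_eq_det, Matrix.det_apply]
  refine SuppIn.sum fun π _ => ?_
  have h := suppIn_prod_symPow π Finset.univ
  have h2 := (h.mono (t := {ν | ∑ l, ν l ^ 2 = ∑ l, rhoZ n l ^ 2}) (by
    rintro ν ⟨_, h2⟩
    rw [Set.mem_ofPred_eq, ← h2, Equiv.sum_comp π (fun l => ν l ^ 2)])).smul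
      ((Equiv.Perm.sign π : ℤ) : ℂ)
  convert h2 using 1
  rw [Units.smul_def, ← Int.cast_smul_eq_zsmul ℂ]
  rfl

/-- The Weyl denominator is an eigenfunction of the Laplace operator. -/
theorem laplace_weylDenom (n : ℕ) :
    ∑ m, dv m (dv m (weylDenom n)) = ((∑ l, rhoZ n l ^ 2 : ℤ) : ℂ) • weylDenom n := by
  ext ν
  rw [coeff_sum_dv_dv, AddMonoidAlgebra.coeff_smul_apply, smul_eq_mul]
  by_cases h : (weylDenom n).coeff ν = 0
  · rw [h, mul_zero, mul_zero]
  · have := suppIn_weylDenom n ν h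
    rw [Set.mem_ofPred_eq] at this
    rw [this]

theorem subst_coordSum_swap (i j l : Fin n) :
    subst (swapHom i j) (coordSum l) = coordSum (Equiv.swap i j l) := by
  rw [coordSum, map_add, subst_fexp, subst_fexp]
  have : ∀ s : Bool, swapHom i j (idxWeight (l, s)) = idxWeight (Equiv.swap i j l, s) := by
    intro s
    funext r
    rw [swapHom_apply, Function.comp, idxWeight, idxWeight, Pi.single_apply, Pi.single_apply]
    have : Equiv.swap i j r = l ↔ r = Equiv.swap i j l := by
      rw [← Equiv.swap_apply_eq_iff]
    simp only [this]
    rfl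
  rw [this, this, coordSum]

theorem subst_coordSum_flip {i j : Fin n} (h : i ≠ j) (l : Fin n) :
    subst (flipHom i j) (coordSum l) = coordSum l := by
  rw [coordSum, map_add, subst_fexp, subst_fexp]
  by_cases hl : l = i ∨ l = j
  · have : ∀ s : Bool, flipHom i j (idxWeight (l, s)) = -idxWeight (l, s) := by
      intro s
      funext r
      simp only [flipHom_apply, flipOn, idxWeight, Finset.mem_singleton, Pi.neg_apply]
      by_cases hr : r = l
      · subst hr
        rcases hl with rfl | rfl <;> simp [h, h.symm]
      · simp [hr]
    rw [this, this, idxWeight_false, neg_neg, add_comm]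
  · rw [not_or] at hl
    have : ∀ s : Bool, flipHom i j (idxWeight (l, s)) = idxWeight (l, s) := by
      intro s
      funext r
      simp only [flipHom_apply, flipOn, idxWeight, Finset.mem_singleton]
      by_cases hr : r = l
      · subst hr; simp [hl.1, hl.2]
      · simp [hr]
    rw [this, this]

theorem subst_weylDenom_swap {i j : Fin n} (h : i ≠ j) :
    subst (swapHom i j) (weylDenom n) = -weylDenom n := by
  have h1 : subst (swapHom i j) (weylDenom n) =
      ∏ p ∈ ltPairs n, (coordSum (Equiv.swap i j p.1) - coordSum (Equiv.swap i j p.2)) := by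
    rw [weylDenom, map_prod]
    simp only [map_sub, subst_coordSum_swap]
  rw [h1]
  have h2 : ∏ p ∈ ltPairs n, (coordSum (Equiv.swap i j p.1) - coordSum (Equiv.swap i j p.2)) =
      ((Matrix.of fun i j : Fin n => symPow (fexp (idxWeight (i, true)))
        (fexp (idxWeight (i, false))) (rho n j)).submatrix (Equiv.swap i j) id).det :=
    prod_ltPairs_sub_eq_det (fun l => fexp (idxWeight (Equiv.swap i j l, true)))
      (fun l => fexp (idxWeight (Equiv.swap i j l, false))) fun i => by
        rw [idxWeight_false, fexp_mul_fexp_neg]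
  rw [h2, Matrix.det_permute, Equiv.Perm.sign_swap h, ← weylDenom_eq_det]
  simp

theorem subst_weylDenom_flip {i j : Fin n} (h : i ≠ j) :
    subst (flipHom i j) (weylDenom n) = weylDenom n := by
  rw [weylDenom, map_prod]
  simp only [map_sub, subst_coordSum_flip h]

end WeylDenominator

/-! ### The character and the Casimir operator -/

section Character

variable {n : ℕ} {V : Type*} [AddCommGroup V] [Module ℂ V] [FiniteDimensional ℂ V]
  {σ : Representation ℂ (Spin n) V} {hσ : IsContinuousRep σ} {k : Fin n → ℤ}

/-- The formal trace `∑ T_{ii} e^{wt i}` of an operator. -/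
def WeightBasis.ftr (B : WeightBasis hσ k) : Module.End ℂ V →ₗ[ℂ] WeightAlg n where
  toFun T := ∑ i, B.b.repr (T (B.b i)) i • fexp (B.wt i)
  map_add' S T := by
    simp only [LinearMap.add_apply, map_add, Finsupp.add_apply, add_smul, Finset.sum_add_distrib]
  map_smul' c T := by
    simp only [LinearMap.smul_apply, map_smul, Finsupp.smul_apply, smul_assoc, Finset.smul_sum,
      RingHom.id_apply]

theorem WeightBasis.ftr_apply (B : WeightBasis hσ k) (T : Module.End ℂ V) :
    B.ftr T = ∑ i, B.b.repr (T (B.b i)) i • fexp (B.wt i) := rfl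

/-- The formal character. -/
def WeightBasis.char (B : WeightBasis hσ k) : WeightAlg n := ∑ i, fexp (B.wt i)

theorem WeightBasis.ftr_one (B : WeightBasis hσ k) : B.ftr 1 = B.char := by
  simp [B.ftr_apply, WeightBasis.char]

theorem WeightBasis.repr_mul (B : WeightBasis hσ k) (S T : Module.End ℂ V)
    (i j : Fin (Module.finrank ℂ V)) : B.b.repr ((S * T) (B.b i)) j =
      ∑ l, B.b.repr (T (B.b i)) l * B.b.repr (S (B.b l)) j := by
  rw [Module.End.mul_apply]
  conv_lhs => rw [← B.b.sum_repr (T (B.b i))]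
  simp only [map_sum, map_smul, Finsupp.coe_finsetSum, Finset.sum_apply, Finsupp.smul_apply,
    smul_eq_mul]

/-- Cyclicity of the formal trace, for an operator `S` that maps the weight space of `ν` to that
of `φ ν`. -/
theorem WeightBasis.ftr_mul (B : WeightBasis hσ k) (S T : Module.End ℂ V)
    (φ : (Fin n → ℤ) → (Fin n → ℤ))
    (h : ∀ i l, B.b.repr (S (B.b l)) i ≠ 0 → B.wt i = φ (B.wt l)) :
    B.ftr (S * T) = ∑ l, B.b.repr ((T * S) (B.b l)) l • fexp (φ (B.wt l)) := by
  simp only [B.ftr_apply, B.repr_mul, Finset.sum_smul]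
  rw [Finset.sum_comm]
  refine Finset.sum_congr rfl fun l _ => Finset.sum_congr rfl fun i _ => ?_
  by_cases h0 : B.b.repr (S (B.b l)) i = 0
  · rw [h0, mul_zero, zero_mul, zero_smul, zero_smul]
  · rw [h i l h0, mul_comm]

theorem WeightBasis.ftr_rootOp_mul (B : WeightBasis hσ k) (c d : Fin n × Bool)
    (T : Module.End ℂ V) : B.ftr (rootOp hσ c d * T) =
      fexp (idxWeight c + idxWeight d) * B.ftr (T * rootOp hσ c d) := by
  rw [B.ftr_mul _ _ (fun ν => idxWeight c + idxWeight d + ν)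
    fun i l h => B.wt_eq_of_repr_ne_zero c d h, B.ftr_apply, Finset.mul_sum]
  refine Finset.sum_congr rfl fun l _ => ?_
  rw [fexp_add (idxWeight c + idxWeight d), mul_smul_comm]

theorem WeightBasis.ftr_cartan (B : WeightBasis hσ k) (j : Fin n) :
    B.ftr (cartan hσ j) = dv j B.char := by
  rw [B.ftr_apply, WeightBasis.char, map_sum]
  refine Finset.sum_congr rfl fun i _ => ?_
  rw [dv_fexp, B.cartan_apply]
  simp

theorem WeightBasis.ftr_cartan_mul (B : WeightBasis hσ k) (j : Fin n) :
    B.ftr (cartan hσ j * cartan hσ j) = dv j (dv j B.char) := by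
  rw [B.ftr_apply, WeightBasis.char, map_sum, map_sum]
  refine Finset.sum_congr rfl fun i _ => ?_
  rw [dv_fexp, Derivation.map_smul, dv_fexp, Module.End.mul_apply, B.cartan_apply, map_smul,
      B.cartan_apply]
  simp [smul_smul]

theorem WeightBasis.subst_char (B : WeightBasis hσ k) (φ : (Fin n → ℤ) →+ (Fin n → ℤ)) (g : Spin n)
    (h : ∀ i l, B.b.repr (σ g (B.b l)) i ≠ 0 → B.wt i = φ (B.wt l)) :
    subst φ B.char = B.char := by
  have h1 := B.ftr_mul (σ g) (σ g⁻¹) φ h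
  rw [← map_mul, ← map_mul, mul_inv_cancel, inv_mul_cancel, map_one, B.ftr_one] at h1
  conv_rhs => rw [h1]
  rw [WeightBasis.char, map_sum]
  refine Finset.sum_congr rfl fun l _ => ?_
  rw [subst_fexp]
  simp

theorem WeightBasis.isWeightVec (B : WeightBasis hσ k) (i : Fin (Module.finrank ℂ V)) :
    IsWeightVec σ (fun j => (B.wt i j : ℝ)) (B.b i) := fun j θ =>
  (torusElt_apply_iff_cartan hσ j _ _).2 (by simpa using B.cartan_apply i j) θ

theorem WeightBasis.wt_eq_of_isWeightVec (B : WeightBasis hσ k) {ν : Fin n → ℤ} {v : V}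
    (hv : IsWeightVec σ (fun j => (ν j : ℝ)) v) {i : Fin (Module.finrank ℂ V)}
    (h : B.b.repr v i ≠ 0) : B.wt i = ν := by
  funext j
  have h1 := (torusElt_apply_iff_cartan hσ j _ _).1 (hv j)
  have h2 := B.repr_cartan j v i
  rw [h1, map_smul, Finsupp.smul_apply, smul_eq_mul] at h2
  have h3 := mul_right_cancel₀ h h2
  have h4 : ((B.wt i j : ℤ) : ℂ) = ((ν j : ℤ) : ℂ) := by simpa using h3.symm
  exact_mod_cast h4

theorem WeightBasis.subst_swap_char (B : WeightBasis hσ k) {i j : Fin n} (h : i ≠ j) :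
    subst (swapHom i j) B.char = B.char :=
  B.subst_char _ (swapElt i j) fun _ l hl =>
    B.wt_eq_of_isWeightVec ((B.isWeightVec l).swap h) hl

theorem WeightBasis.subst_flip_char (B : WeightBasis hσ k) {i j : Fin n} (h : i ≠ j) :
    subst (flipHom i j) B.char = B.char :=
  B.subst_char _ (flipElt i j) fun _ l hl => by
    refine B.wt_eq_of_isWeightVec (ν := flipHom i j (B.wt l)) ?_ hl
    convert (B.isWeightVec l).flip h using 1
    funext m
    simp only [flipHom_apply, flipOn]
    split_ifs <;> simp

/-- The contribution to the trace of the Casimir operator of the root vectors that belong to the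
coordinates `i` and `j`. -/
def WeightBasis.casimirPart (B : WeightBasis hσ k) (i j : Fin n) : WeightAlg n :=
  ∑ s, ∑ t, B.ftr (rootOp hσ (i, s) (j, t) * rootOp hσ (negIdx (j, t)) (negIdx (i, s)))

theorem WeightBasis.ftr_casimir (B : WeightBasis hσ k) :
    B.ftr (casimir (rootOp hσ)) = ∑ i, ∑ j, B.casimirPart i j := by
  simp only [casimir, map_sum, Fintype.sum_prod_type, WeightBasis.casimirPart]
  exact Finset.sum_congr rfl fun i _ => Finset.sum_comm

theorem WeightBasis.casimirPart_self (B : WeightBasis hσ k) (i : Fin n) :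
    B.casimirPart i i = 2 * dv i (dv i B.char) := by
  have h1 : rootOp hσ (i, true) (i, false) = cartan hσ i := by
    have := rootOp_neg hσ (i, true)
    simpa [negIdx, sgnIdx] using this
  have h2 : rootOp hσ (i, false) (i, true) = -cartan hσ i := by rw [rootOp_swap, h1]
  simp only [WeightBasis.casimirPart, Fintype.sum_bool, negIdx, rootOp_self, Bool.not_true,
    Bool.not_false, h1, h2, zero_mul, map_zero, neg_mul_neg, B.ftr_cartan_mul]
  ring

/-- The formal trace of `S T` is `e^α` times that of `T S` if `S` has the root `α`, so that the
formal trace of `[S, T]`, for root vectors `S`, `T` of roots `α`, `-α`, determines that of `S T`. -/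
theorem WeightBasis.mul_ftr_rootOp (B : WeightBasis hσ k) {i j : Fin n} (hij : i ≠ j) (s t : Bool) :
    (coordSum i - coordSum j) *
      B.ftr (rootOp hσ (i, s) (j, t) * rootOp hσ (negIdx (j, t)) (negIdx (i, s))) =
    (fexp (idxWeight (i, s)) - fexp (idxWeight (j, t))) *
      ((sgnIdx (i, s) : ℂ) • dv i B.char + (sgnIdx (j, t) : ℂ) • dv j B.char) := by
  set S := rootOp hσ (i, s) (j, t) with hS
  set T := rootOp hσ (negIdx (j, t)) (negIdx (i, s)) with hT
  have h1 : B.ftr (S * T) - B.ftr (T * S) =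
      (sgnIdx (i, s) : ℂ) • dv i B.char + (sgnIdx (j, t) : ℂ) • dv j B.char := by
    rw [← map_sub, hS, hT, rootOp_lie]
    have n1 : ¬negIdx (j, t) = negIdx (i, s) := fun h => hij (congrArg Prod.fst h).symm
    have n2 : ¬negIdx (i, s) = negIdx (j, t) := fun h => hij (congrArg Prod.fst h)
    rw [if_pos rfl, if_neg n1, if_neg n2, if_pos rfl, sub_zero, sub_zero, map_add, rootOp_neg,
      rootOp_neg, map_smul, map_smul, B.ftr_cartan, B.ftr_cartan]
  have h2 : B.ftr (S * T) = fexp (idxWeight (i, s) + idxWeight (j, t)) * B.ftr (T * S) :=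
    B.ftr_rootOp_mul _ _ _
  have h3 : ∀ (l : Fin n) (u : Bool), coordSum l =
      fexp (idxWeight (l, u)) + fexp (-idxWeight (l, u)) := by
    intro l u
    cases u
    · rw [idxWeight_false, neg_neg, add_comm, coordSum, idxWeight_false]
    · rw [coordSum, idxWeight_false]
  rw [fexp_add] at h2
  rw [h3 i s, h3 j t, ← h1]
  have e1 := fexp_mul_fexp_neg (idxWeight (i, s))
  have e2 := fexp_mul_fexp_neg (idxWeight (j, t))
  generalize fexp (idxWeight (i, s)) = x at *
  generalize fexp (-idxWeight (i, s)) = x' at *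
  generalize fexp (idxWeight (j, t)) = y at *
  generalize fexp (-idxWeight (j, t)) = y' at *
  rw [h2]
  linear_combination (y * B.ftr (T * S)) * e1 - (x * B.ftr (T * S)) * e2

theorem dv_coordSum (m i : Fin n) : dv m (coordSum i) =
    if m = i then fexp (idxWeight (i, true)) - fexp (idxWeight (i, false)) else 0 := by
  rw [coordSum, map_add, dv_fexp, dv_fexp]
  split_ifs with h
  · subst h
    simp [idxWeight, sgnIdx]
    abel
  · simp [idxWeight, h]

theorem WeightBasis.mul_casimirPart (B : WeightBasis hσ k) {i j : Fin n} (hij : i ≠ j) :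
    (coordSum i - coordSum j) * B.casimirPart i j =
      2 * ∑ m, dv m (coordSum i - coordSum j) * dv m B.char := by
  have h1 : ∑ m, dv m (coordSum i - coordSum j) * dv m B.char =
      (fexp (idxWeight (i, true)) - fexp (idxWeight (i, false))) * dv i B.char -
        (fexp (idxWeight (j, true)) - fexp (idxWeight (j, false))) * dv j B.char := by
    simp only [map_sub, dv_coordSum, sub_mul, Finset.sum_sub_distrib, ite_mul, zero_mul,
      Finset.sum_ite_eq', Finset.mem_univ, if_true]
  rw [h1, WeightBasis.casimirPart]
  have e : ∀ s t, _ := fun s t => B.mul_ftr_rootOp hij s t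
  have e1 := e true true
  have e2 := e true false
  have e3 := e false true
  have e4 := e false false
  simp only [sgnIdx, if_true, Bool.false_eq_true, if_false, Int.cast_one, one_smul, Int.cast_neg,
    neg_smul] at e1 e2 e3 e4
  simp only [Fintype.sum_bool]
  linear_combination e1 + e2 + e3 + e4

theorem sum_sum_eq_ltPairs {M : Type*} [AddCommMonoid M] (f : Fin n → Fin n → M) :
    ∑ i, ∑ j, f i j = ∑ i, f i i + ∑ p ∈ ltPairs n, (f p.1 p.2 + f p.2 p.1) := by
  have h1 : ∀ i j, f i j = (if i = j then f i j else 0) + ((if i < j then f i j else 0) +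
      (if j < i then f i j else 0)) := by
    intro i j
    rcases lt_trichotomy i j with h | h | h
    · simp [h, h.ne, h.not_gt]
    · simp [h]
    · simp [h, h.ne', h.not_gt]
  have h2 : ∑ i, ∑ j, (if j < i then f i j else 0) = ∑ p ∈ ltPairs n, f p.2 p.1 := by
    rw [Finset.sum_comm, ltPairs, Finset.sum_filter, Fintype.sum_prod_type]
  have h3 : ∑ i, ∑ j, (if i < j then f i j else 0) = ∑ p ∈ ltPairs n, f p.1 p.2 := by
    rw [ltPairs, Finset.sum_filter, Fintype.sum_prod_type]
  calc ∑ i, ∑ j, f i j = ∑ i, ∑ j, ((if i = j then f i j else 0) +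
        ((if i < j then f i j else 0) + (if j < i then f i j else 0))) :=
        Finset.sum_congr rfl fun i _ => Finset.sum_congr rfl fun j _ => h1 i j
    _ = _ := by
      simp only [Finset.sum_add_distrib, h2, h3, Finset.sum_ite_eq, Finset.mem_univ, if_true]

/-- Each pair of coordinates contributes the logarithmic derivative of its factor of the Weyl
denominator in the direction of the gradient of the character, and the contributions add up to that
of the product by the Leibniz rule. -/
theorem WeightBasis.weylDenom_mul_ftr_casimir (B : WeightBasis hσ k) :
    weylDenom n * B.ftr (casimir (rootOp hσ)) =
      2 * (weylDenom n * ∑ m, dv m (dv m B.char)) +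
        4 * ∑ m, dv m (weylDenom n) * dv m B.char := by
  have key : ∀ t : Finset (Fin n × Fin n), (∀ p ∈ t, p.1 ≠ p.2) →
      (∏ p ∈ t, (coordSum p.1 - coordSum p.2)) *
        ∑ p ∈ t, (B.casimirPart p.1 p.2 + B.casimirPart p.2 p.1) =
      4 * ∑ m, dv m (∏ p ∈ t, (coordSum p.1 - coordSum p.2)) * dv m B.char := by
    intro t
    induction t using Finset.induction_on with
    | empty => simp
    | insert q t hq ih =>
      intro ht
      have hne := ht q (Finset.mem_insert_self _ _)
      have ih' := ih fun p hp => ht p (Finset.mem_insert_of_mem hp)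
      have h1 := B.mul_casimirPart hne
      have h2 := B.mul_casimirPart hne.symm
      have h3 : ∑ m, dv m (coordSum q.2 - coordSum q.1) * dv m B.char =
          -∑ m, dv m (coordSum q.1 - coordSum q.2) * dv m B.char := by
        rw [← Finset.sum_neg_distrib]
        refine Finset.sum_congr rfl fun m _ => ?_
        rw [← neg_sub, map_neg, neg_mul]
      rw [h3] at h2
      rw [Finset.prod_insert hq, Finset.sum_insert hq]
      set P := ∏ p ∈ t, (coordSum p.1 - coordSum p.2) with hP
      have h4 : ∑ m, dv m ((coordSum q.1 - coordSum q.2) * P) * dv m B.char =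
          P * ∑ m, dv m (coordSum q.1 - coordSum q.2) * dv m B.char +
            (coordSum q.1 - coordSum q.2) * ∑ m, dv m P * dv m B.char := by
        rw [Finset.mul_sum, Finset.mul_sum, ← Finset.sum_add_distrib]
        refine Finset.sum_congr rfl fun m _ => ?_
        rw [Derivation.leibniz, smul_eq_mul, smul_eq_mul]
        ring
      rw [h4]
      linear_combination P * h1 - P * h2 + (coordSum q.1 - coordSum q.2) * ih'
  have h := key (ltPairs n) fun p hp => (mem_ltPairs.1 hp).ne
  rw [← weylDenom] at h
  rw [B.ftr_casimir, sum_sum_eq_ltPairs, mul_add, h]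
  simp only [B.casimirPart_self, Finset.mul_sum]
  congr 1
  refine Finset.sum_congr rfl fun m _ => ?_
  ring

/-- The product of the Weyl denominator and the character is an eigenfunction of the Laplace
operator: `Δ (D χ) = (Δ D) χ + 2 ⟨∇D, ∇χ⟩ + D Δχ`, where the first term is `|ρ|² D χ` and the
other two are half the formal trace of the Casimir operator, multiplied by `D`. -/
theorem WeightBasis.laplace_mul_char [NeZero n] (B : WeightBasis hσ k) (hirr : σ.IsIrreducible) :
    ∃ c : ℂ, ∑ m, dv m (dv m (weylDenom n * B.char)) = c • (weylDenom n * B.char) := by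
  obtain ⟨κ, hκ⟩ := exists_casimir_scalar hσ hirr
  have h1 := B.weylDenom_mul_ftr_casimir
  rw [hκ, map_smul, B.ftr_one] at h1
  refine ⟨κ / 2 + ((∑ l, rhoZ n l ^ 2 : ℤ) : ℂ), ?_⟩
  have h2 : ∑ m, dv m (dv m (weylDenom n * B.char)) =
      (∑ m, dv m (dv m (weylDenom n))) * B.char + 2 * ∑ m, dv m (weylDenom n) * dv m B.char +
        weylDenom n * ∑ m, dv m (dv m B.char) := by
    rw [Finset.sum_mul, Finset.mul_sum, Finset.mul_sum, ← Finset.sum_add_distrib,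
      ← Finset.sum_add_distrib]
    refine Finset.sum_congr rfl fun m _ => ?_
    rw [Derivation.leibniz, map_add, smul_eq_mul, smul_eq_mul, Derivation.leibniz,
      Derivation.leibniz]
    simp only [smul_eq_mul]
    ring
  rw [h2, laplace_weylDenom]
  have h3 : (2 : ℂ) • (2 * ∑ m, dv m (weylDenom n) * dv m B.char +
        weylDenom n * ∑ m, dv m (dv m B.char)) = κ • (weylDenom n * B.char) := by
    rw [← mul_smul_comm, h1, two_smul]
    ring
  have h4 : (2 * ∑ m, dv m (weylDenom n) * dv m B.char +
        weylDenom n * ∑ m, dv m (dv m B.char)) = (κ / 2) • (weylDenom n * B.char) := by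
    have := congrArg (fun x => (1 / 2 : ℂ) • x) h3
    simp only [smul_smul] at this
    rw [show (1 / 2 : ℂ) * 2 = 1 by norm_num, one_smul] at this
    rw [this]
    congr 1
    ring
  rw [add_assoc, h4, smul_mul_assoc, ← add_smul, add_comm]

/-- The highest weight has multiplicity one in the character, and bounds all other weights. -/
theorem WeightBasis.hasLeading_char [NeZero n] (B : WeightBasis hσ k) (hirr : σ.IsIrreducible) :
    HasLeading B.char k := by
  obtain ⟨i₀, h₀⟩ := B.exists_eq
  refine ⟨?_, SuppIn.sum fun i _ => suppIn_fexp (B.sub_mem i)⟩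
  rw [WeightBasis.char, AddMonoidAlgebra.coeff_sum, Finsupp.finsetSum_apply,
    Finset.sum_eq_single i₀]
  · rw [coeff_fexp, if_pos h₀]
  · intro i _ hi
    rw [coeff_fexp, if_neg]
    exact fun h => hi (B.wt_injOn hirr h₀ h)
  · simp

end Character

/-! ### Weyl's character and dimension formulas -/

section Alternating

variable {n : ℕ}

/-- An element of the group algebra that changes sign under transpositions of coordinates, is
invariant under sign changes of two coordinates and has no dominant weights, is zero: a weight that
maximizes the pairing with an interior point of the chamber is dominant. -/
theorem eq_zero_of_alternating {f : WeightAlg n}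
    (hs : ∀ i j, i ≠ j → subst (swapHom i j) f = -f)
    (hf : ∀ i j, i ≠ j → subst (flipHom i j) f = f)
    (h0 : ∀ ν, IsDominant ν → f.coeff ν = 0) : f = 0 := by
  by_contra hne
  have hsupp : f.coeff.support.Nonempty := by
    rw [Finsupp.support_nonempty_iff]
    exact fun h => hne (AddMonoidAlgebra.coeff_eq_zero.1 h)
  obtain ⟨ν, hν, hmax⟩ := Finset.exists_max_image f.coeff.support
    (fun ν => ∑ l, ν l * chamberPoint n l) hsupp
  rw [Finsupp.mem_support_iff] at hν
  have h1 : ∀ i j, i ≠ j → ∀ μ, f.coeff μ ≠ 0 → f.coeff (μ ∘ Equiv.swap i j) ≠ 0 := by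
    intro i j hij μ hμ h
    have := coeff_subst (swapHom_injective i j) f μ
    rw [hs i j hij, swapHom_apply, AddMonoidAlgebra.coeff_neg, Finsupp.neg_apply, h,
      neg_zero] at this
    exact hμ this.symm
  have h2 : ∀ i j, i ≠ j → ∀ μ, f.coeff μ ≠ 0 → f.coeff (flipOn {i} (flipOn {j} μ)) ≠ 0 := by
    intro i j hij μ hμ h
    have := coeff_subst (flipHom_injective i j) f μ
    rw [hf i j hij, flipHom_apply, h] at this
    exact hμ this.symm
  refine hν (h0 ν (isDominant_of_pairing_le (fun i j hij => hmax _ ?_) fun i j hij => hmax _ ?_))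
  · exact Finsupp.mem_support_iff.2 (h1 i j hij.ne ν hν)
  · exact Finsupp.mem_support_iff.2 (h2 i j hij.ne _ (h1 i j hij.ne ν hν))

/-- The alternating sum `∑_{w ∈ W} sgn(w) e^{w a}` over the Weyl group of type `D_n`, which consists
of the permutations of the coordinates combined with even sign changes; odd sign changes have the
coefficient `0`. -/
def altSum (a : Fin n → ℤ) : WeightAlg n :=
  ∑ π : Equiv.Perm (Fin n), ∑ ε : Fin n → ℤˣ,
    ((((Equiv.Perm.sign π : ℤˣ) : ℤ) : ℂ) * ((1 + (((∏ j, ε j : ℤˣ) : ℤ) : ℂ)) / 2)) •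
      fexp (fun j => (ε j : ℤ) * a (π j))

theorem subst_smul (φ : (Fin n → ℤ) →+ (Fin n → ℤ)) (c : ℂ) (f : WeightAlg n) :
    subst φ (c • f) = c • subst φ f :=
  AddMonoidAlgebra.ext (Finsupp.mapDomain_smul c f.coeff)

theorem subst_altSum_swap (a : Fin n → ℤ) {i j : Fin n} (h : i ≠ j) :
    subst (swapHom i j) (altSum a) = -altSum a := by
  have hsm : ∀ (c : ℂ) (f : WeightAlg n), subst (swapHom i j) (c • f) = c • subst (swapHom i j) f :=
    subst_smul _
  simp only [altSum, map_sum, hsm, subst_fexp]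
  rw [← Finset.sum_neg_distrib, ← Equiv.sum_comp (Equiv.mulRight (Equiv.swap i j))]
  refine Finset.sum_congr rfl fun π _ => ?_
  rw [← Finset.sum_neg_distrib,
      ← Equiv.sum_comp (Equiv.arrowCongr (Equiv.swap i j) (Equiv.refl ℤˣ))]
  refine Finset.sum_congr rfl fun ε _ => ?_
  have e1 : ∏ l, (Equiv.arrowCongr (Equiv.swap i j) (Equiv.refl ℤˣ)) ε l = ∏ l, ε l :=
    Equiv.prod_comp (Equiv.swap i j) ε
  have e2 : swapHom i j (fun l => (((Equiv.arrowCongr (Equiv.swap i j)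
      (Equiv.refl ℤˣ)) ε l : ℤˣ) : ℤ) *
      a ((Equiv.mulRight (Equiv.swap i j)) π l)) = fun l => (ε l : ℤ) * a (π l) := by
    funext l
    simp [swapHom_apply, Equiv.arrowCongr]
  rw [e1, e2, ← neg_smul, Equiv.coe_mulRight, Equiv.Perm.sign_mul, Equiv.Perm.sign_swap h]
  congr 1
  push_cast
  ring

theorem subst_altSum_flip (a : Fin n → ℤ) (i j : Fin n) :
    subst (flipHom i j) (altSum a) = altSum a := by
  have hsm : ∀ (c : ℂ) (f : WeightAlg n), subst (flipHom i j) (c • f) = c • subst (flipHom i j) f :=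
    subst_smul _
  simp only [altSum, map_sum, hsm, subst_fexp]
  refine Finset.sum_congr rfl fun π _ => ?_
  let Φ : (Fin n → ℤˣ) ≃ (Fin n → ℤˣ) :=
    { toFun := fun ε => flipOn {i} (flipOn {j} ε)
      invFun := fun ε => flipOn {j} (flipOn {i} ε)
      left_inv := fun ε => by
        change flipOn {j} (flipOn {i} (flipOn {i} (flipOn {j} ε))) = ε
        rw [flipOn_flipOn_singleton_self, flipOn_flipOn_singleton_self]
      right_inv := fun ε => by
        change flipOn {i} (flipOn {j} (flipOn {j} (flipOn {i} ε))) = ε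
        rw [flipOn_flipOn_singleton_self, flipOn_flipOn_singleton_self] }
  rw [← Equiv.sum_comp Φ]
  refine Finset.sum_congr rfl fun ε _ => ?_
  have hp : ∀ (m : Fin n) (ε : Fin n → ℤˣ), ∏ l, flipOn {m} ε l = -∏ l, ε l := by
    intro m ε
    have : ∀ l, flipOn {m} ε l = (if l = m then -1 else 1) * ε l := by
      intro l
      by_cases hl : l = m <;> simp [flipOn, hl]
    simp only [this, Finset.prod_mul_distrib, Finset.prod_ite_eq', Finset.mem_univ, if_true]
    rw [neg_one_mul]
  have e1 : ∏ l, Φ ε l = ∏ l, ε l := by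
    change ∏ l, flipOn {i} (flipOn {j} ε) l = _
    rw [hp, hp, neg_neg]
  have e2 : flipHom i j (fun l => ((Φ ε l : ℤˣ) : ℤ) * a (π l)) = fun l => (ε l : ℤ) * a (π l) := by
    funext l
    simp only [Φ, flipHom_apply, flipOn, Equiv.coe_fn_mk]
    split_ifs <;> simp
  rw [e1, e2]

theorem abs_unit_mul (ε : ℤˣ) (x : ℤ) : |(ε : ℤ) * x| = |x| := by
  rw [abs_mul, Int.isUnit_iff_abs_eq.1 ε.isUnit, one_mul]

/-- Among the dominant weights, the alternating sum contains only `a`. -/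
theorem coeff_altSum [NeZero n] {a : Fin n → ℤ} (ha : IsStrictDominant a) {ν : Fin n → ℤ}
    (hν : IsDominant ν) : (altSum a).coeff ν = if ν = a then 1 else 0 := by
  have habs : ∀ i j, i < j → |a j| < |a i| := fun i j hij => (ha i j hij).trans_le (le_abs_self _)
  -- The absolute values of the coordinates of `a` are strictly decreasing, so no permutation but
  -- the identity leaves them decreasing.
  have key : ∀ (π : Equiv.Perm (Fin n)) (ε : Fin n → ℤˣ),
      (fun j => (ε j : ℤ) * a (π j)) = ν → π = 1 ∧ ∀ j, j ≠ lastIdx n → ε j = 1 := by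
    intro π ε h
    have hv : ∀ j, ν j = (ε j : ℤ) * a (π j) := fun j => (congrFun h j).symm
    have hv' : ∀ j, |ν j| = |a (π j)| := fun j => by rw [hv, abs_unit_mul]
    have hinj : ∀ i j, |a i| = |a j| → i = j := by
      intro i j hij
      rcases lt_trichotomy i j with h | h | h
      · exact absurd hij (habs i j h).ne'
      · exact h
      · exact absurd hij (habs j i h).ne
    have hmono : StrictMono π := by
      intro i j hij
      have h1 : |a (π j)| ≤ |a (π i)| := by
        rw [← hv', ← hv']
        exact (hν i j hij).trans (le_abs_self _)
      rcases lt_trichotomy (π i) (π j) with h | h | h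
      · exact h
      · exact absurd (π.injective h) hij.ne
      · exact absurd h1 (not_le.2 (habs _ _ h))
    have hπ : π = 1 := by
      have : (π : Fin n → Fin n) = id := by
        refine (hmono.range_inj strictMono_id).1 ?_
        rw [Set.range_id, π.surjective.range_eq]
      exact Equiv.ext fun i => congrFun this i
    refine ⟨hπ, fun j hj => ?_⟩
    have hlt : j < lastIdx n := by
      have h1 := j.2
      have h2 : (j : ℕ) ≠ n - 1 := fun h => hj (Fin.ext h)
      change (j : ℕ) < n - 1
      omega
    have hpos : 0 < a j := (abs_nonneg _).trans_lt (ha j _ hlt)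
    have hnn : 0 ≤ ν j := (abs_nonneg _).trans (hν j _ hlt)
    rw [hv, hπ, Equiv.Perm.one_apply] at hnn
    rcases Int.units_eq_one_or (ε j) with h | h
    · exact h
    · rw [h] at hnn
      simp at hnn
      omega
  have hcoef : (altSum a).coeff ν = ∑ π : Equiv.Perm (Fin n), ∑ ε : Fin n → ℤˣ,
      ((((Equiv.Perm.sign π : ℤˣ) : ℤ) : ℂ) * ((1 + (((∏ j, ε j : ℤˣ) : ℤ) : ℂ)) / 2)) *
        (if (fun j => (ε j : ℤ) * a (π j)) = ν then 1 else 0) := by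
    simp only [altSum, AddMonoidAlgebra.coeff_sum, Finsupp.finsetSum_apply,
      AddMonoidAlgebra.coeff_smul_apply, coeff_fexp, smul_eq_mul]
  rw [hcoef, Finset.sum_eq_single 1, Finset.sum_eq_single 1]
  · simp [eq_comm]
  · intro ε _ hε
    by_cases h : (fun j => (ε j : ℤ) * a ((1 : Equiv.Perm (Fin n)) j)) = ν
    · have h1 := (key 1 ε h).2
      -- Only the last sign can be negative, and then the sign change is odd.
      have h2 : ε (lastIdx n) = -1 := by
        rcases Int.units_eq_one_or (ε (lastIdx n)) with h3 | h3
        · refine absurd (funext fun j => ?_) hε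
          by_cases hj : j = lastIdx n
          · rw [hj, h3]; rfl
          · rw [h1 j hj]; rfl
        · exact h3
      have h3 : ∏ j, ε j = -1 := by
        rw [Finset.prod_eq_single (lastIdx n) (fun j _ hj => h1 j hj) (by simp), h2]
      rw [h3]
      simp
    · rw [if_neg h, mul_zero]
  · simp
  · intro π _ hπ
    refine Finset.sum_eq_zero fun ε _ => ?_
    rw [if_neg fun h => hπ (key π ε h).1, mul_zero]
  · simp

end Alternating

section CharacterFormula

variable {n : ℕ} {V : Type*} [AddCommGroup V] [Module ℂ V] [FiniteDimensional ℂ V]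
  {σ : Representation ℂ (Spin n) V} {hσ : IsContinuousRep σ} {k : Fin n → ℤ}

theorem IsDominant.rhoZ_add {k : Fin n → ℤ} (hk : IsDominant k) : IsStrictDominant (rhoZ n + k) :=
  fun i j hij => (abs_add_le _ _).trans_lt
    (add_lt_add_of_lt_of_le (rhoZ_strictDominant n i j hij) (hk i j hij))

/-- Weyl's character formula for integral highest weights.  Both sides are alternating, so their
dominant weights decide.  All weights `ν` of the left-hand side have the length of `ρ + k`, since it
is an eigenfunction of the Laplace operator, and the only such dominant `ν` below `ρ + k` is `ρ + k`
itself, with coefficient `1`. -/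
theorem WeightBasis.weylDenom_mul_char [NeZero n] (B : WeightBasis hσ k) (hirr : σ.IsIrreducible)
    (hk : IsDominant k) : weylDenom n * B.char = altSum (rhoZ n + k) := by
  have ha := hk.rhoZ_add
  have hlead := (hasLeading_weylDenom n).mul (B.hasLeading_char hirr)
  obtain ⟨c, hc⟩ := B.laplace_mul_char hirr
  have hc' : ∀ ν, ((∑ m, ν m ^ 2 : ℤ) : ℂ) * (weylDenom n * B.char).coeff ν =
      c * (weylDenom n * B.char).coeff ν := by
    intro ν
    rw [← coeff_sum_dv_dv, hc, AddMonoidAlgebra.coeff_smul_apply, smul_eq_mul]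
  have hca := hc' (rhoZ n + k)
  rw [hlead.1, mul_one, mul_one] at hca
  rw [← sub_eq_zero]
  refine eq_zero_of_alternating (fun i j h => ?_) (fun i j h => ?_) fun ν hν => ?_
  · rw [map_sub, map_mul, subst_weylDenom_swap h, B.subst_swap_char h, subst_altSum_swap _ h]
    ring
  · rw [map_sub, map_mul, subst_weylDenom_flip h, B.subst_flip_char h, subst_altSum_flip]
  · rw [AddMonoidAlgebra.coeff_sub, Finsupp.sub_apply, coeff_altSum ha hν, sub_eq_zero]
    split_ifs with h
    · rw [h, hlead.1]
    · by_contra h0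
      have h1 := mul_right_cancel₀ h0 (hc' ν)
      rw [← hca] at h1
      have h2 : ∑ m, ν m ^ 2 = ∑ m, (rhoZ n + k) m ^ 2 := by exact_mod_cast h1
      exact h (eq_of_norm_le ha hν (hlead.2 ν h0) h2.ge)

/-- Evaluation of the formal exponential `e^ν` at the multiple `s ρ` of the half sum of the positive
roots. -/
def evalRho (n : ℕ) (s : ℂ) : WeightAlg n →ₐ[ℂ] ℂ :=
  AddMonoidAlgebra.lift ℂ ℂ (Fin n → ℤ)
    { toFun := fun ν => Complex.exp (s * ∑ l, (Multiplicative.toAdd ν l : ℂ) * (rho n l : ℂ))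
      map_one' := by simp
      map_mul' := fun μ ν => by
        rw [← Complex.exp_add, ← mul_add, ← Finset.sum_add_distrib]
        congr 2
        refine Finset.sum_congr rfl fun l _ => ?_
        rw [toAdd_mul, Pi.add_apply]
        push_cast
        ring }

theorem evalRho_fexp (s : ℂ) (ν : Fin n → ℤ) :
    evalRho n s (fexp ν) = Complex.exp (s * ∑ l, (ν l : ℂ) * (rho n l : ℂ)) := by
  rw [evalRho, fexp, AddMonoidAlgebra.lift_single, one_smul]
  rfl

/-- `2 cosh (s x)`. -/
def twoCosh (s x : ℂ) : ℂ := Complex.exp (s * x) + Complex.exp (-(s * x))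

theorem evalRho_weylDenom (s : ℂ) : evalRho n s (weylDenom n) =
    ∏ p ∈ ltPairs n, (twoCosh s (rho n p.1) - twoCosh s (rho n p.2)) := by
  have h : ∀ i : Fin n, evalRho n s (coordSum i) = twoCosh s (rho n i) := by
    intro i
    rw [coordSum, map_add, evalRho_fexp, evalRho_fexp, twoCosh]
    have h1 : ∑ l, ((idxWeight (i, true) l : ℤ) : ℂ) * (rho n l : ℂ) = rho n i := by
      rw [Finset.sum_eq_single i]
      · simp [idxWeight, sgnIdx]
      · intro l _ hl; simp [idxWeight, hl]
      · simp
    rw [idxWeight_false, h1]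
    simp only [Pi.neg_apply, Int.cast_neg, neg_mul, Finset.sum_neg_distrib, h1, mul_neg]
  rw [weylDenom, map_prod]
  simp only [map_sub, h]

theorem rho_eq_zero_iff [NeZero n] (j : Fin n) : rho n j = 0 ↔ j = lastIdx n := by
  have := j.2
  rw [Fin.ext_iff]
  simp only [rho, lastIdx]
  omega

/-- The alternating sum at `s ρ` is a Vandermonde determinant, like the denominator. -/
theorem evalRho_altSum [NeZero n] (s : ℂ) (a : Fin n → ℤ) : evalRho n s (altSum a) =
    ∏ p ∈ ltPairs n, (twoCosh s (a p.1) - twoCosh s (a p.2)) := by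
  have h1 : ∏ p ∈ ltPairs n, (twoCosh s (a p.1) - twoCosh s (a p.2)) =
      (Matrix.of fun i j : Fin n => symPow (Complex.exp (s * a i)) (Complex.exp (-(s * a i)))
        (rho n j)).det :=
    prod_ltPairs_sub_eq_det (fun i => Complex.exp (s * a i)) (fun i => Complex.exp (-(s * a i)))
      fun i => by rw [← Complex.exp_add, add_neg_cancel, Complex.exp_zero]
  rw [h1, Matrix.det_apply, altSum, map_sum]
  refine Finset.sum_congr rfl fun π _ => ?_
  rw [map_sum]
  simp only [map_smul, evalRho_fexp, smul_eq_mul, Matrix.of_apply]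
  set g : Fin n → ℤˣ → ℂ := fun j u => Complex.exp (s * (((u : ℤ) * a (π j) : ℤ) * (rho n j : ℂ)))
    with hg
  have h2 : ∀ ε : Fin n → ℤˣ, Complex.exp (s * ∑ l,
      (((ε l : ℤ) * a (π l) : ℤ) : ℂ) * (rho n l : ℂ)) =
      ∏ l, g l (ε l) := by
    intro ε
    rw [Finset.mul_sum, Complex.exp_sum]
  simp only [h2]
  have h3 : ∀ f : Fin n → ℤˣ → ℂ, ∑ ε : Fin n → ℤˣ, ∏ l, f l (ε l) = ∏ l, (f l 1 + f l (-1)) := by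
    intro f
    rw [← Fintype.piFinset_univ, ← Finset.prod_univ_sum]
    refine Finset.prod_congr rfl fun l _ => ?_
    rw [UnitsInt.univ, Finset.sum_pair (by decide)]
  have h4 : ∑ ε : Fin n → ℤˣ, ((((∏ j, ε j : ℤˣ) : ℤ) : ℂ)) * ∏ l, g l (ε l) = 0 := by
    have : ∀ ε : Fin n → ℤˣ, ((((∏ j, ε j : ℤˣ) : ℤ) : ℂ)) * ∏ l, g l (ε l) =
        ∏ l, (((ε l : ℤˣ) : ℤ) : ℂ) * g l (ε l) := by
      intro ε
      rw [Finset.prod_mul_distrib, Units.coe_prod, Int.cast_prod]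
    simp only [this]
    rw [h3 fun l u => ((u : ℤ) : ℂ) * g l u]
    -- The factor at the last index vanishes, because the last coordinate of `ρ` is zero.
    refine Finset.prod_eq_zero (Finset.mem_univ (lastIdx n)) ?_
    simp [hg, rho_last]
  have h5 : ∑ ε : Fin n → ℤˣ, ∏ l, g l (ε l) =
      2 * ∏ j, symPow (Complex.exp (s * a (π j))) (Complex.exp (-(s * a (π j)))) (rho n j) := by
    rw [h3, ← Finset.mul_prod_erase _ _ (Finset.mem_univ (lastIdx n)),
      ← Finset.mul_prod_erase (a := lastIdx n) _ (fun j => symPow _ _ _) (Finset.mem_univ _),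
      ← mul_assoc]
    congr 1
    · simp [hg, symPow, rho_last]; norm_num
    · refine Finset.prod_congr rfl fun j hj => ?_
      have hj' : ¬rho n j = 0 := fun h => (Finset.mem_erase.1 hj).1 ((rho_eq_zero_iff j).1 h)
      rw [symPow, if_neg hj', ← Complex.exp_nat_mul, ← Complex.exp_nat_mul]
      simp only [hg]
      congr 2
      · push_cast; simp; ring
      · push_cast; simp; ring
  have h6 : ∀ ε : Fin n → ℤˣ, ((((Equiv.Perm.sign π : ℤˣ) : ℤ) : ℂ) *
      ((1 + (((∏ j, ε j : ℤˣ) : ℤ) : ℂ)) / 2)) * ∏ l, g l (ε l) =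
      (((Equiv.Perm.sign π : ℤˣ) : ℤ) : ℂ) / 2 * ∏ l, g l (ε l) +
        (((Equiv.Perm.sign π : ℤˣ) : ℤ) : ℂ) / 2 *
          (((((∏ j, ε j : ℤˣ) : ℤ) : ℂ)) * ∏ l, g l (ε l)) := fun ε => by ring
  simp only [h6, Finset.sum_add_distrib, ← Finset.mul_sum, h4, h5]
  rw [Units.smul_def, zsmul_eq_mul]
  ring

/-- `2 cosh (s x) - 2` is the square of `2 sinh (s x / 2)`. -/
theorem tendsto_twoCosh (x y : ℂ) : Filter.Tendsto
    (fun s : ℂ => (twoCosh s x - twoCosh s y) / s ^ 2) (𝓝[≠] 0) (𝓝 (x ^ 2 - y ^ 2)) := by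
  have key : ∀ x : ℂ, Filter.Tendsto (fun s : ℂ => (twoCosh s x - 2) / s ^ 2) (𝓝[≠] 0)
      (𝓝 (x ^ 2)) := by
    intro x
    have h1 : HasDerivAt (fun s : ℂ => Complex.exp (s * (x / 2)) - Complex.exp (-(s * (x / 2)))) x 0 := by
      have e1 : HasDerivAt (fun s : ℂ => s * (x / 2)) (x / 2) 0 := by
        simpa using (hasDerivAt_id (0 : ℂ)).mul_const (x / 2)
      have := e1.cexp.sub e1.neg.cexp
      refine this.congr_deriv ?_
      simp
    have h2 := h1.tendsto_slope_zero
    have h3 := h2.pow 2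
    refine h3.congr fun s => ?_
    simp only [zero_add, zero_mul, neg_zero, Complex.exp_zero, sub_self, sub_zero, smul_eq_mul]
    rw [mul_pow, inv_pow, inv_mul_eq_div]
    congr 1
    have e1 : Complex.exp (s * (x / 2)) * Complex.exp (-(s * (x / 2))) = 1 := by
      rw [← Complex.exp_add, add_neg_cancel, Complex.exp_zero]
    have e2 : Complex.exp (s * (x / 2)) ^ 2 = Complex.exp (s * x) := by
      rw [← Complex.exp_nat_mul]; congr 1; push_cast; ring
    have e3 : Complex.exp (-(s * (x / 2))) ^ 2 = Complex.exp (-(s * x)) := by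
      rw [← Complex.exp_nat_mul]; congr 1; push_cast; ring
    rw [twoCosh, ← e2, ← e3]
    linear_combination -2 * e1
  refine ((key x).sub (key y)).congr fun s => ?_
  rw [← sub_div]
  congr 1
  ring

/-- Weyl's dimension formula for integral highest weights: the limit for `s → 0` of the character
formula at `s ρ`, after division by `s²` for each pair of coordinates. -/
theorem finrank_mul_rootProd [NeZero n] (hσ : IsContinuousRep σ) (hirr : σ.IsIrreducible)
    (hk : IsHighestWeight σ (fun j => (k j : ℝ))) :
    (Module.finrank ℂ V : ℂ) * rootProd (fun j => (rho n j : ℂ)) =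
      rootProd (fun j => ((rhoZ n + k) j : ℂ)) := by
  obtain ⟨B⟩ := nonempty_weightBasis hσ hk
  have h1 : ∀ s : ℂ, (∏ p ∈ ltPairs n, (twoCosh s (rho n p.1) - twoCosh s (rho n p.2)) / s ^ 2) *
      evalRho n s B.char =
      ∏ p ∈ ltPairs n, (twoCosh s ((rhoZ n + k) p.1 : ℤ) - twoCosh s ((rhoZ n + k) p.2 : ℤ)) /
          s ^ 2 := by
    intro s
    rw [Finset.prod_div_distrib, Finset.prod_div_distrib, ← evalRho_altSum, ← evalRho_weylDenom,
      ← B.weylDenom_mul_char hirr hk.isDominant, map_mul]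
    ring
  have h2 : Filter.Tendsto (fun s : ℂ => evalRho n s B.char) (𝓝[≠] 0)
      (𝓝 (Module.finrank ℂ V : ℂ)) := by
    have : Continuous fun s : ℂ => evalRho n s B.char := by
      have h3 : ∀ s : ℂ, evalRho n s B.char =
          ∑ i, Complex.exp (s * ∑ l, (B.wt i l : ℂ) * (rho n l : ℂ)) := fun s => by
        rw [WeightBasis.char, map_sum]
        exact Finset.sum_congr rfl fun i _ => evalRho_fexp _ _
      simp only [h3]
      fun_prop
    have h3 := this.tendsto 0
    have h4 : evalRho n 0 B.char = (Module.finrank ℂ V : ℂ) := by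
      rw [WeightBasis.char, map_sum]
      simp [evalRho_fexp]
    rw [h4] at h3
    exact h3.mono_left nhdsWithin_le_nhds
  have h3 := (tendsto_finsetProd (ltPairs n) fun p _ =>
    tendsto_twoCosh (rho n p.1 : ℂ) (rho n p.2 : ℂ)).mul h2
  have h4 := tendsto_finsetProd (ltPairs n) fun p _ =>
    tendsto_twoCosh ((rhoZ n + k) p.1 : ℂ) ((rhoZ n + k) p.2 : ℂ)
  have h5 := tendsto_nhds_unique (h3.congr h1) h4
  rw [mul_comm]
  exact h5

end CharacterFormula

/-! ### Integrality of quotients of root products -/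

section Integrality

/-- The product `∏_{r < m} (x² - r²)`. -/
def sqFactorial (m : ℕ) (x : ℤ) : ℤ := ∏ r ∈ Finset.range m, (x ^ 2 - (r : ℤ) ^ 2)

theorem sqFactorial_eq (m : ℕ) (x : ℤ) : sqFactorial m x =
    (∏ r ∈ Finset.range m, (x - r)) * ∏ r ∈ Finset.range m, (x + r) := by
  rw [sqFactorial, ← Finset.prod_mul_distrib]
  exact Finset.prod_congr rfl fun r _ => by ring

theorem sqFactorial_pos (m : ℕ) : 0 < sqFactorial m m := by
  refine Finset.prod_pos fun r hr => ?_
  have h : (r : ℤ) < m := by exact_mod_cast Finset.mem_range.1 hr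
  nlinarith [Int.natCast_nonneg r]

theorem sqFactorial_eq_zero {m : ℕ} {r : ℕ} (h : r < m) : sqFactorial m r = 0 :=
  Finset.prod_eq_zero (Finset.mem_range.2 h) (by ring)

/-- The product of `2 m` consecutive integers, written symmetrically. -/
theorem prod_consecutive (m : ℕ) (x : ℤ) : ∏ i ∈ Finset.range (m + m), (x - m + i) =
    (∏ r ∈ Finset.range m, (x - (r + 1))) * ∏ r ∈ Finset.range m, (x + r) := by
  rw [Finset.prod_range_add]
  congr 1
  · rw [← Finset.prod_range_reflect]
    refine Finset.prod_congr rfl fun r hr => ?_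
    have := Finset.mem_range.1 hr
    rw [Nat.sub_sub, Nat.cast_sub (by omega)]
    push_cast
    ring
  · refine Finset.prod_congr rfl fun r _ => ?_
    push_cast
    ring

/-- `x² (x² - 1) ⋯ (x² - (m - 1)²)` is divisible by its value at `m`, which is `(2 m)! / 2`. -/
theorem sqFactorial_dvd (m : ℕ) (x : ℤ) : sqFactorial m m ∣ sqFactorial m x := by
  rcases Nat.eq_zero_or_pos m with rfl | hm
  · simp [sqFactorial]
  -- Twice the product is the sum of two products of `2 m` consecutive integers.
  have key : ∀ y : ℤ, y ≠ 0 → 2 * sqFactorial m y = ∏ i ∈ Finset.range (m + m), (y - m + i) +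
      ∏ i ∈ Finset.range (m + m), (y + 1 - m + i) := by
    intro y hy
    have h1 : (∏ r ∈ Finset.range m, (y - (r + 1))) * y =
        (∏ r ∈ Finset.range m, (y - (r : ℤ))) * (y - m) := by
      rw [← Finset.prod_range_succ (fun r : ℕ => y - (r : ℤ)),
        Finset.prod_range_succ' (fun r : ℕ => y - (r : ℤ))]
      simp
    have h2 : (∏ r ∈ Finset.range m, (y + 1 + r)) * y =
        (∏ r ∈ Finset.range m, (y + (r : ℤ))) * (y + m) := by
      rw [← Finset.prod_range_succ (fun r : ℕ => y + (r : ℤ)),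
        Finset.prod_range_succ' (fun r : ℕ => y + (r : ℤ))]
      simp only [Nat.cast_add, Nat.cast_one, Nat.cast_zero, add_zero]
      congr 1
      exact Finset.prod_congr rfl fun r _ => by ring
    have h3 : ∏ r ∈ Finset.range m, (y + 1 - ((r : ℤ) + 1)) = ∏ r ∈ Finset.range m, (y - (r : ℤ)) :=
      Finset.prod_congr rfl fun r _ => by ring
    rw [prod_consecutive, prod_consecutive, h3, sqFactorial_eq]
    apply mul_right_cancel₀ hy
    linear_combination -(∏ r ∈ Finset.range m, (y + (r : ℤ))) * h1 -
      (∏ r ∈ Finset.range m, (y - (r : ℤ))) * h2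
  have hval : 2 * sqFactorial m m = ((m + m).factorial : ℤ) := by
    rw [key m (by exact_mod_cast hm.ne'), Finset.prod_eq_zero (i := 0) (by simp; omega) (by simp),
      zero_add, ← Finset.prod_range_add_one_eq_factorial]
    push_cast
    exact Finset.prod_congr rfl fun r _ => by ring
  by_cases hx : x = 0
  · subst hx
    have := sqFactorial_eq_zero hm
    rw [Nat.cast_zero] at this
    rw [this]
    exact dvd_zero _
  · have h := dvd_add (Nat.factorial_coe_dvd_prod (m + m) (x - m))
      (Nat.factorial_coe_dvd_prod (m + m) (x + 1 - m))
    rw [← key x hx, ← hval] at h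
    exact (mul_dvd_mul_iff_left two_ne_zero).1 h

theorem rootProd_eq_det {n : ℕ} (x : Fin n → ℤ) :
    rootProd x = (Matrix.of fun i j : Fin n => sqFactorial (rho n j) (x i)).det := by
  have h := prod_ltPairs_sub_eq_det_eval (fun i => x i ^ 2)
    (fun m => ∏ r ∈ Finset.range m, (Polynomial.X - Polynomial.C ((r : ℤ) ^ 2)))
    (fun m => Polynomial.monic_prod_X_sub_C _ _) (fun m => by
      rw [Polynomial.natDegree_finsetProd_X_sub_C_eq_card, Finset.card_range])
  rw [rootProd, h]
  congr 1
  ext i j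
  simp [sqFactorial, Polynomial.eval_prod]

/-- The root product of an integral weight is divisible by the root product of `ρ`.  Both are
Vandermonde determinants in the polynomials `sqFactorial m`, whose values are divisible by
`sqFactorial m m`; after division of the columns, the determinant of `ρ` is triangular with
diagonal `1`. -/
theorem rootProd_rho_dvd {n : ℕ} (x : Fin n → ℤ) :
    rootProd (fun j => (rho n j : ℤ)) ∣ rootProd x := by
  choose g hg using sqFactorial_dvd
  have h1 : ∀ y : Fin n → ℤ, rootProd y = (∏ j : Fin n, sqFactorial (rho n j) (rho n j)) *
      (Matrix.of fun i j : Fin n => g (rho n j) (y i)).det := by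
    intro y
    rw [rootProd_eq_det, ← Matrix.det_mul_row]
    congr 1
    ext i j
    rw [Matrix.of_apply, Matrix.of_apply, Matrix.of_apply, hg]
  have h2 : (Matrix.of fun i j : Fin n => g (rho n j) (rho n i)).det = 1 := by
    have hlow : ∀ i j : Fin n, j < i → g (rho n j) (rho n i) = 0 := by
      intro i j hij
      have hlt : rho n i < rho n j := by
        have h3 : (j : ℕ) < i := hij
        have := i.2
        simp only [rho]
        omega
      have h3 := hg (rho n j) (rho n i)
      rw [sqFactorial_eq_zero hlt] at h3
      exact (mul_eq_zero.1 h3.symm).resolve_left (sqFactorial_pos _).ne'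
    rw [Matrix.det_of_isUpperTriangular]
    · refine Finset.prod_eq_one fun i _ => ?_
      have h3 := hg (rho n i) (rho n i)
      exact (mul_eq_left₀ (sqFactorial_pos _).ne').1 h3.symm
    · intro i j hij
      exact hlow i j hij
  rw [h1 x, h1 fun j => (rho n j : ℤ), h2, mul_one]
  exact dvd_mul_right _ _

end Integrality

/-! ### Sums of digamma values -/

section Digamma

theorem digamma_add_one_of_im_ne_zero {w : ℂ} (hw : w.im ≠ 0) :
    Complex.digamma (w + 1) = Complex.digamma w + w⁻¹ := by
  refine Complex.digamma_apply_add_one w fun m h => hw ?_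
  rw [h]
  simp

/-- The recurrence `ψ (w + 1) = ψ w + 1 / w`, applied to the four digamma values in `psiSum`. -/
theorem psiSum_natCast {lam : ℝ} (h : lam ≠ 0) (b : ℕ) : psiSum (Complex.I * lam) b =
    2 * (Complex.digamma (1 + Complex.I * lam) + Complex.digamma (1 - Complex.I * lam) +
      ∑ l ∈ Finset.range b, 2 * (l : ℂ) / ((lam : ℂ) ^ 2 + (l : ℂ) ^ 2) +
      (b : ℂ) / ((b : ℂ) ^ 2 + (lam : ℂ) ^ 2)) := by
  induction b with
  | zero => simp [psiSum]; ring
  | succ b ih =>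
    have hI := Complex.I_sq
    set z := Complex.I * (lam : ℂ) with hz
    have him : z.im = lam := by simp [hz]
    have hz2 : z ^ 2 = -(lam : ℂ) ^ 2 := by rw [hz, mul_pow, hI]; ring
    have n1 : ∀ r : ℝ, z + (r : ℂ) ≠ 0 := fun r h0 => h (by
      have := congrArg Complex.im h0
      rwa [Complex.add_im, Complex.ofReal_im, add_zero, him] at this)
    have n2 : ∀ r : ℝ, (r : ℂ) - z ≠ 0 := fun r h0 => h (by
      have := congrArg Complex.im h0
      rw [Complex.sub_im, Complex.ofReal_im, him] at this
      simpa using this)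
    have e1 := digamma_add_one_of_im_ne_zero (w := 1 + (z + b)) (by simp [him, h])
    have e2 := digamma_add_one_of_im_ne_zero (w := 1 - (z - b)) (by simp [him, h])
    have e3 := digamma_add_one_of_im_ne_zero (w := 1 - (z + (b + 1))) (by simp [him, h])
    have e4 := digamma_add_one_of_im_ne_zero (w := 1 + (z - (b + 1))) (by simp [him, h])
    have f1 : 1 + (z + (b : ℂ)) + 1 = 1 + (z + ((b + 1 : ℕ) : ℂ)) := by push_cast; ring
    have f2 : 1 - (z - (b : ℂ)) + 1 = 1 - (z - ((b + 1 : ℕ) : ℂ)) := by push_cast; ring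
    have f3 : 1 - (z + ((b : ℂ) + 1)) + 1 = 1 - (z + (b : ℂ)) := by ring
    have f4 : 1 + (z - ((b : ℂ) + 1)) + 1 = 1 + (z - (b : ℂ)) := by ring
    rw [f1] at e1
    rw [f2] at e2
    rw [f3] at e3
    rw [f4] at e4
    have step : psiSum z ((b + 1 : ℕ) : ℂ) = psiSum z b + ((1 + (z + (b : ℂ)))⁻¹ +
        (1 - (z - (b : ℂ)))⁻¹ - (1 - (z + ((b : ℂ) + 1)))⁻¹ - (1 + (z - ((b : ℂ) + 1)))⁻¹) := by
      simp only [psiSum, e1, e2, e3, e4]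
      push_cast
      ring
    have m1 := n1 (b + 1)
    have m2 := n2 (b + 1)
    have m3 := n1 b
    have m4 := n2 b
    push_cast at m1 m2 m3 m4
    have g1 : (1 + (z + (b : ℂ)))⁻¹ + (1 - (z - (b : ℂ)))⁻¹ =
        2 * (b + 1) / (((b : ℂ) + 1) ^ 2 + (lam : ℂ) ^ 2) := by
      have hd : ((b : ℂ) + 1) ^ 2 + (lam : ℂ) ^ 2 = (z + (b + 1)) * (b + 1 - z) := by
        linear_combination hz2
      have h1 : 1 + (z + (b : ℂ)) = z + (b + 1) := by ring
      have h2 : 1 - (z - (b : ℂ)) = b + 1 - z := by ring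
      rw [hd, h1, h2]
      field_simp
      ring
    have g2 : -(1 - (z + ((b : ℂ) + 1)))⁻¹ - (1 + (z - ((b : ℂ) + 1)))⁻¹ =
        2 * b / ((b : ℂ) ^ 2 + (lam : ℂ) ^ 2) := by
      have hd : (b : ℂ) ^ 2 + (lam : ℂ) ^ 2 = (z + b) * (b - z) := by
        linear_combination hz2
      have h1 : 1 - (z + ((b : ℂ) + 1)) = -(z + b) := by ring
      have h2 : 1 + (z - ((b : ℂ) + 1)) = -(b - z) := by ring
      rw [hd, h1, h2, inv_neg, inv_neg]
      field_simp
      ring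
    rw [step, ih, Finset.sum_range_succ, add_comm ((lam : ℂ) ^ 2) ((b : ℂ) ^ 2)]
    have g3 : (1 + (z + (b : ℂ)))⁻¹ + (1 - (z - (b : ℂ)))⁻¹ - (1 - (z + ((b : ℂ) + 1)))⁻¹ -
        (1 + (z - ((b : ℂ) + 1)))⁻¹ = 2 * (b + 1) / (((b : ℂ) + 1) ^ 2 + (lam : ℂ) ^ 2) +
          2 * b / ((b : ℂ) ^ 2 + (lam : ℂ) ^ 2) := by
      rw [← g1, ← g2]; ring
    rw [g3]
    push_cast
    ring

theorem continuousAt_digamma_one : ContinuousAt Complex.digamma 1 := by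
  have hd : DifferentiableOn ℂ Complex.Gamma {s | 0 < s.re} := fun s hs =>
    (Complex.differentiableAt_Gamma s fun m h => by
      have : 0 < s.re := hs
      rw [h] at this
      simp at this
      linarith [(Nat.cast_nonneg m : (0 : ℝ) ≤ m)]).differentiableWithinAt
  have hn : {s : ℂ | 0 < s.re} ∈ 𝓝 (1 : ℂ) :=
    (isOpen_lt continuous_const Complex.continuous_re).mem_nhds (by simp)
  have ha := hd.analyticAt hn
  rw [Complex.digamma_def]
  exact ha.deriv.continuousAt.div ha.continuousAt (by rw [Complex.Gamma_one]; exact one_ne_zero)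

end Digamma

/-! ### Root products as polynomials in one coordinate -/

section RootProd

/-- As a polynomial in the coordinate `j`, the root product has the roots `± a i`, `i ≠ j`. -/
theorem exists_rootProd_update {n : ℕ} {R : Type*} [CommRing R] (a : Fin n → R) (j : Fin n) :
    ∃ c : R, ∀ x, rootProd (Function.update a j x) =
      c * ∏ i ∈ Finset.univ.erase j, (x ^ 2 - a i ^ 2) := by
  let s : Fin n → R := fun i => if j < i then 1 else -1
  let g : (Fin n → R) → Fin n → Fin n → R := fun y i l => if i < l then y i ^ 2 - y l ^ 2 else 1
  refine ⟨(∏ i ∈ Finset.univ.erase j, s i) *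
    ∏ i ∈ Finset.univ.erase j, ∏ l ∈ Finset.univ.erase j, g a i l, fun x => ?_⟩
  have h1 : ∀ y : Fin n → R, rootProd y = (∏ i ∈ Finset.univ.erase j, (g y j i * g y i j)) *
      ∏ i ∈ Finset.univ.erase j, ∏ l ∈ Finset.univ.erase j, g y i l := by
    intro y
    have e1 : rootProd y = ∏ i, ∏ l, g y i l := by
      rw [rootProd, ltPairs, Finset.prod_filter, Fintype.prod_prod_type]
    have e2 : ∀ i, ∏ l, g y i l = g y i j * ∏ l ∈ Finset.univ.erase j, g y i l := fun i =>
      (Finset.mul_prod_erase _ _ (Finset.mem_univ j)).symm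
    have e3 : g y j j = 1 := if_neg (lt_irrefl j)
    rw [e1, ← Finset.mul_prod_erase _ _ (Finset.mem_univ j), e2 j, e3, one_mul,
      Finset.prod_congr rfl fun i _ => e2 i, Finset.prod_mul_distrib, Finset.prod_mul_distrib,
      mul_assoc]
  have h2 : ∏ i ∈ Finset.univ.erase j, ∏ l ∈ Finset.univ.erase j, g (Function.update a j x) i l =
      ∏ i ∈ Finset.univ.erase j, ∏ l ∈ Finset.univ.erase j, g a i l := by
    refine Finset.prod_congr rfl fun i hi => Finset.prod_congr rfl fun l hl => ?_
    simp only [g, Function.update_of_ne (Finset.ne_of_mem_erase hi),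
      Function.update_of_ne (Finset.ne_of_mem_erase hl)]
  have h3 : ∏ i ∈ Finset.univ.erase j,
      (g (Function.update a j x) j i * g (Function.update a j x) i j) =
      (∏ i ∈ Finset.univ.erase j, s i) * ∏ i ∈ Finset.univ.erase j, (x ^ 2 - a i ^ 2) := by
    rw [← Finset.prod_mul_distrib]
    refine Finset.prod_congr rfl fun i hi => ?_
    have hne := Finset.ne_of_mem_erase hi
    simp only [g, s, Function.update_self, Function.update_of_ne hne]
    rcases lt_or_gt_of_ne hne with h | h
    · rw [if_neg h.not_gt, if_pos h, if_neg h.not_gt]; ring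
    · rw [if_pos h, if_neg h.not_gt, if_pos h]; ring
  rw [h1, h2, h3]
  ring

theorem rootProd_intCast {n : ℕ} (x : Fin n → ℤ) :
    rootProd (fun i => (x i : ℂ)) = ((rootProd x : ℤ) : ℂ) := by
  simp [rootProd]

theorem rootProd_rho_ne_zero (n : ℕ) : rootProd (fun j : Fin n => (rho n j : ℂ)) ≠ 0 := by
  refine Finset.prod_ne_zero_iff.2 fun p hp => ?_
  have h := mem_ltPairs.1 hp
  have h1 : rho n p.2 < rho n p.1 := by
    have h2 : (p.1 : ℕ) < p.2 := h
    have := p.2.2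
    simp only [rho]
    omega
  have h2 : rho n p.2 ^ 2 < rho n p.1 ^ 2 := Nat.pow_lt_pow_left h1 two_ne_zero
  change (rho n p.1 : ℂ) ^ 2 - (rho n p.2 : ℂ) ^ 2 ≠ 0
  rw [sub_ne_zero]
  exact_mod_cast h2.ne'

end RootProd

/-! ### The decomposition of `Ω` -/

section AbsShift

variable {n : ℕ}

/-- The absolute values `|k_j| + ρ_j` of the coordinates `k_j + ρ_j`. -/
def absShift (k : Fin n → ℤ) (j : Fin n) : ℕ := (k j).natAbs + rho n j

theorem absShift_last [NeZero n] (k : Fin n → ℤ) :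
    absShift k (lastIdx n) = (k (lastIdx n)).natAbs := by
  rw [absShift, rho_last, add_zero]

theorem lt_lastIdx [NeZero n] {j : Fin n} (hj : j ≠ lastIdx n) : j < lastIdx n := by
  have h1 := j.2
  have h2 : (j : ℕ) ≠ n - 1 := fun h => hj (Fin.ext h)
  change (j : ℕ) < n - 1
  omega

theorem eq_absShift_or [NeZero n] {k : Fin n → ℤ} (hk : IsDominant k) (j : Fin n) :
    (rhoZ n + k) j = absShift k j ∨ (rhoZ n + k) j = -(absShift k j : ℤ) := by
  simp only [Pi.add_apply, rhoZ, absShift]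
  by_cases hj : j = lastIdx n
  · rw [hj, rho_last]
    omega
  · have := (abs_nonneg _).trans (hk j _ (lt_lastIdx hj))
    omega

theorem sq_eq_absShift_sq [NeZero n] {k : Fin n → ℤ} (hk : IsDominant k) (j : Fin n) :
    (rhoZ n + k) j ^ 2 = (absShift k j : ℤ) ^ 2 := by
  rcases eq_absShift_or hk j with h | h <;> rw [h]
  ring

theorem absShift_lt {k : Fin n → ℤ} (hk : IsDominant k) {i j : Fin n} (h : i < j) :
    absShift k j < absShift k i := by
  have h1 := hk i j h
  have h2 := rhoZ_strictDominant n i j h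
  simp only [rhoZ] at h2
  simp only [absShift]
  have h3 := abs_nonneg (k j)
  rw [abs_of_nonneg (by positivity)] at h2
  rw [Int.abs_eq_natAbs] at h1
  omega

theorem absShift_injective {k : Fin n → ℤ} (hk : IsDominant k) :
    Function.Injective (absShift k) := by
  intro i j h
  rcases lt_trichotomy i j with h1 | h1 | h1
  · exact absurd h (absShift_lt hk h1).ne'
  · exact h1
  · exact absurd h (absShift_lt hk h1).ne

theorem last_le_absShift [NeZero n] {k : Fin n → ℤ} (hk : IsDominant k) (j : Fin n) :
    (k (lastIdx n)).natAbs ≤ absShift k j := by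
  rw [← absShift_last]
  by_cases hj : j = lastIdx n
  · rw [hj]
  · exact (absShift_lt hk (lt_lastIdx hj)).le

/-- The polynomial `d ∏_{i ≠ j} (X - b_i²) / (b_j² - b_i²)`, with `b_i = |k_i| + ρ_i`. -/
def planchPoly (d : ℕ) (k : Fin n → ℤ) (j : Fin n) : Polynomial ℝ :=
  Polynomial.C (d : ℝ) * Lagrange.basis Finset.univ (fun i => (absShift k i : ℝ) ^ 2) j

theorem absShift_sq_injOn {k : Fin n → ℤ} (hk : IsDominant k) (s : Set (Fin n)) :
    Set.InjOn (fun i => (absShift k i : ℝ) ^ 2) s := by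
  intro i _ j _ h
  have h1 : ((absShift k i : ℕ) : ℝ) = absShift k j :=
    (pow_left_inj₀ (Nat.cast_nonneg _) (Nat.cast_nonneg _) two_ne_zero).1 h
  exact absShift_injective hk (by exact_mod_cast h1)

/-- Lagrange interpolation of a constant. -/
theorem sum_planchPoly [NeZero n] (d : ℕ) {k : Fin n → ℤ} (hk : IsDominant k) (w : ℝ) :
    ∑ j, (planchPoly d k j).eval w = d := by
  have h := Lagrange.sum_basis (absShift_sq_injOn hk (Finset.univ : Finset (Fin n)))
    ⟨lastIdx n, Finset.mem_univ _⟩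
  have h1 := congrArg (fun p => (Polynomial.C (d : ℝ) * p).eval w) h
  simp only [Finset.mul_sum, Polynomial.eval_finsetSum] at h1
  rw [mul_one, Polynomial.eval_C] at h1
  exact h1

theorem planchPoly_eval_self (d : ℕ) {k : Fin n → ℤ} (hk : IsDominant k) (j : Fin n) :
    (planchPoly d k j).eval ((absShift k j : ℝ) ^ 2) = d := by
  rw [planchPoly, Polynomial.eval_mul, Polynomial.eval_C,
    Lagrange.eval_basis_self (v := fun i => (absShift k i : ℝ) ^ 2) (absShift_sq_injOn hk _)
      (Finset.mem_univ j), mul_one]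

theorem natDegree_planchPoly_le (d : ℕ) {k : Fin n → ℤ} (hk : IsDominant k) (j : Fin n) :
    (planchPoly d k j).natDegree ≤ n - 1 := by
  refine (Polynomial.natDegree_C_mul_le _ _).trans ?_
  rw [Lagrange.natDegree_basis (absShift_sq_injOn hk _) (Finset.mem_univ j), Finset.card_univ,
    Fintype.card_fin]

end AbsShift

section Planch

variable {n : ℕ} {V : Type*} [AddCommGroup V] [Module ℂ V] [FiniteDimensional ℂ V]
  {σ : Representation ℂ (Spin n) V}

/-- The coefficients of the digamma terms in `Ω`.  As a polynomial in `w`, the left-hand side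
vanishes at `b_i²` for `i ≠ j`, and at `b_j²` it is `dim σ` by Weyl's dimension formula. -/
theorem rootProd_div_eq [NeZero n] (hσ : IsContinuousRep σ) (hirr : σ.IsIrreducible)
    {k : Fin n → ℤ} (hk : IsHighestWeight σ (fun j => (k j : ℝ))) (j : Fin n) {x : ℂ} {w : ℝ}
    (hx : x ^ 2 = (w : ℂ)) :
    rootProd (Function.update (fun i => ((rhoZ n + k) i : ℂ)) j x) /
      rootProd (fun i => (rho n i : ℂ)) =
      (((planchPoly (Module.finrank ℂ V) k j).eval w : ℝ) : ℂ) := by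
  have hd := hk.isDominant
  obtain ⟨c, hc⟩ := exists_rootProd_update (fun i => ((rhoZ n + k) i : ℂ)) j
  have hsq : ∀ i, (((rhoZ n + k) i : ℤ) : ℂ) ^ 2 = (absShift k i : ℂ) ^ 2 := by
    intro i
    exact_mod_cast congrArg (Int.cast : ℤ → ℂ) (sq_eq_absShift_sq hd i)
  have h1 := finrank_mul_rootProd hσ hirr hk
  have h2 := hc ((rhoZ n + k) j : ℂ)
  rw [Function.update_eq_self, ← h1] at h2
  rw [hc]
  simp only [hsq, hx] at h2 ⊢
  have hρ := rootProd_rho_ne_zero n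
  have hprod : ∏ i ∈ Finset.univ.erase j, ((absShift k j : ℂ) ^ 2 - (absShift k i : ℂ) ^ 2) ≠
      0 := by
    refine Finset.prod_ne_zero_iff.2 fun i hi => ?_
    rw [sub_ne_zero]
    intro h
    have h' : (absShift k j : ℝ) ^ 2 = (absShift k i : ℝ) ^ 2 := by exact_mod_cast h
    exact Finset.ne_of_mem_erase hi
      (absShift_sq_injOn hd Set.univ (Set.mem_univ j) (Set.mem_univ i) h').symm
  rw [planchPoly, Polynomial.eval_mul, Polynomial.eval_C, Lagrange.basis, Polynomial.eval_prod]
  have h3 : ∀ i,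
      ((Lagrange.basisDivisor ((absShift k j : ℝ) ^ 2) ((absShift k i : ℝ) ^ 2)).eval w) =
      ((absShift k j : ℝ) ^ 2 - (absShift k i : ℝ) ^ 2)⁻¹ * (w - (absShift k i : ℝ) ^ 2) := by
    intro i
    simp [Lagrange.basisDivisor]
  simp only [h3]
  push_cast
  rw [Finset.prod_mul_distrib, Finset.prod_inv_distrib]
  field_simp
  linear_combination -(∏ i ∈ Finset.univ.erase j, ((w : ℂ) - (absShift k i : ℂ) ^ 2)) * h2

/-- The coefficients `c_{j,l}`; they are integers because root products of integral weights are
divisible by that of `ρ`. -/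
theorem exists_int_planchPoly [NeZero n] (hσ : IsContinuousRep σ) (hirr : σ.IsIrreducible)
    {k : Fin n → ℤ} (hk : IsHighestWeight σ (fun j => (k j : ℝ))) (j : Fin n) (l : ℕ) :
    ∃ c : ℤ, (planchPoly (Module.finrank ℂ V) k j).eval ((l : ℝ) ^ 2) = c := by
  obtain ⟨c, hc⟩ := rootProd_rho_dvd (Function.update (rhoZ n + k) j (l : ℤ))
  refine ⟨c, ?_⟩
  have h := rootProd_div_eq hσ hirr hk j (x := l) (w := (l : ℝ) ^ 2) (by push_cast; rfl)
  have h1 : Function.update (fun i => ((rhoZ n + k) i : ℂ)) j (l : ℂ) =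
      fun i => ((Function.update (rhoZ n + k) j (l : ℤ) i : ℤ) : ℂ) := by
    funext i
    by_cases hi : i = j
    · subst hi; simp
    · simp [hi]
  have h2 : rootProd (fun i => (rho n i : ℂ)) = ((rootProd (fun i => (rho n i : ℤ)) : ℤ) : ℂ) := by
    rw [← rootProd_intCast]
    rfl
  have hρ := rootProd_rho_ne_zero n
  rw [h1, rootProd_intCast, hc, Int.cast_mul, ← h2, mul_div_cancel_left₀ _ hρ] at h
  exact_mod_cast h.symm

theorem omegaExpr_eq_planch [NeZero n] (hσ : IsContinuousRep σ) (hirr : σ.IsIrreducible)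
    {k : Fin n → ℤ} (hk : IsHighestWeight σ (fun j => (k j : ℝ))) {lam : ℝ} (h : lam ≠ 0) :
    omegaExpr (Module.finrank ℂ V) (fun j => (k j : ℝ)) lam =
      -2 * (Module.finrank ℂ V : ℂ) * (Real.eulerMascheroniConstant : ℂ) -
      ∑ j, (((planchPoly (Module.finrank ℂ V) k j).eval (-lam ^ 2) : ℝ) : ℂ) *
        (Complex.digamma (1 + Complex.I * lam) + Complex.digamma (1 - Complex.I * lam) +
          ∑ l ∈ Finset.range (absShift k j), 2 * (l : ℂ) / ((lam : ℂ) ^ 2 + (l : ℂ) ^ 2) +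
          (absShift k j : ℂ) / ((absShift k j : ℂ) ^ 2 + (lam : ℂ) ^ 2)) := by
  have hs : shifted (fun j => (k j : ℝ)) = fun i => ((rhoZ n + k) i : ℂ) := by
    funext i
    simp [shifted, rhoZ, add_comm]
  rw [omegaExpr_eq, hs, Finset.mul_sum]
  congr 1
  refine Finset.sum_congr rfl fun j _ => ?_
  rw [rootProd_div_eq hσ hirr hk j (w := -lam ^ 2) (by
    rw [mul_pow, Complex.I_sq]; push_cast; ring)]
  have hpsi : psiSum (Complex.I * lam) ((rhoZ n + k) j : ℂ) =
      psiSum (Complex.I * lam) (absShift k j) := by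
    rcases eq_absShift_or hk.isDominant j with h1 | h1
    · rw [h1]; push_cast; rfl
    · rw [h1, Int.cast_neg, psiSum_neg]; push_cast; rfl
  rw [hpsi, psiSum_natCast h]
  ring

end Planch

section Quotient

/-- Division of `R` by `X - l²`, read at `X = -λ²`.  The numerator `l` makes both sides vanish for
`l = 0`, whatever `λ` is. -/
theorem eval_mul_div_eq (R : Polynomial ℝ) (l : ℕ) (lam : ℝ) :
    ((R.eval (-lam ^ 2) : ℝ) : ℂ) * ((l : ℂ) / ((lam : ℂ) ^ 2 + (l : ℂ) ^ 2)) =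
      ((R.eval ((l : ℝ) ^ 2) : ℝ) : ℂ) * ((l : ℂ) / ((lam : ℂ) ^ 2 + (l : ℂ) ^ 2)) -
        (((l : ℝ) * (R /ₘ (Polynomial.X - Polynomial.C ((l : ℝ) ^ 2))).eval (-lam ^ 2) : ℝ) : ℂ) := by
  have h1 := congrArg (Polynomial.eval (-lam ^ 2))
    (Polynomial.modByMonic_add_div R (Polynomial.X - Polynomial.C ((l : ℝ) ^ 2)))
  rw [Polynomial.modByMonic_X_sub_C_eq_C_eval] at h1
  simp only [Polynomial.eval_add, Polynomial.eval_mul, Polynomial.eval_C, Polynomial.eval_sub,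
    Polynomial.eval_X] at h1
  rcases Nat.eq_zero_or_pos l with rfl | hl
  · simp
  · have h2 : (0 : ℝ) < lam ^ 2 + (l : ℝ) ^ 2 := by positivity
    have h3 : (lam : ℂ) ^ 2 + (l : ℂ) ^ 2 ≠ 0 := by exact_mod_cast h2.ne'
    rw [← h1]
    push_cast
    field_simp
    ring

theorem natDegree_divByMonic_add_two_le {m : ℕ} {R : Polynomial ℝ} (h : R.natDegree ≤ m) (x : ℝ) :
    R /ₘ (Polynomial.X - Polynomial.C x) = 0 ∨
      (R /ₘ (Polynomial.X - Polynomial.C x)).natDegree + 1 ≤ m := by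
  rcases Nat.eq_zero_or_pos R.natDegree with h0 | h0
  · left
    rw [Polynomial.divByMonic_eq_zero_iff (Polynomial.monic_X_sub_C x), Polynomial.degree_X_sub_C]
    refine Polynomial.degree_le_natDegree.trans_lt ?_
    rw [h0]
    exact_mod_cast zero_lt_one
  · right
    rw [Polynomial.natDegree_divByMonic _ (Polynomial.monic_X_sub_C x),
        Polynomial.natDegree_X_sub_C]
    omega

/-- The polynomials that are zero or of degree less than `m` form a submodule. -/
theorem mem_degreeLT_iff_natDegree {m : ℕ} {p : Polynomial ℝ} :
    p ∈ Polynomial.degreeLT ℝ m ↔ p = 0 ∨ p.natDegree + 1 ≤ m := by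
  rw [Polynomial.mem_degreeLT]
  by_cases h : p = 0
  · simp [h, bot_lt_iff_ne_bot]
  · rw [Polynomial.degree_eq_natDegree h]
    simp only [h, false_or]
    exact_mod_cast Iff.rfl

end Quotient

section Decomposition

variable {n : ℕ} {V : Type*} [AddCommGroup V] [Module ℂ V]
  {σ : Representation ℂ (Spin n) V}

/-- The polynomial in `X = -λ²` that is left over when the products of the polynomials `planchPoly`
with the fractions `2 l / (λ² + l²)` are reduced. -/
def quotPoly [NeZero n] (d : ℕ) (k : Fin n → ℤ) : Polynomial ℝ :=
  -(∑ j, ∑ l ∈ Finset.Ico (k (lastIdx n)).natAbs (absShift k j), Polynomial.C (2 * (l : ℝ)) *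
      (planchPoly d k j /ₘ (Polynomial.X - Polynomial.C ((l : ℝ) ^ 2)))) -
    ∑ j, Polynomial.C (absShift k j : ℝ) *
      (planchPoly d k j /ₘ (Polynomial.X - Polynomial.C ((absShift k j : ℝ) ^ 2)))

theorem quotPoly_degree [NeZero n] (d : ℕ) {k : Fin n → ℤ} (hk : IsDominant k) :
    quotPoly d k = 0 ∨ (quotPoly d k).natDegree + 1 ≤ n - 1 := by
  rw [← mem_degreeLT_iff_natDegree]
  have h1 : ∀ (j : Fin n) (c x : ℝ), Polynomial.C c *
      (planchPoly d k j /ₘ (Polynomial.X - Polynomial.C x)) ∈ Polynomial.degreeLT ℝ (n - 1) := by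
    intro j c x
    rw [← Polynomial.smul_eq_C_mul]
    exact Submodule.smul_mem _ _ (mem_degreeLT_iff_natDegree.2
      (natDegree_divByMonic_add_two_le (natDegree_planchPoly_le d hk j) x))
  exact Submodule.sub_mem _ (Submodule.neg_mem _ (Submodule.sum_mem _ fun j _ =>
    Submodule.sum_mem _ fun l _ => h1 _ _ _)) (Submodule.sum_mem _ fun j _ => h1 _ _ _)

/-- The right-hand side of the decomposition of `Ω`. -/
def decompExpr [NeZero n] (d : ℕ) (k : Fin n → ℤ) (Q : Polynomial ℝ) (c : Fin n → ℕ → ℤ)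
    (lam : ℝ) : ℂ :=
  -(d : ℂ) * (2 * (Real.eulerMascheroniConstant : ℂ) +
      Complex.digamma (1 + Complex.I * lam) + Complex.digamma (1 - Complex.I * lam) +
      ∑ l ∈ Finset.Ico 1 (k (lastIdx n)).natAbs, 2 * (l : ℂ) / ((lam : ℂ) ^ 2 + (l : ℂ) ^ 2)) -
    ∑ j, ∑ l ∈ Finset.Ico (k (lastIdx n)).natAbs ((k j).natAbs + rho n j),
      (c j l : ℂ) * (2 * (l : ℂ) / ((lam : ℂ) ^ 2 + (l : ℂ) ^ 2)) -
    ∑ j, (d : ℂ) * (((k j).natAbs + rho n j : ℕ) : ℂ) /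
      ((((k j).natAbs + rho n j : ℕ) : ℂ) ^ 2 + (lam : ℂ) ^ 2) -
    ((Q.eval lam : ℝ) : ℂ)

theorem continuousAt_frac (l : ℕ) :
    ContinuousAt (fun lam : ℝ => (l : ℂ) / ((lam : ℂ) ^ 2 + (l : ℂ) ^ 2)) 0 := by
  rcases Nat.eq_zero_or_pos l with rfl | hl
  · simpa using continuousAt_const
  · have h : ((0 : ℝ) : ℂ) ^ 2 + (l : ℂ) ^ 2 ≠ 0 := by
      have : (l : ℂ) ≠ 0 := by exact_mod_cast hl.ne'
      simpa using this
    exact ContinuousAt.div (by fun_prop) (by fun_prop) h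

theorem continuousAt_decompExpr [NeZero n] (d : ℕ) (k : Fin n → ℤ) (Q : Polynomial ℝ)
    (c : Fin n → ℕ → ℤ) : ContinuousAt (decompExpr d k Q c) 0 := by
  have hf : ∀ l : ℕ, ContinuousAt
      (fun lam : ℝ => 2 * (l : ℂ) / ((lam : ℂ) ^ 2 + (l : ℂ) ^ 2)) 0 := fun l => by
    simpa only [mul_div_assoc] using (continuousAt_frac l).const_mul (2 : ℂ)
  have hψ1 : ContinuousAt (fun lam : ℝ => Complex.digamma (1 + Complex.I * lam)) 0 := by
    refine ContinuousAt.comp (g := Complex.digamma) (f := fun lam : ℝ => 1 + Complex.I * (lam : ℂ))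
      ?_ (by fun_prop)
    simpa using continuousAt_digamma_one
  have hψ2 : ContinuousAt (fun lam : ℝ => Complex.digamma (1 - Complex.I * lam)) 0 := by
    refine ContinuousAt.comp (g := Complex.digamma) (f := fun lam : ℝ => 1 - Complex.I * (lam : ℂ))
      ?_ (by fun_prop)
    simpa using continuousAt_digamma_one
  have hb : ∀ b : ℕ, ContinuousAt
      (fun lam : ℝ => (d : ℂ) * (b : ℂ) / ((b : ℂ) ^ 2 + (lam : ℂ) ^ 2)) 0 := fun b => by
    simpa only [mul_div_assoc, add_comm] using (continuousAt_frac b).const_mul (d : ℂ)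
  have hQ : ContinuousAt (fun lam : ℝ => ((Q.eval lam : ℝ) : ℂ)) 0 :=
    Complex.continuous_ofReal.continuousAt.comp Q.continuous.continuousAt
  unfold decompExpr
  refine ((ContinuousAt.sub ?_ ?_).sub ?_).sub hQ
  · refine continuousAt_const.mul (((continuousAt_const.add hψ1).add hψ2).add ?_)
    exact tendsto_finsetSum _ fun l _ => hf l
  · exact tendsto_finsetSum _ fun j _ => tendsto_finsetSum _ fun l _ =>
      (hf l).const_mul (c j l : ℂ)
  · exact tendsto_finsetSum _ fun j _ => hb _

variable [FiniteDimensional ℂ V]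

/-- Reduction of the coefficients modulo `X - l²` yields the decomposition for `λ ≠ 0`.  The digamma
values and the fractions with `l < |k_{n+1}|` occur in all summands, where the coefficients add up
to `dim σ`. -/
theorem omegaExpr_eq_decompExpr [NeZero n] (hσ : IsContinuousRep σ) (hirr : σ.IsIrreducible)
    {k : Fin n → ℤ} (hk : IsHighestWeight σ (fun j => (k j : ℝ))) {c : Fin n → ℕ → ℤ}
    (hc : ∀ j (l : ℕ), (planchPoly (Module.finrank ℂ V) k j).eval ((l : ℝ) ^ 2) = c j l)
    {lam : ℝ} (h : lam ≠ 0) :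
    omegaExpr (Module.finrank ℂ V) (fun j => (k j : ℝ)) lam =
      decompExpr (Module.finrank ℂ V) k
        ((quotPoly (Module.finrank ℂ V) k).comp (-Polynomial.X ^ 2)) c lam := by
  have hd := hk.isDominant
  rw [omegaExpr_eq_planch hσ hirr hk h, decompExpr]
  set d := Module.finrank ℂ V with hdim
  set ψ := Complex.digamma (1 + Complex.I * lam) + Complex.digamma (1 - Complex.I * lam) with hψ
  set m := (k (lastIdx n)).natAbs with hm
  let t : ℕ → ℂ := fun l => 2 * (l : ℂ) / ((lam : ℂ) ^ 2 + (l : ℂ) ^ 2)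
  let P : Fin n → ℂ := fun j => (((planchPoly d k j).eval (-lam ^ 2) : ℝ) : ℂ)
  let S : Fin n → ℕ → ℝ := fun j l =>
    (planchPoly d k j /ₘ (Polynomial.X - Polynomial.C ((l : ℝ) ^ 2))).eval (-lam ^ 2)
  have hsum : ∑ j, P j = d := by
    have := sum_planchPoly d hd (-lam ^ 2)
    simp only [P]
    exact_mod_cast congrArg (fun r : ℝ => (r : ℂ)) this
  -- The fraction with `l = 0` is zero, so the first sum may start at `1`.
  have hsplit : ∀ j, ∑ l ∈ Finset.range (absShift k j), t l =
      ∑ l ∈ Finset.Ico 1 m, t l + ∑ l ∈ Finset.Ico m (absShift k j), t l := by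
    intro j
    rw [Finset.range_eq_Ico, ← Finset.sum_Ico_consecutive t (Nat.zero_le m) (last_le_absShift hd j)]
    congr 1
    rcases Nat.eq_zero_or_pos m with h0 | h0
    · rw [h0]; simp
    · rw [Finset.sum_eq_sum_Ico_succ_bot h0]
      simp [t]
  have hPt : ∀ j l, P j * t l = (c j l : ℂ) * t l - ((2 * (l : ℝ) * S j l : ℝ) : ℂ) := by
    intro j l
    have h1 := eval_mul_div_eq (planchPoly d k j) l lam
    rw [hc] at h1
    simp only [P, t, S]
    push_cast at h1 ⊢
    linear_combination 2 * h1
  have hPb : ∀ j, P j * ((absShift k j : ℂ) / ((absShift k j : ℂ) ^ 2 + (lam : ℂ) ^ 2)) =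
      (d : ℂ) * (absShift k j : ℂ) / ((absShift k j : ℂ) ^ 2 + (lam : ℂ) ^ 2) -
        (((absShift k j : ℝ) * S j (absShift k j) : ℝ) : ℂ) := by
    intro j
    have h1 := eval_mul_div_eq (planchPoly d k j) (absShift k j) lam
    rw [planchPoly_eval_self d hd, add_comm ((lam : ℂ) ^ 2)] at h1
    simp only [P, S]
    push_cast at h1 ⊢
    linear_combination h1
  have hQ : ((((quotPoly d k).comp (-Polynomial.X ^ 2)).eval lam : ℝ) : ℂ) =
      -(∑ j, ∑ l ∈ Finset.Ico m (absShift k j), ((2 * (l : ℝ) * S j l : ℝ) : ℂ)) -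
        ∑ j, (((absShift k j : ℝ) * S j (absShift k j) : ℝ) : ℂ) := by
    rw [Polynomial.eval_comp]
    simp only [quotPoly, Polynomial.eval_sub, Polynomial.eval_neg, Polynomial.eval_finsetSum,
      Polynomial.eval_mul, Polynomial.eval_C, Polynomial.eval_pow, Polynomial.eval_X]
    push_cast
    rfl
  have hexp : ∀ j, P j * (ψ + ∑ l ∈ Finset.range (absShift k j), t l +
      (absShift k j : ℂ) / ((absShift k j : ℂ) ^ 2 + (lam : ℂ) ^ 2)) =
      P j * (ψ + ∑ l ∈ Finset.Ico 1 m, t l) +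
        (∑ l ∈ Finset.Ico m (absShift k j), (c j l : ℂ) * t l -
          ∑ l ∈ Finset.Ico m (absShift k j), ((2 * (l : ℝ) * S j l : ℝ) : ℂ)) +
        ((d : ℂ) * (absShift k j : ℂ) / ((absShift k j : ℂ) ^ 2 + (lam : ℂ) ^ 2) -
          (((absShift k j : ℝ) * S j (absShift k j) : ℝ) : ℂ)) := by
    intro j
    rw [hsplit, ← Finset.sum_sub_distrib, ← Finset.sum_congr rfl fun l _ => hPt j l, ← hPb,
      ← Finset.mul_sum]
    ring
  have htot := Finset.sum_congr (rfl : (Finset.univ : Finset (Fin n)) = Finset.univ)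
    fun j _ => hexp j
  rw [Finset.sum_add_distrib, Finset.sum_add_distrib, ← Finset.sum_mul, hsum,
    Finset.sum_sub_distrib, Finset.sum_sub_distrib] at htot
  rw [hQ]
  change _ - ∑ j, P j * (ψ + ∑ l ∈ Finset.range (absShift k j), t l +
      (absShift k j : ℂ) / ((absShift k j : ℂ) ^ 2 + (lam : ℂ) ^ 2)) =
    -(d : ℂ) * (2 * (Real.eulerMascheroniConstant : ℂ) +
      Complex.digamma (1 + Complex.I * lam) + Complex.digamma (1 - Complex.I * lam) +
      ∑ l ∈ Finset.Ico 1 m, t l) -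
    ∑ j, ∑ l ∈ Finset.Ico m (absShift k j), (c j l : ℂ) * t l -
    ∑ j, (d : ℂ) * (absShift k j : ℂ) / ((absShift k j : ℂ) ^ 2 + (lam : ℂ) ^ 2) - _
  rw [htot]
  ring

theorem exists_isDecomposition [NeZero n] (hσ : IsContinuousRep σ) (hirr : σ.IsIrreducible)
    {k : Fin n → ℤ} (hk : IsHighestWeight σ (fun j => (k j : ℝ))) :
    ∃ (Q : Polynomial ℝ) (c : Fin n → ℕ → ℤ), IsDecomposition σ k Q c := by
  choose c hc using exists_int_planchPoly hσ hirr hk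
  refine ⟨(quotPoly (Module.finrank ℂ V) k).comp (-Polynomial.X ^ 2), c, ?_, ?_, ?_⟩
  · intro lam
    simp [Polynomial.eval_comp]
  · rcases quotPoly_degree (Module.finrank ℂ V) hk.isDominant with h | h
    · left; rw [h, Polynomial.zero_comp]
    · right
      have h1 : (-Polynomial.X ^ 2 : Polynomial ℝ).natDegree = 2 := by
        rw [Polynomial.natDegree_neg, Polynomial.natDegree_X_pow]
      rw [Polynomial.natDegree_comp, h1]
      omega
  · intro lam
    have hev : ∀ᶠ x in 𝓝[≠] (0 : ℝ), decompExpr (Module.finrank ℂ V) k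
        ((quotPoly (Module.finrank ℂ V) k).comp (-Polynomial.X ^ 2)) c x =
        omegaExpr (Module.finrank ℂ V) (highestWeight σ) x := by
      filter_upwards [self_mem_nhdsWithin] with x hx
      rw [highestWeight_eq hk]
      exact (omegaExpr_eq_decompExpr hσ hirr hk hc hx).symm
    change Omega σ lam = decompExpr _ _ _ _ lam
    rw [Omega]
    by_cases h : lam = 0
    -- The value of `Ω` at zero is a limit, and the right-hand side is continuous there.
    · subst h
      rw [Function.update_self]
      exact (((continuousAt_decompExpr _ _ _ _).tendsto.mono_left nhdsWithin_le_nhds).congr'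
        hev).limUnder_eq
    · rw [Function.update_of_ne h, highestWeight_eq hk]
      exact omegaExpr_eq_decompExpr hσ hirr hk hc h

end Decomposition

section Uniqueness

variable {n : ℕ} {V : Type*} [AddCommGroup V] [Module ℂ V]
  {σ : Representation ℂ (Spin n) V}

theorem tendsto_frac_atTop (l : ℕ) : Filter.Tendsto
    (fun lam : ℝ => 2 * (l : ℂ) / ((lam : ℂ) ^ 2 + (l : ℂ) ^ 2)) Filter.atTop (𝓝 0) := by
  have h1 : Filter.Tendsto (fun lam : ℝ => lam ^ 2 + (l : ℝ) ^ 2) Filter.atTop Filter.atTop :=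
    Filter.tendsto_atTop_add_const_right _ _ (Filter.tendsto_pow_atTop two_ne_zero)
  have h2 := (h1.const_div_atTop (2 * (l : ℝ)))
  have h3 := (Complex.continuous_ofReal.tendsto 0).comp h2
  rw [Complex.ofReal_zero] at h3
  refine h3.congr fun lam => ?_
  simp

/-- The polynomial part is unique, since all fractions tend to zero at infinity. -/
theorem IsDecomposition.unique [NeZero n] {k : Fin n → ℤ} {Q Q' : Polynomial ℝ}
    {c c' : Fin n → ℕ → ℤ} (h : IsDecomposition σ k Q c) (h' : IsDecomposition σ k Q' c') :
    Q' = Q := by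
  let D : ℝ → ℂ := fun lam => ∑ j, ∑ l ∈ Finset.Ico (k (lastIdx n)).natAbs ((k j).natAbs + rho n j),
    ((c j l : ℂ) - c' j l) * (2 * (l : ℂ) / ((lam : ℂ) ^ 2 + (l : ℂ) ^ 2))
  have h1 : ∀ lam : ℝ, D lam = (((Q' - Q).eval lam : ℝ) : ℂ) := by
    intro lam
    have e := (h.formula lam).symm.trans (h'.formula lam)
    simp only [D, sub_mul, Finset.sum_sub_distrib]
    rw [Polynomial.eval_sub, Complex.ofReal_sub]
    linear_combination -e
  have h2 : Filter.Tendsto D Filter.atTop (𝓝 0) := by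
    have : Filter.Tendsto D Filter.atTop (𝓝 (∑ j : Fin n,
        ∑ l ∈ Finset.Ico (k (lastIdx n)).natAbs ((k j).natAbs + rho n j),
          ((c j l : ℂ) - c' j l) * 0)) :=
      tendsto_finsetSum _ fun j _ => tendsto_finsetSum _ fun l _ =>
          (tendsto_frac_atTop l).const_mul _
    simpa only [mul_zero, Finset.sum_const_zero] using this
  have h3 : Filter.Tendsto (fun lam : ℝ => (Q' - Q).eval lam) Filter.atTop (𝓝 0) := by
    have h4 := (Complex.continuous_re.tendsto 0).comp (h2.congr h1)
    rw [Complex.zero_re] at h4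
    exact h4.congr fun lam => Complex.ofReal_re _
  exact sub_eq_zero.1 (Polynomial.leadingCoeff_eq_zero.1
    ((Polynomial.tendsto_nhds_iff (Q' - Q)).1 h3).1)

/-- The decomposition depends on `k` only through the absolute values of its coordinates, which `σ`
and `w₀σ` share. -/
theorem IsDecomposition.of_w0Rep [NeZero n] {k k' : Fin n → ℤ} {Q : Polynomial ℝ}
    {c : Fin n → ℕ → ℤ} (hk : IsHighestWeight σ (fun j => (k j : ℝ)))
    (hk' : IsHighestWeight (w0Rep σ) (fun j => (k' j : ℝ)))
    (h : IsDecomposition (w0Rep σ) k' Q c) : IsDecomposition σ k Q c := by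
  have h1 := isHighestWeight_unique hk ((isHighestWeight_w0Rep _).1 hk')
  have h2 : ∀ j, (k' j).natAbs = (k j).natAbs := by
    intro j
    have h3 := congrFun h1 j
    by_cases hj : j = lastIdx n
    · simp only [flipOn, hj, Finset.mem_singleton, if_true] at h3
      have h4 : k (lastIdx n) = -k' (lastIdx n) := by exact_mod_cast h3
      rw [hj, h4, Int.natAbs_neg]
    · simp only [flipOn, hj, Finset.mem_singleton, if_false] at h3
      have h4 : k j = k' j := by exact_mod_cast h3
      rw [h4]
  refine ⟨h.even, h.degree_le, fun lam => ?_⟩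
  have h3 := h.formula lam
  simp only [h2, Omega_w0Rep] at h3
  exact h3

end Uniqueness

end HoffmannOmega

end

theorem proposition5p3 (n : ℕ) [NeZero n] {V : Type*} [AddCommGroup V] [Module ℂ V]
    [FiniteDimensional ℂ V] (σ : Representation ℂ (HoffmannOmega.Spin n) V)
    (hirr : σ.IsIrreducible) (hcont : HoffmannOmega.IsContinuousRep σ) :
    (∀ k : Fin n → ℤ, HoffmannOmega.IsHighestWeight σ (fun j => (k j : ℝ)) →
      ∃ (Q : Polynomial ℝ) (c : Fin n → ℕ → ℤ),
        HoffmannOmega.IsDecomposition σ k Q c ∧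
        (∀ Q' c', HoffmannOmega.IsDecomposition σ k Q' c' → Q' = Q) ∧
        (∀ k' : Fin n → ℤ,
          HoffmannOmega.IsHighestWeight (HoffmannOmega.w0Rep σ) (fun j => (k' j : ℝ)) →
          ∀ Q' c', HoffmannOmega.IsDecomposition (HoffmannOmega.w0Rep σ) k' Q' c' → Q' = Q)) ∧
    (∀ lam : ℝ, HoffmannOmega.Omega σ lam = HoffmannOmega.Omega (HoffmannOmega.w0Rep σ) lam ∧
      HoffmannOmega.Omega σ lam = HoffmannOmega.Omega σ.dual lam) := by
  refine ⟨fun k hk => ?_, fun lam =>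
    ⟨(HoffmannOmega.Omega_w0Rep lam).symm, (HoffmannOmega.Omega_dual hcont lam).symm⟩⟩
  obtain ⟨Q, c, h⟩ := HoffmannOmega.exists_isDecomposition hcont hirr hk
  exact ⟨Q, c, h, fun Q' c' h' => h.unique h', fun k' hk' Q' c' h' => h.unique (h'.of_w0Rep hk hk')⟩
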